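/- Let $W$ be a Gaussian white noise on $\mathbb R\times[0,\infty)$ with Lebesgue control measure (a Gaussian random measure with independent values on disjoint sets), let $\mu$ be the standard normal distribution on $\mathbb R$, and let $\mathfrak X=C([0,1];L_2(\mathbb R,\mu))$ with the norm $\|x\|=\sup_{t\in[0,1]}\left(\int_{\mathbb R}x(u,t)^2\,\mu(du)\right)^{1/2}$. Let $\varphi$ be a real-valued Schwartz function on $\mathbb R$ whose Fourier transform is nonzero Lebesgue-almost everywhere, where $\mathcal F(f)(\lambda)=\int_{\mathbb R}e^{-i\lambda u}f(u)\,du$, extended to $L_2(\mathbb R)$ by Plancherel. Then: (a) For every $\varepsilon>0$ the Gaussian field $$y^\varepsilon(u,t)=u+\sqrt{\varepsilon}\int_0^t\int_{\mathbb R}\varphi(u-p)\,W(dp,ds),\qquad u\in\mathbb R,\ t\in[0,1],$$ has a version that defines a random element of $\mathfrak X$. (b) The family of random elements $\{y^\varepsilon\}_{\varepsilon>0}$ satisfies the large deviation principle in $\mathfrak X$ with the rate function $$I(h)=\begin{cases}\dfrac1{4\pi}\displaystyle\int_0^1\int_{\mathbb R}\left|\frac{\mathcal F(\dot h(\cdot,t))(\lambda)}{\mathcal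 F(\varphi)(\lambda)}\right|^2d\lambda\,dt,& h\in H,\\[2mm]+\infty,& h\in\mathfrak X\setminus H,\end{cases}$$ where $H$ is the set of all functions $h(u,t)=u+\int_0^t\int_{\mathbb R}\varphi(u-p)a(p,s)\,dp\,ds$ with $a\in L_2(\mathbb R\times[0,1])$ and $\dot h$ is the derivative in $t$. That is, $I:\mathfrak X\to[0,\infty]$ is lower semicontinuous, for every closed $F\subset\mathfrak X$ $$\limsup_{\varepsilon\to0+}\varepsilon\log P\{y^\varepsilon\in F\}\le-\inf_{f\in F}I(f),$$ and for every open $G\subset\mathfrak X$ $$\liminf_{\varepsilon\to0+}\varepsilon\log P\{y^\varepsilon\in G\}\ge-\inf_{f\in G}I(f).$$ -/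

import Mathlib

open MeasureTheory ProbabilityTheory Filter Topology Set
open scoped ENNReal NNReal SchwartzMap FourierTransform

noncomputable section

namespace FlowLDP

/-! ### Large deviation principle -/

/-- The family of random elements `Y ε` of `X` (as `ε → 0+`) satisfies the large deviation principle
with rate function `I`. -/
structure SatisfiesLDP {X Ω : Type*} [TopologicalSpace X] [MeasurableSpace Ω] (P : Measure Ω)
    (Y : ℝ → Ω → X) (I : X → ℝ≥0∞) : Prop where
  lowerSemicontinuous : LowerSemicontinuous I
  upper_bound : ∀ F : Set X, IsClosed F →
    limsup (fun ε : ℝ => (ε : EReal) * ENNReal.log (P {ω | Y ε ω ∈ F})) (𝓝[>] 0)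
      ≤ -(⨅ f ∈ F, (I f : EReal))
  lower_bound : ∀ G : Set X, IsOpen G →
    -(⨅ f ∈ G, (I f : EReal))
      ≤ liminf (fun ε : ℝ => (ε : EReal) * ENNReal.log (P {ω | Y ε ω ∈ G})) (𝓝[>] 0)

/-! ### Gaussian random measures and their Wiener integrals -/

/-- `W` is a Gaussian random measure (white noise) with control measure `m`: values on disjoint sets
are independent, `W A` is centred Gaussian with variance `m A`, and `W` is additive almost surely.
(Countable additivity, in `L²` and a.s., follows.) Only measurable sets of finite `m`-measure
matter. -/
structure IsWhiteNoise {E Ω : Type*} [MeasurableSpace E] [MeasurableSpace Ω]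
    (W : Set E → Ω → ℝ) (m : Measure E) (P : Measure Ω) : Prop where
  hasLaw : ∀ A : Set E, MeasurableSet A → m A < ∞ →
    HasLaw (W A) (gaussianReal 0 (m A).toNNReal) P
  indep : ∀ (n : ℕ) (A : Fin n → Set E), (∀ i, MeasurableSet (A i)) → (∀ i, m (A i) < ∞) →
    Pairwise (fun i j => Disjoint (A i) (A j)) → iIndepFun (fun i => W (A i)) P
  additive : ∀ A B : Set E, MeasurableSet A → MeasurableSet B → m A < ∞ → m B < ∞ →
    Disjoint A B → W (A ∪ B) =ᵐ[P] fun ω => W A ω + W B ω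

/-- The integral `∫ g dW` of a simple function, `∑ c, c * W {g = c}`. -/
def simpleIntegral {E Ω : Type*} [MeasurableSpace E] (W : Set E → Ω → ℝ)
    (g : SimpleFunc E ℝ) (ω : Ω) : ℝ :=
  ∑ c ∈ g.range, c * W (g ⁻¹' {c}) ω

/-- `J = ∫ f dW` almost surely, for a deterministic `f ∈ L²(m)`: `J` is the limit in `L²(P)` of
`∫ g dW` for simple functions `g → f` in `L²(m)`. -/
def HasWienerIntegral {E Ω : Type*} [MeasurableSpace E] [MeasurableSpace Ω]
    (W : Set E → Ω → ℝ) (m : Measure E) (P : Measure Ω) (f : E → ℝ) (J : Ω → ℝ) : Prop :=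
  MemLp f 2 m ∧ MemLp J 2 P ∧ ∀ δ : ℝ≥0∞, 0 < δ → ∃ g : SimpleFunc E ℝ, MemLp g 2 m ∧
    eLpNorm (fun x => f x - g x) 2 m < δ ∧
    eLpNorm (fun ω => J ω - simpleIntegral W g ω) 2 P < δ

/-- Lebesgue measure on `ℝ × [0, ∞)`, whose points are written `(p, s)`. -/
def halfPlaneMeasure : Measure (ℝ × ℝ) := volume.restrict (univ ×ˢ Ici (0 : ℝ))

/-! ### The path space and the Gaussian field -/

/-- The standard normal distribution on `ℝ`. -/
abbrev stdNormal : Measure ℝ := gaussianReal 0 1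

/-- `C([0,1]; L₂(ℝ, μ))`, `μ` standard normal, with the supremum norm. -/
abbrev PathSpace : Type := C(Icc (0 : ℝ) 1, Lp ℝ 2 stdNormal)

/-- The random field `y u t` is (a version of) `u + √ε ∫₀ᵗ ∫ φ(u - p) W(dp, ds)`. -/
def IsField {Ω : Type*} [MeasurableSpace Ω] (W : Set (ℝ × ℝ) → Ω → ℝ) (P : Measure Ω)
    (φ : 𝓢(ℝ, ℝ)) (ε : ℝ) (y : ℝ → ℝ → Ω → ℝ) : Prop :=
  ∀ u : ℝ, ∀ t ∈ Icc (0 : ℝ) 1, ∃ J : Ω → ℝ,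
    HasWienerIntegral W halfPlaneMeasure P
      (fun x => (Icc (0 : ℝ) t).indicator (fun _ => φ (u - x.1)) x.2) J ∧
    y u t =ᵐ[P] fun ω => u + √ε * J ω

/-- `Y` is the field `u + √ε ∫₀ᵗ ∫ φ(u - p) W(dp, ds)` regarded as a random element of
`C([0,1]; L₂(μ))`: a Borel measurable map such that, for a version `y` of the field for which every
`y(·, t, ·)` is jointly measurable, almost surely `Y(t) = y(·, t)` in `L₂(μ)` for all `t`. -/
def IsFieldElement {Ω : Type*} [MeasurableSpace Ω] (W : Set (ℝ × ℝ) → Ω → ℝ) (P : Measure Ω)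
    (φ : 𝓢(ℝ, ℝ)) (ε : ℝ) (Y : Ω → PathSpace) : Prop :=
  Measurable[inferInstance, borel PathSpace] Y ∧
  ∃ y : ℝ → ℝ → Ω → ℝ, IsField W P φ ε y ∧
    (∀ t ∈ Icc (0 : ℝ) 1, Measurable fun x : ℝ × Ω => y x.1 t x.2) ∧
    ∀ᵐ ω ∂P, ∀ t : Icc (0 : ℝ) 1, (Y ω t : ℝ → ℝ) =ᵐ[stdNormal] fun u => y u t ω

/-! ### The rate function -/

/-- The set `H` of all `h(u,t) = u + ∫₀ᵗ ∫ φ(u - p) a(p, s) dp ds` with `a ∈ L₂(ℝ × [0,1])`. -/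
def skeletonSet (φ : 𝓢(ℝ, ℝ)) : Set PathSpace :=
  {h | ∃ a : ℝ × ℝ → ℝ, MemLp a 2 (volume.restrict (univ ×ˢ Icc (0 : ℝ) 1)) ∧
    ∀ t : Icc (0 : ℝ) 1, (h t : ℝ → ℝ) =ᵐ[stdNormal]
      fun u => u + ∫ s in (0 : ℝ)..t, ∫ p, φ (u - p) * a (p, s)}

/-- The time derivative `ḣ(·, t)`, taken in the norm of `L₂(μ)`. -/
def timeDeriv (h : PathSpace) (t : ℝ) : Lp ℝ 2 stdNormal :=
  deriv (IccExtend (zero_le_one (α := ℝ)) h) t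

/-- The Fourier transform `∫ exp(-iλu) f(u) du` of a (Schwartz) function. -/
def fourierInt (f : ℝ → ℝ) (l : ℝ) : ℂ :=
  ∫ u : ℝ, Complex.exp (-(Complex.I * l * u)) * (f u : ℂ)

open Classical in
/-- The Fourier transform on `L₂(ℝ, du)` (Plancherel), a function defined almost everywhere,
normalized so that it is `λ ↦ ∫ exp(-iλu) f(u) du` for `f ∈ L₁ ∩ L₂`. Mathlib's transform has
`exp(-2πi ξ u)` as its kernel, whence the dilation. -/
def fourierL2 (f : ℝ → ℝ) (l : ℝ) : ℂ :=
  if hf : MemLp (fun u => (f u : ℂ)) 2 volume then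
    (𝓕 (hf.toLp (fun u => (f u : ℂ))) : Lp ℂ 2 (volume : Measure ℝ)) (l / (2 * Real.pi))
  else 0

open Classical in
/-- The rate function
`(1 / 4π) ∫₀¹ ∫ |F(ḣ(·,t))(λ) / F(φ)(λ)|² dλ dt` on `H`, and `∞` off `H`. -/
def rateFunction (φ : 𝓢(ℝ, ℝ)) (h : PathSpace) : ℝ≥0∞ :=
  if h ∈ skeletonSet φ then
    ENNReal.ofReal (1 / (4 * Real.pi)) *
      ∫⁻ t in Icc (0 : ℝ) 1, ∫⁻ l : ℝ,
        ‖fourierL2 (timeDeriv h t : ℝ → ℝ) l / fourierInt φ l‖ₑ ^ 2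
  else ∞

end FlowLDP

end

namespace FlowLDP

/-! ### The Wiener integral as an isometry with Gaussian values -/

section WienerIntegral

variable {E Ω : Type*} [MeasurableSpace E] [MeasurableSpace Ω] {W : Set E → Ω → ℝ}
  {m : Measure E} {P : Measure Ω}

/-! The result is the large deviation principle for `x₀ + √ε X`, with `X` a centred Gaussian element
of a separable Banach space, followed by an identification of the abstract rate in Fourier terms.

The noise yields an isometry `J = wiener hW` from `L²(ℝ × [0,∞))` into `L²(P)` with centred Gaussian
values, and for fixed `(u, t)` the centred field is `J (kernel φ u t)`. The squared kernel
increments are at most `C (|u - u'| + |t - t'|)`, so Gaussian fourth moments on dyadic grids are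
summable, and chaining produces a jointly measurable version whose paths are continuous into `L²(μ)`
(`IsIsonormal.exists_pathElement`). Every continuous functional of `X` lies in the range of `J`
(`IsIsonormal.exists_dual_ae_eq`), which is the only form of Gaussianity the abstract part uses.

The abstract principle (`satisfiesLDP_gaussian`) has rate `inf ‖a‖² / 2` over the `a` with `x₀ + S a
= h`, where `S a = E[J(a) X]`. It compares `X` with `T n X`, where the `T n` have finite rank and
converge strongly to the identity (Bernstein polynomials in time, orthogonal projections in space).
`T n X` depends on finitely many independent standard normals, for which a Chernoff bound and a
density bound suffice. The remainder is negligible at every exponential rate: it tends to 0 in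
probability, and Fernique's theorem, with constants depending only on a radius carrying mass `3/4`,
turns this into arbitrarily strong Gaussian tails. The same estimate makes `S` compact, hence the
sublevel sets compact.

For the field, `S b` is `∫₀ᵗ φ * b(·, s) ds`, whose time derivative is `φ * b(·, t)` for almost
every `t`. Division by the transform of `φ`, nonzero almost everywhere, recovers the transform of
`b(·, t)`, and Plancherel gives the energy of `b` on the strip; the factor `2π` turns `1 / 4π` into
`1 / 2` (`rateFunction_eq`, `rateFunction_eq_iInf`). Finally any two admissible random elements
agree almost surely (`IsFieldElement.ae_eq`), so the principle does not depend on the version. -/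

lemma IsWhiteNoise.memLp_two (hW : IsWhiteNoise W m P) {A : Set E} (hA : MeasurableSet A)
    (hAm : m A < ∞) : MemLp (W A) 2 P := by
  have h := hW.hasLaw A hA hAm
  have h2 := memLp_id_gaussianReal' (μ := 0) (v := (m A).toNNReal) 2 (by simp)
  rw [← h.map_eq, memLp_map_measure_iff (by fun_prop) h.aemeasurable] at h2
  exact h2

lemma measure_preimage_lt_top_of_memLp {g : SimpleFunc E ℝ} (hg : MemLp g 2 m) {c : ℝ}
    (hc : c ≠ 0) : m (g ⁻¹' {c}) < ∞ :=
  SimpleFunc.measure_preimage_lt_top_of_memLp (by simp) (by simp) g hg c hc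

lemma integral_sq_simpleFunc {g : SimpleFunc E ℝ} (hg : MemLp g 2 m) :
    ∫ x, g x ^ 2 ∂m = ∑ c ∈ g.range, c ^ 2 * m.real (g ⁻¹' {c}) := by
  have hi : Integrable g m := (SimpleFunc.memLp_iff_integrable (by simp) (by simp)).1 hg
  have h1 : Integrable (g.map (fun c => c ^ 2)) m := by
    simpa [Function.comp_def] using hg.integrable_sq
  have := SimpleFunc.map_integral g (fun c : ℝ => c ^ 2) hi (by simp)
  rw [SimpleFunc.integral_eq_integral _ h1] at this
  simpa [mul_comm] using this

/-- The Wiener integral of a simple function is Gaussian. -/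
lemma IsWhiteNoise.hasLaw_simpleIntegral (hW : IsWhiteNoise W m P) {g : SimpleFunc E ℝ}
    (hg : MemLp g 2 m) :
    HasLaw (simpleIntegral W g) (gaussianReal 0 (∫ x, g x ^ 2 ∂m).toNNReal) P := by
  classical
  have h0 : IsProbabilityMeasure P :=
    (hW.hasLaw ∅ .empty (by simp)).isProbabilityMeasure
  -- The value 0 is dropped: its fibre may have infinite measure, where nothing is known about the
  -- noise.
  set s := g.range.filter (· ≠ 0) with hs
  let e := s.equivFin
  have hne (i : Fin s.card) : (e.symm i : ℝ) ≠ 0 := by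
    exact (Finset.mem_filter.1 (e.symm i).2).2
  have hfin (i : Fin s.card) : m (g ⁻¹' {(e.symm i : ℝ)}) < ∞ :=
    measure_preimage_lt_top_of_memLp hg (hne i)
  have hind := hW.indep s.card (fun i => g ⁻¹' {(e.symm i : ℝ)})
    (fun i => g.measurableSet_fiber _) hfin (fun i j hij => by
      refine Disjoint.preimage _ ?_
      rw [Set.disjoint_singleton]
      intro h
      exact hij (e.symm.injective (Subtype.ext h)))
  have hind2 : iIndepFun (fun (i : Fin s.card) ω => (e.symm i : ℝ) * W (g ⁻¹' {(e.symm i : ℝ)}) ω) P :=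
    hind.comp (fun i x => (e.symm i : ℝ) * x) (fun i => by fun_prop)
  have hsum : simpleIntegral W g
      = fun ω => ∑ i : Fin s.card, (e.symm i : ℝ) * W (g ⁻¹' {(e.symm i : ℝ)}) ω := by
    ext ω
    rw [simpleIntegral, ← Finset.sum_filter_of_ne (p := (· ≠ 0)) (by
      intro c _ h hc; simp [hc] at h), ← hs, ← Finset.sum_coe_sort s]
    exact (Equiv.sum_comp e.symm (fun c : s => (c : ℝ) * W (g ⁻¹' {(c : ℝ)}) ω)).symm
  have hlaw (i : Fin s.card) := gaussianReal_const_mul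
    (hW.hasLaw _ (g.measurableSet_fiber _) (hfin i)) (e.symm i : ℝ)
  have hmeas (i : Fin s.card) := (hlaw i).aemeasurable
  refine ⟨?_, ?_⟩
  · rw [hsum]
    exact Finset.aemeasurable_fun_sum _ fun i _ => hmeas i
  · refine Measure.ext_of_charFun ?_
    rw [hsum, hind2.charFun_map_fun_sum_eq_prod hmeas]
    ext t
    rw [Finset.prod_apply]
    simp_rw [(hlaw _).map_eq, charFun_gaussianReal]
    rw [← Complex.exp_sum]
    congr 1
    have hnn : 0 ≤ ∫ x, g x ^ 2 ∂m := integral_nonneg fun x => by positivity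
    have : ∫ x, g x ^ 2 ∂m
        = ∑ i : Fin s.card, (e.symm i : ℝ) ^ 2 * m.real (g ⁻¹' {(e.symm i : ℝ)}) := by
      rw [integral_sq_simpleFunc hg, ← Finset.sum_filter_of_ne (p := (· ≠ 0)) (by
        intro c _ h hc; simp [hc] at h), ← hs, ← Finset.sum_coe_sort s]
      exact (Equiv.sum_comp e.symm (fun c : s => (c : ℝ) ^ 2 * m.real (g ⁻¹' {(c : ℝ)}))).symm
    have h3 : (((∫ x, g x ^ 2 ∂m).toNNReal : ℝ) : ℂ)
        = ∑ i : Fin s.card, ((e.symm i : ℝ) : ℂ) ^ 2 * (m.real (g ⁻¹' {(e.symm i : ℝ)}) : ℂ) := by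
      rw [Real.coe_toNNReal _ hnn, this]
      push_cast
      rfl
    rw [h3]
    simp only [mul_zero, Complex.ofReal_zero, zero_mul, zero_sub, Finset.sum_neg_distrib]
    rw [Finset.sum_mul, Finset.sum_div]
    congr 2
    ext i
    simp [Measure.real, mul_comm, ENNReal.toReal]

lemma gaussianReal_integral_sq_id (v : ℝ≥0) : ∫ x, x ^ 2 ∂(gaussianReal 0 v) = v := by
  have h := variance_fun_id_gaussianReal (μ := 0) (v := v)
  rw [variance_eq_integral (by fun_prop), integral_id_gaussianReal] at h
  simpa using h

lemma norm_sq_eq_integral_sq (f : Lp ℝ 2 m) : ‖f‖ ^ 2 = ∫ x, f x ^ 2 ∂m := by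
  rw [← real_inner_self_eq_norm_sq, L2.inner_def]
  simp [pow_two]

lemma norm_toLp_sq {f : E → ℝ} (hf : MemLp f 2 m) : ‖hf.toLp f‖ ^ 2 = ∫ x, f x ^ 2 ∂m := by
  rw [norm_sq_eq_integral_sq]
  refine integral_congr_ae ?_
  filter_upwards [hf.coeFn_toLp] with x hx
  rw [hx]

/-- The square integrable simple functions. -/
noncomputable def simpleL2 (m : Measure E) : Submodule ℝ (SimpleFunc E ℝ) where
  carrier := {g | MemLp g 2 m}
  add_mem' := fun h1 h2 => by simpa using MemLp.add h1 h2
  zero_mem' := by simp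
  smul_mem' := fun c g h => by simpa using MemLp.const_smul h c

/-- The class in `L²` of a square integrable simple function. -/
noncomputable def simpleToLp (m : Measure E) : simpleL2 m →ₗ[ℝ] Lp ℝ 2 m where
  toFun g := MemLp.toLp g.1 g.2
  map_add' _ _ := rfl
  map_smul' _ _ := rfl

lemma denseRange_simpleToLp : DenseRange (simpleToLp m) := by
  intro f
  rw [Metric.mem_closure_iff]
  intro ε hε
  obtain ⟨g, hg, hg2⟩ := (Lp.memLp f).exists_simpleFunc_eLpNorm_sub_lt (by simp)
    (ε := ENNReal.ofReal ε) (by simpa using hε)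
  refine ⟨_, ⟨⟨g, hg2⟩, rfl⟩, ?_⟩
  rw [dist_eq_norm, Lp.norm_def, ← ENNReal.lt_ofReal_iff_toReal_lt (Lp.eLpNorm_ne_top _)]
  refine lt_of_eq_of_lt (eLpNorm_congr_ae ?_) hg
  filter_upwards [Lp.coeFn_sub f (simpleToLp m ⟨g, hg2⟩), MemLp.coeFn_toLp hg2] with x h1 h2
  rw [h1, Pi.sub_apply, Pi.sub_apply, ← h2]
  rfl

open Classical in
/-- The noise of a set, as an element of `L²(P)`. -/
noncomputable def noiseLp (hW : IsWhiteNoise W m P) (A : Set E) : Lp ℝ 2 P :=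
  if h : MeasurableSet A ∧ m A < ∞ then (hW.memLp_two h.1 h.2).toLp (W A) else 0

lemma coeFn_noiseLp (hW : IsWhiteNoise W m P) {A : Set E} (hA : MeasurableSet A) (hm : m A < ∞) :
    noiseLp hW A =ᵐ[P] W A := by
  rw [noiseLp, dif_pos ⟨hA, hm⟩]
  exact MemLp.coeFn_toLp _

/-- This is the input that makes `SimpleFunc.setToSimpleFunc` linear, so no common refinement of two
simple functions has to be written out. -/
lemma finMeasAdditive_noiseLp (hW : IsWhiteNoise W m P) :
    FinMeasAdditive m (fun A => ContinuousLinearMap.toSpanSingleton ℝ (noiseLp hW A)) := by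
  intro A B hA hB hmA hmB hAB
  have : noiseLp hW (A ∪ B) = noiseLp hW A + noiseLp hW B := by
    refine Lp.ext ?_
    filter_upwards [coeFn_noiseLp hW hA hmA.lt_top, coeFn_noiseLp hW hB hmB.lt_top,
      coeFn_noiseLp hW (hA.union hB) (measure_union_lt_top hmA.lt_top hmB.lt_top),
      Lp.coeFn_add (noiseLp hW A) (noiseLp hW B),
      hW.additive A B hA hB hmA.lt_top hmB.lt_top hAB] with ω h1 h2 h3 h4 h5
    rw [h3, h4, Pi.add_apply, h1, h2, h5]
  ext
  simp [this]

/-- The Wiener integral on simple functions. -/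
noncomputable def simpleWiener (hW : IsWhiteNoise W m P) : simpleL2 m →ₗ[ℝ] Lp ℝ 2 P where
  toFun g := g.1.setToSimpleFunc
    (fun A => ContinuousLinearMap.toSpanSingleton ℝ (noiseLp hW A))
  map_add' g g' := SimpleFunc.setToSimpleFunc_add _ (finMeasAdditive_noiseLp hW)
    ((SimpleFunc.memLp_iff_integrable (by simp) (by simp)).1 g.2)
    ((SimpleFunc.memLp_iff_integrable (by simp) (by simp)).1 g'.2)
  map_smul' c g := SimpleFunc.setToSimpleFunc_smul_real _ (finMeasAdditive_noiseLp hW) c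
    ((SimpleFunc.memLp_iff_integrable (by simp) (by simp)).1 g.2)

lemma coeFn_simpleWiener (hW : IsWhiteNoise W m P) (g : simpleL2 m) :
    simpleWiener hW g =ᵐ[P] simpleIntegral W g.1 := by
  have h1 : ∀ c ∈ g.1.range, ((c • noiseLp hW (g.1 ⁻¹' {c}) : Lp ℝ 2 P) : Ω → ℝ) =ᵐ[P]
      fun ω => c * W (g.1 ⁻¹' {c}) ω := by
    intro c _
    by_cases hc : c = 0
    · subst hc
      rw [zero_smul]
      filter_upwards [Lp.coeFn_zero ℝ 2 P] with ω h
      rw [h]; simp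
    · filter_upwards [Lp.coeFn_smul c (noiseLp hW (g.1 ⁻¹' {c})),
        coeFn_noiseLp hW (g.1.measurableSet_fiber c)
          (measure_preimage_lt_top_of_memLp g.2 hc)] with ω h2 h3
      rw [h2, Pi.smul_apply, h3, smul_eq_mul]
  have h2 : simpleWiener hW g = ∑ c ∈ g.1.range, c • noiseLp hW (g.1 ⁻¹' {c}) := by
    simp [simpleWiener, SimpleFunc.setToSimpleFunc]
  rw [h2]
  filter_upwards [Lp.coeFn_finsetSum g.1.range (fun c => c • noiseLp hW (g.1 ⁻¹' {c})),
    (g.1.range.eventually_all).2 h1] with ω h3 h4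
  rw [h3, Finset.sum_apply, simpleIntegral]
  exact Finset.sum_congr rfl h4

/-- The isometry is read off from the Gaussian law: the second moment is the variance, which is `∫
g²`. -/
lemma norm_simpleWiener (hW : IsWhiteNoise W m P) (g : simpleL2 m) :
    ‖simpleWiener hW g‖ = ‖simpleToLp m g‖ := by
  rw [← sq_eq_sq₀ (norm_nonneg _) (norm_nonneg _)]
  have h1 : ‖simpleToLp m g‖ ^ 2 = ∫ x, g.1 x ^ 2 ∂m := norm_toLp_sq g.2
  have hl := (hW.hasLaw_simpleIntegral g.2).congr (coeFn_simpleWiener hW g)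
  have h2 := hl.integral_comp (f := fun x => x ^ 2) (by fun_prop)
  rw [norm_sq_eq_integral_sq, h1]
  rw [gaussianReal_integral_sq_id, Real.coe_toNNReal _ (integral_nonneg fun x => by positivity)]
    at h2
  exact h2

/-- The Wiener integral `f ↦ ∫ f dW` as an isometry `L²(m) → L²(P)`. -/
noncomputable def wiener (hW : IsWhiteNoise W m P) : Lp ℝ 2 m →ₗᵢ[ℝ] Lp ℝ 2 P where
  toLinearMap := (simpleWiener hW).extendOfNorm (simpleToLp m)
  norm_map' f := by
    refine denseRange_simpleToLp.induction_on f ?_ ?_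
      (p := fun f => ‖(simpleWiener hW).extendOfNorm (simpleToLp m) f‖ = ‖f‖)
    · exact isClosed_eq (by fun_prop) (by fun_prop)
    · intro g
      rw [LinearMap.extendOfNorm_eq denseRange_simpleToLp
        ⟨1, fun g => by rw [norm_simpleWiener, one_mul]⟩, norm_simpleWiener]

lemma wiener_simpleToLp (hW : IsWhiteNoise W m P) (g : simpleL2 m) :
    wiener hW (simpleToLp m g) = simpleWiener hW g :=
  LinearMap.extendOfNorm_eq denseRange_simpleToLp
    ⟨1, fun g => by rw [norm_simpleWiener, one_mul]⟩ g

/-- An isometry from a Hilbert space to `L²(P)` whose values are centred Gaussian variables. -/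
def IsIsonormal {H : Type*} [NormedAddCommGroup H] [InnerProductSpace ℝ H]
    (J : H →ₗᵢ[ℝ] Lp ℝ 2 P) : Prop :=
  ∀ f, HasLaw (J f) (gaussianReal 0 (‖f‖₊ ^ 2)) P

/-- An `L²` convergent sequence has almost surely convergent subsequences and the integrand is
bounded by 1. Characteristic function identities thus pass from simple functions to all of `L²`. -/
lemma continuous_integral_exp_mul_I [IsFiniteMeasure P] (t : ℝ) :
    Continuous fun f : Lp ℝ 2 P => ∫ ω, Complex.exp (t * f ω * Complex.I) ∂P := by
  rw [continuous_iff_seqContinuous]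
  intro f g hfg
  refine tendsto_of_subseq_tendsto ?_
  intro ns hns
  have hm : TendstoInMeasure P (fun n => (f (ns n) : Ω → ℝ)) atTop g :=
    tendstoInMeasure_of_tendsto_Lp (hfg.comp hns)
  obtain ⟨ms, -, hms⟩ := hm.exists_seq_tendsto_ae
  refine ⟨ms, ?_⟩
  refine tendsto_integral_of_dominated_convergence (fun _ => 1) ?_ (integrable_const _) ?_ ?_
  · intro n
    have := (Lp.aestronglyMeasurable (f (ns (ms n))))
    have h : Continuous fun x : ℝ => Complex.exp (t * x * Complex.I) := by fun_prop
    exact h.comp_aestronglyMeasurable this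
  · intro n
    filter_upwards with ω
    rw [← Complex.ofReal_mul, Complex.norm_exp_ofReal_mul_I]
  · filter_upwards [hms] with ω hω
    have h : Continuous fun x : ℝ => Complex.exp (t * x * Complex.I) := by fun_prop
    exact (h.tendsto _).comp hω

lemma isIsonormal_iff {H : Type*} [NormedAddCommGroup H] [InnerProductSpace ℝ H]
    [IsFiniteMeasure P] (J : H →ₗᵢ[ℝ] Lp ℝ 2 P) :
    IsIsonormal J ↔ ∀ f, ∀ t : ℝ, ∫ ω, Complex.exp (t * J f ω * Complex.I) ∂P
      = Complex.exp (-(‖f‖ ^ 2 * t ^ 2 / 2)) := by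
  have hm (f : H) : AEMeasurable (J f) P := (Lp.aestronglyMeasurable (J f)).aemeasurable
  have h1 (f : H) (t : ℝ) : charFun (P.map (J f)) t
      = ∫ ω, Complex.exp (t * J f ω * Complex.I) ∂P := by
    rw [charFun_apply_real, integral_map (hm f)
      (by fun_prop)]
  refine forall_congr' fun f => ⟨fun h t => ?_, fun h => ⟨hm f, ?_⟩⟩
  · rw [← h1, h.map_eq, charFun_gaussianReal]
    simp
  · refine Measure.ext_of_charFun ?_
    ext t
    rw [h1, h t, charFun_gaussianReal]
    simp

lemma isIsonormal_wiener (hW : IsWhiteNoise W m P) : IsIsonormal (wiener hW) := by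
  have h0 : IsProbabilityMeasure P :=
    (hW.hasLaw ∅ .empty (by simp)).isProbabilityMeasure
  rw [isIsonormal_iff]
  intro f t
  refine denseRange_simpleToLp.induction_on f ?_ ?_
    (p := fun f => ∫ ω, Complex.exp (t * wiener hW f ω * Complex.I) ∂P
      = Complex.exp (-(‖f‖ ^ 2 * t ^ 2 / 2)))
  · exact isClosed_eq ((continuous_integral_exp_mul_I t).comp (wiener hW).continuous)
      (by fun_prop)
  · intro g
    have hl := (hW.hasLaw_simpleIntegral g.2).congr (coeFn_simpleWiener hW g)
    have h1 : ‖simpleToLp m g‖ ^ 2 = ∫ x, g.1 x ^ 2 ∂m := norm_toLp_sq g.2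
    have h2 := hl.integral_comp (f := fun x : ℝ => Complex.exp (t * x * Complex.I)) (by fun_prop)
    rw [← charFun_apply_real, charFun_gaussianReal, Real.coe_toNNReal _
      (integral_nonneg fun x => by positivity), ← h1] at h2
    rw [wiener_simpleToLp]
    refine h2.trans ?_
    simp

/-- The same simple function approximates `f` and `J`; by the isometry both candidates lie within `ε
/ 2` of its integral. -/
lemma HasWienerIntegral.ae_eq (hW : IsWhiteNoise W m P) {f : E → ℝ} {J : Ω → ℝ}
    (h : HasWienerIntegral W m P f J) : J =ᵐ[P] wiener hW (h.1.toLp f) := by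
  obtain ⟨hf, hJ, h⟩ := h
  suffices hJ.toLp J = wiener hW (hf.toLp f) by
    rw [← this]
    exact (hJ.coeFn_toLp).symm
  refine eq_of_forall_dist_le fun ε hε => ?_
  obtain ⟨g, hg, h1, h2⟩ := h (ENNReal.ofReal (ε / 2)) (by simpa using hε)
  have e1 : ‖hf.toLp f - simpleToLp m ⟨g, hg⟩‖ < ε / 2 := by
    rw [Lp.norm_def, ← ENNReal.lt_ofReal_iff_toReal_lt (Lp.eLpNorm_ne_top _)]
    refine lt_of_eq_of_lt (eLpNorm_congr_ae ?_) h1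
    filter_upwards [Lp.coeFn_sub (hf.toLp f) (simpleToLp m ⟨g, hg⟩), MemLp.coeFn_toLp hg,
      hf.coeFn_toLp] with x h1 h2 h3
    rw [h1, Pi.sub_apply, h3, ← h2]
    rfl
  have e2 : ‖hJ.toLp J - simpleWiener hW ⟨g, hg⟩‖ < ε / 2 := by
    rw [Lp.norm_def, ← ENNReal.lt_ofReal_iff_toReal_lt (Lp.eLpNorm_ne_top _)]
    refine lt_of_eq_of_lt (eLpNorm_congr_ae ?_) h2
    filter_upwards [Lp.coeFn_sub (hJ.toLp J) (simpleWiener hW ⟨g, hg⟩),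
      coeFn_simpleWiener hW ⟨g, hg⟩, hJ.coeFn_toLp] with x h1 h2 h3
    rw [h1, Pi.sub_apply, h3, h2]
  rw [← wiener_simpleToLp] at e2
  rw [← (wiener hW).norm_map, map_sub] at e1
  rw [dist_eq_norm]
  have := norm_sub_le_norm_sub_add_norm_sub (hJ.toLp J) (wiener hW (simpleToLp m ⟨g, hg⟩))
    (wiener hW (hf.toLp f))
  rw [norm_sub_rev (wiener hW (simpleToLp m ⟨g, hg⟩))] at this
  linarith

lemma hasWienerIntegral_wiener (hW : IsWhiteNoise W m P) {f : E → ℝ} (hf : MemLp f 2 m) :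
    HasWienerIntegral W m P f (wiener hW (hf.toLp f)) := by
  refine ⟨hf, Lp.memLp _, fun δ hδ => ?_⟩
  obtain ⟨g, hg, hg2⟩ := hf.exists_simpleFunc_eLpNorm_sub_lt (by simp) hδ.ne'
  refine ⟨g, hg2, hg, ?_⟩
  have h1 : ‖wiener hW (hf.toLp f) - simpleWiener hW ⟨g, hg2⟩‖ₑ
      = ‖hf.toLp f - simpleToLp m ⟨g, hg2⟩‖ₑ := by
    rw [← wiener_simpleToLp, ← map_sub]
    rw [← ofReal_norm, ← ofReal_norm, (wiener hW).norm_map]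
  rw [Lp.enorm_def, Lp.enorm_def] at h1
  refine lt_of_eq_of_lt ?_ hg
  refine Eq.trans (eLpNorm_congr_ae ?_) (h1.trans (eLpNorm_congr_ae ?_))
  · filter_upwards [Lp.coeFn_sub (wiener hW (hf.toLp f)) (simpleWiener hW ⟨g, hg2⟩),
      coeFn_simpleWiener hW ⟨g, hg2⟩] with x h1 h2
    rw [h1, Pi.sub_apply, h2]
  · filter_upwards [Lp.coeFn_sub (hf.toLp f) (simpleToLp m ⟨g, hg2⟩), MemLp.coeFn_toLp hg2,
      hf.coeFn_toLp] with x h1 h2 h3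
    rw [h1, Pi.sub_apply, h3, Pi.sub_apply, ← h2]
    rfl

/-- The range of an isonormal map is closed under almost sure limits. -/
lemma IsIsonormal.exists_of_tendsto_ae {H : Type*} [NormedAddCommGroup H] [InnerProductSpace ℝ H]
    [CompleteSpace H] [IsProbabilityMeasure P] {J : H →ₗᵢ[ℝ] Lp ℝ 2 P} (hJ : IsIsonormal J)
    {ζ : Ω → ℝ} {f : ℕ → H} (h : ∀ᵐ ω ∂P, Tendsto (fun n => J (f n) ω) atTop (𝓝 (ζ ω))) :
    ∃ g, ζ =ᵐ[P] J g := by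
  -- Almost sure convergence sends the characteristic function of the differences at 1 to 1. For
  -- Gaussian values it equals `exp (-‖f n - f m‖² / 2)`, so `f` is Cauchy in `H`.
  have h1 (p : ℕ × ℕ) : ∫ ω, Complex.exp ((J (f p.1) ω - J (f p.2) ω : ℝ) * Complex.I) ∂P
      = Real.exp (-(‖f p.1 - f p.2‖ ^ 2 / 2)) := by
    have h2 := (isIsonormal_iff J).1 hJ (f p.1 - f p.2) 1
    push_cast
    simp only [Complex.ofReal_one, one_mul, one_pow, mul_one] at h2
    rw [← h2]
    refine integral_congr_ae ?_
    filter_upwards [Lp.coeFn_sub (J (f p.1)) (J (f p.2))] with ω hω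
    rw [map_sub, hω]
    simp
  have h2 : Tendsto (fun p : ℕ × ℕ =>
      ∫ ω, Complex.exp ((J (f p.1) ω - J (f p.2) ω : ℝ) * Complex.I) ∂P)
      (atTop ×ˢ atTop) (𝓝 (∫ _, 1 ∂P)) := by
    refine tendsto_integral_filter_of_dominated_convergence (fun _ => 1) ?_ ?_
      (integrable_const _) ?_
    · refine Eventually.of_forall fun p => ?_
      have h : Continuous fun x : ℝ => Complex.exp (x * Complex.I) := by fun_prop
      exact h.comp_aestronglyMeasurable
        ((Lp.aestronglyMeasurable (J (f p.1))).sub (Lp.aestronglyMeasurable (J (f p.2))))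
    · refine Eventually.of_forall fun p => Eventually.of_forall fun ω => ?_
      rw [Complex.norm_exp_ofReal_mul_I]
    · filter_upwards [h] with ω hω
      have h3 : Tendsto (fun p : ℕ × ℕ => J (f p.1) ω - J (f p.2) ω) (atTop ×ˢ atTop)
          (𝓝 (ζ ω - ζ ω)) := (hω.comp tendsto_fst).sub (hω.comp tendsto_snd)
      have h4 : Continuous fun x : ℝ => Complex.exp (x * Complex.I) := by fun_prop
      have h5 := (h4.tendsto _).comp h3
      simp only [sub_self, Complex.ofReal_zero, zero_mul, Complex.exp_zero] at h5
      exact h5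
  have h3 : Tendsto (fun p : ℕ × ℕ => ‖f p.1 - f p.2‖) (atTop ×ˢ atTop) (𝓝 0) := by
    simp_rw [h1] at h2
    have h4 := (Complex.continuous_re.tendsto _).comp h2
    simp only [integral_const, probReal_univ, one_smul, Complex.one_re, Function.comp_def,
      Complex.ofReal_re] at h4
    have h5 := (Real.continuousAt_log one_ne_zero).tendsto.comp h4
    simp only [Function.comp_def, Real.log_exp, Real.log_one] at h5
    have h6 := (Real.continuous_sqrt.tendsto _).comp (h5.const_mul (-2))
    simp only [mul_zero, Real.sqrt_zero] at h6
    refine h6.congr fun p => ?_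
    simp only [Function.comp_def]
    rw [show -2 * -(‖f p.1 - f p.2‖ ^ 2 / 2) = ‖f p.1 - f p.2‖ ^ 2 by ring,
      Real.sqrt_sq (norm_nonneg _)]
  have h4 : CauchySeq f := by
    rw [cauchySeq_iff_tendsto_dist_atTop_0, ← prod_atTop_atTop_eq]
    simpa only [dist_eq_norm] using h3
  obtain ⟨g, hg⟩ := cauchySeq_tendsto_of_complete h4
  refine ⟨g, ?_⟩
  have hm : TendstoInMeasure P (fun n => (J (f n) : Ω → ℝ)) atTop (J g) :=
    tendstoInMeasure_of_tendsto_Lp ((J.continuous.tendsto g).comp hg)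
  obtain ⟨ms, hms, hms2⟩ := hm.exists_seq_tendsto_ae
  filter_upwards [hms2, h] with ω h5 h6
  exact tendsto_nhds_unique (h6.comp hms.tendsto_atTop) h5

end WienerIntegral

/-! ### Independent coordinates and finite-dimensional Gaussian estimates -/

section Isonormal

variable {Ω H : Type*} [MeasurableSpace Ω] {P : Measure Ω}
  [NormedAddCommGroup H] [InnerProductSpace ℝ H] {J : H →ₗᵢ[ℝ] Lp ℝ 2 P}

lemma measurable_coeFn_Lp (f : Lp ℝ 2 P) : Measurable f := (Lp.stronglyMeasurable f).measurable

lemma IsIsonormal.hasLaw_of_norm_one (hJ : IsIsonormal J) {e : H} (he : ‖e‖ = 1) :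
    HasLaw (J e) (gaussianReal 0 1) P := by
  have := hJ e
  rwa [show ‖e‖₊ ^ 2 = 1 by ext; simp [he]] at this

lemma coeFn_sum_smul {N : ℕ} (J : H →ₗᵢ[ℝ] Lp ℝ 2 P) (c : Fin N → ℝ) (e : Fin N → H) :
    J (∑ i, c i • e i) =ᵐ[P] fun ω => ∑ i, c i * J (e i) ω := by
  rw [map_sum]
  have h1 : ∀ i, J (c i • e i) =ᵐ[P] fun ω => c i * J (e i) ω := by
    intro i
    rw [map_smul]
    filter_upwards [Lp.coeFn_smul (c i) (J (e i))] with ω hω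
    rw [hω, Pi.smul_apply, smul_eq_mul]
  filter_upwards [Lp.coeFn_finsetSum Finset.univ (fun i => J (c i • e i)),
    ae_all_iff.2 h1] with ω h2 h3
  rw [h2, Finset.sum_apply]
  exact Finset.sum_congr rfl fun i _ => h3 i

variable [IsProbabilityMeasure P]

/-- Orthonormal vectors are mapped to independent variables. -/
lemma IsIsonormal.iIndepFun (hJ : IsIsonormal J) {N : ℕ} {e : Fin N → H} (he : Orthonormal ℝ e) :
    iIndepFun (fun i => (J (e i) : Ω → ℝ)) P := by
  have hm (i : Fin N) : Measurable (J (e i)) := measurable_coeFn_Lp _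
  rw [iIndepFun_iff_charFun_pi fun i => (hm i).aemeasurable]
  intro t
  -- A linear combination of coordinates is one Gaussian variable `J (∑ tᵢ eᵢ)` of variance `∑ tᵢ²`,
  -- so the joint characteristic function factors.
  have h1 : charFun (P.map (fun ω => WithLp.toLp 2 fun i => J (e i) ω)) t
      = ∫ ω, Complex.exp ((1 : ℝ) * J (∑ i, t i • e i) ω * Complex.I) ∂P := by
    rw [charFun_apply, integral_map (by fun_prop) (by fun_prop)]
    refine integral_congr_ae ?_
    filter_upwards [coeFn_sum_smul J (fun i => t i) e] with ω hω
    rw [hω, PiLp.inner_apply]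
    simp
  rw [h1, (isIsonormal_iff J).1 hJ]
  simp_rw [(hJ.hasLaw_of_norm_one (he.1 _)).map_eq, charFun_gaussianReal]
  rw [← Complex.exp_sum]
  congr 1
  have h2 : ‖∑ i, t i • e i‖ ^ 2 = ∑ i, t i ^ 2 := by
    rw [← real_inner_self_eq_norm_sq, he.inner_sum]
    simp [pow_two]
  rw [← Complex.ofReal_pow, h2]
  simp [Finset.sum_div]

lemma integrable_exp_mul_sq_gaussianReal {θ : ℝ} (hθ : θ < 1 / 2) :
    Integrable (fun x : ℝ => Real.exp (θ * x ^ 2)) (gaussianReal 0 1) := by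
  rw [gaussianReal_of_var_ne_zero _ one_ne_zero, gaussianPDF_def,
    integrable_withDensity_iff (by fun_prop) (by simp)]
  have h := (integrable_exp_neg_mul_sq (b := 1 / 2 - θ) (by linarith)).mul_const (√(2 * Real.pi * 1))⁻¹
  refine h.congr (Eventually.of_forall fun x => ?_)
  simp only [gaussianPDFReal_def, NNReal.coe_one, sub_zero]
  rw [ENNReal.toReal_ofReal (by positivity), mul_comm (√(2 * Real.pi * 1))⁻¹, ← mul_assoc,
    ← Real.exp_add]
  congr 2
  ring

/-- Gaussian tail of the squared norm of a standard Gaussian vector. -/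
lemma IsIsonormal.measure_sum_sq_le (hJ : IsIsonormal J) {N : ℕ} {e : Fin N → H}
    (he : Orthonormal ℝ e) {l l' : ℝ} (hl : 0 ≤ l) (hll : l < l') :
    ∃ K : ℝ, 0 < K ∧ ∀ ε : ℝ, 0 < ε →
      P {ω | l' ≤ (∑ i, (√ε * J (e i) ω) ^ 2) / 2} ≤ ENNReal.ofReal (K * Real.exp (-l / ε)) := by
  have hl' : 0 < l' := hl.trans_lt hll
  -- With this `θ` the Chernoff exponent at the threshold `2 l' / ε` is exactly `-l / ε`; `l < l'`
  -- gives `θ < 1/2`, so the moment generating function, which serves as `K`, is finite.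
  set θ := l / (2 * l') with hθ
  have hθ0 : 0 ≤ θ := by positivity
  have hθ1 : θ < 1 / 2 := by
    rw [hθ, div_lt_div_iff₀ (by positivity) (by norm_num)]
    linarith
  have hm (i : Fin N) : Measurable (J (e i)) := measurable_coeFn_Lp _
  have hind : ProbabilityTheory.iIndepFun (fun i ω => J (e i) ω ^ 2) P :=
    (hJ.iIndepFun he).comp (fun _ x => x ^ 2) (fun _ => by fun_prop)
  have hint := hind.integrable_exp_mul_sum (t := θ) (fun i => by fun_prop) (s := Finset.univ) (by
    intro i _
    have h := integrable_exp_mul_sq_gaussianReal hθ1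
    have hl := hJ.hasLaw_of_norm_one (he.1 i)
    rw [← hl.map_eq, integrable_map_measure (by fun_prop) (by fun_prop)] at h
    exact h)
  have hpos := mgf_pos hint
  refine ⟨_, hpos, fun ε hε => ?_⟩
  have h := measure_ge_le_exp_mul_mgf (2 * l' / ε) hθ0 hint
  rw [← ofReal_measureReal]
  refine ENNReal.ofReal_le_ofReal ?_
  have e1 : -θ * (2 * l' / ε) = -l / ε := by
    rw [hθ]; field_simp
  rw [e1, mul_comm (Real.exp _)] at h
  convert! h using 3
  ext ω
  simp only [Finset.sum_apply]
  simp_rw [mul_pow, Real.sq_sqrt hε.le, ← Finset.mul_sum]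
  rw [div_le_iff₀ hε, le_div_iff₀ (by norm_num : (0 : ℝ) < 2)]
  constructor <;> intro h <;> linarith

/-- The event is an interval of length `2η / √ε ≥ 2η`, and on it `ε x² ≤ (|α| + η)²` bounds the
density from below. -/
lemma gaussianReal_Ioo_ge (α : ℝ) {η ε : ℝ} (hη : 0 < η) (hε : 0 < ε) (hε1 : ε ≤ 1) :
    ENNReal.ofReal (2 * η * (√(2 * Real.pi))⁻¹ * Real.exp (-((|α| + η) ^ 2 / 2) / ε))
      ≤ gaussianReal 0 1 {x | |√ε * x - α| < η} := by
  have hs : 0 < √ε := Real.sqrt_pos.2 hε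
  have hs1 : √ε ≤ 1 := Real.sqrt_le_one.2 hε1
  have hset : {x : ℝ | |√ε * x - α| < η} = Ioo ((α - η) / √ε) ((α + η) / √ε) := by
    ext x
    rw [Set.mem_ofPred_eq, abs_lt, Set.mem_Ioo, div_lt_iff₀ hs, lt_div_iff₀ hs]
    constructor <;> rintro ⟨h1, h2⟩ <;> constructor <;> linarith
  rw [gaussianReal_apply _ one_ne_zero, hset]
  set c := (√(2 * Real.pi))⁻¹ * Real.exp (-((|α| + η) ^ 2 / 2) / ε) with hc
  have hc0 : 0 ≤ c := by positivity
  have h1 : ∀ x ∈ Ioo ((α - η) / √ε) ((α + η) / √ε), ENNReal.ofReal c ≤ gaussianPDF 0 1 x := by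
    intro x hx
    rw [gaussianPDF, gaussianPDFReal_def]
    refine ENNReal.ofReal_le_ofReal ?_
    simp only [NNReal.coe_one, mul_one, sub_zero]
    rw [hc]
    refine mul_le_mul_of_nonneg_left (Real.exp_le_exp.2 ?_) (by positivity)
    rw [neg_div, neg_div, neg_le_neg_iff, div_div, div_le_div_iff₀ (by norm_num) (by positivity)]
    rw [← hset, Set.mem_ofPred_eq] at hx
    have h2 : |√ε * x| ≤ |α| + η := by
      have := abs_sub_abs_le_abs_sub (√ε * x) α
      linarith
    have h3 : (√ε * x) ^ 2 ≤ (|α| + η) ^ 2 := by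
      rw [← sq_abs (√ε * x)]
      gcongr
    rw [mul_pow, Real.sq_sqrt hε.le] at h3
    linarith
  refine le_trans ?_ (setLIntegral_mono' measurableSet_Ioo h1)
  rw [setLIntegral_const, Real.volume_Ioo, ← ENNReal.ofReal_mul hc0]
  refine ENNReal.ofReal_le_ofReal ?_
  rw [show (α + η) / √ε - (α - η) / √ε = 2 * η / √ε by field_simp; ring,
    show 2 * η * (√(2 * Real.pi))⁻¹ * Real.exp (-((|α| + η) ^ 2 / 2) / ε) = c * (2 * η) by
      rw [hc]; ring]
  gcongr
  rw [le_div_iff₀ hs]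
  nlinarith

lemma IsIsonormal.le_measure_forall_abs_sub_lt (hJ : IsIsonormal J) {N : ℕ} {e : Fin N → H}
    (he : Orthonormal ℝ e) (α : Fin N → ℝ) {η : ℝ} (hη : 0 < η) :
    ∃ k : ℝ, 0 < k ∧ ∀ ε : ℝ, 0 < ε → ε ≤ 1 →
      ENNReal.ofReal (k * Real.exp (-(∑ i, (|α i| + η) ^ 2 / 2) / ε))
        ≤ P {ω | ∀ i, |√ε * J (e i) ω - α i| < η} := by
  refine ⟨∏ _i : Fin N, (2 * η * (√(2 * Real.pi))⁻¹), Finset.prod_pos fun i _ => by positivity,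
    fun ε hε hε1 => ?_⟩
  have h1 := (hJ.iIndepFun he).meas_iInter (s := fun i => {ω | |√ε * J (e i) ω - α i| < η})
    (fun i => ⟨{x | |√ε * x - α i| < η}, measurableSet_lt (by fun_prop) (by fun_prop), rfl⟩)
  rw [show {ω | ∀ i, |√ε * J (e i) ω - α i| < η} = ⋂ i, {ω | |√ε * J (e i) ω - α i| < η} by
    ext; simp, h1, neg_div, Finset.sum_div, ← Finset.sum_neg_distrib, Real.exp_sum,
    ← Finset.prod_mul_distrib, ENNReal.ofReal_prod_of_nonneg fun i _ => by positivity]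
  refine Finset.prod_le_prod' fun i _ => ?_
  have hl := hJ.hasLaw_of_norm_one (he.1 i)
  rw [hl.measure_eq (p := fun x => |√ε * x - α i| < η)
    (measurableSet_lt (by fun_prop) (by fun_prop))]
  refine le_trans (le_of_eq ?_) (gaussianReal_Ioo_ge (α i) hη hε hε1)
  rw [neg_div]

end Isonormal

/-! ### A uniform form of Fernique's theorem -/

section Fernique

variable {𝔛 : Type*} [NormedAddCommGroup 𝔛] [NormedSpace ℝ 𝔛] [CompleteSpace 𝔛]
  [SecondCountableTopology 𝔛] [MeasurableSpace 𝔛] [BorelSpace 𝔛]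

/-- Fernique's theorem with a bound depending only on a radius of a ball of measure `≥ 3/4`. -/
lemma exists_lintegral_exp_sq_norm_le : ∃ c C : ℝ, 0 < c ∧ 0 < C ∧
    ∀ (μ : Measure 𝔛) [IsGaussian μ], (∀ L : StrongDual ℝ 𝔛, μ[L] = 0) → ∀ a : ℝ,
      3 / 4 ≤ μ {x | ‖x‖ ≤ a} →
      ∫⁻ x, ENNReal.ofReal (Real.exp (c * a⁻¹ ^ 2 * ‖x‖ ^ 2)) ∂μ ≤ ENNReal.ofReal C := by
  have h34 : (2⁻¹ : ℝ≥0∞) < 3 / 4 := by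
    rw [← ENNReal.toReal_lt_toReal (by simp) (ENNReal.div_ne_top (by simp) (by simp))]
    simp; norm_num
  have h341 : (3 / 4 : ℝ≥0∞) < 1 := by
    rw [← ENNReal.toReal_lt_toReal (ENNReal.div_ne_top (by simp) (by simp)) (by simp)]
    simp; norm_num
  -- The rotation-invariance bound depends on the measure only through the lower bound `3/4` for the
  -- mass of the ball. As `3/4 > 1/2`, the ratio `(3/4) / (1/4)` exceeds 1 and the series converges.
  set D : ℝ≥0∞ := .ofReal (Real.exp (Fernique.logRatio (3 / 4)))
        + ∑' n : ℕ, .ofReal (Real.exp (-2⁻¹ * Real.log ((3 / 4) / (1 - 3 / 4) : ℝ≥0∞).toReal * 2 ^ n))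
    with hD
  have hDtop : D ≠ ∞ := by
    refine ENNReal.add_ne_top.2 ⟨ENNReal.ofReal_ne_top, ?_⟩
    refine (Summable.tsum_ofReal_lt_top ?_).ne
    refine Real.summable_exp_nat_mul_of_ge ?_ (fun i => mod_cast (Nat.lt_pow_self (by simp)).le)
    refine mul_neg_of_neg_of_pos (by simp) (Real.log_pos ?_)
    rw [ENNReal.toReal_div, ENNReal.toReal_sub_of_le h341.le (by simp)]
    simp; norm_num
  refine ⟨Fernique.logRatio (3 / 4), D.toReal + 1, Fernique.logRatio_pos h34 h341,
    by positivity, fun μ _ hμ a ha => ?_⟩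
  have h := lintegral_exp_mul_sq_norm_le_of_map_rotation_eq_self
    (IsGaussian.map_rotation_eq_self_of_forall_strongDual_eq_zero hμ _) ha h34
  refine h.trans ?_
  rw [← hD]
  rw [ENNReal.le_ofReal_iff_toReal_le hDtop (by positivity)]
  linarith

end Fernique

/-! ### The operator from controls to paths -/

section CorrelationOperator

variable {Ω H 𝔛 : Type*} [MeasurableSpace Ω] {P : Measure Ω}
  [NormedAddCommGroup H] [InnerProductSpace ℝ H]
  [NormedAddCommGroup 𝔛] [NormedSpace ℝ 𝔛]

lemma integrable_coeFn_smul (f : Lp ℝ 2 P) {X : Ω → 𝔛} (hX : MemLp X 2 P) :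
    Integrable (fun ω => f ω • X ω) P :=
  memLp_one_iff_integrable.1 (hX.smul (Lp.memLp f))

lemma norm_integral_coeFn_smul_le (f : Lp ℝ 2 P) {X : Ω → 𝔛} (hX : MemLp X 2 P) :
    ‖∫ ω, f ω • X ω ∂P‖ ≤ (eLpNorm X 2 P).toReal * ‖f‖ := by
  have h1 := eLpNorm_smul_le_mul_eLpNorm (p := 2) (q := 2) (r := 1) hX.1 (Lp.aestronglyMeasurable f)
  rw [eLpNorm_one_eq_lintegral_enorm] at h1
  refine (norm_integral_le_lintegral_norm _).trans ?_
  rw [Lp.norm_def, mul_comm, ← ENNReal.toReal_mul]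
  refine ENNReal.toReal_mono (ENNReal.mul_ne_top (Lp.eLpNorm_ne_top f) hX.eLpNorm_ne_top) ?_
  simp_rw [ofReal_norm]
  exact h1

/-- The operator `a ↦ E[J a • X]`. -/
noncomputable def correlationOp (J : H →ₗᵢ[ℝ] Lp ℝ 2 P) {X : Ω → 𝔛} (hX : MemLp X 2 P) :
    H →L[ℝ] 𝔛 :=
  LinearMap.mkContinuous
    { toFun := fun a => ∫ ω, J a ω • X ω ∂P
      map_add' := fun a b => by
        rw [← integral_add (integrable_coeFn_smul _ hX) (integrable_coeFn_smul _ hX), map_add]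
        refine integral_congr_ae ?_
        filter_upwards [Lp.coeFn_add (J a) (J b)] with ω hω
        rw [hω, Pi.add_apply, add_smul]
      map_smul' := fun c a => by
        rw [map_smul, RingHom.id_apply, ← integral_smul]
        refine integral_congr_ae ?_
        filter_upwards [Lp.coeFn_smul c (J a)] with ω hω
        rw [hω, Pi.smul_apply, smul_smul, smul_eq_mul] }
    (eLpNorm X 2 P).toReal
    (fun a => by simpa using norm_integral_coeFn_smul_le (J a) hX)

lemma correlationOp_apply (J : H →ₗᵢ[ℝ] Lp ℝ 2 P) {X : Ω → 𝔛} (hX : MemLp X 2 P) (a : H) :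
    correlationOp J hX a = ∫ ω, J a ω • X ω ∂P := rfl

variable [CompleteSpace 𝔛]

lemma map_correlationOp {F : Type*} [NormedAddCommGroup F] [NormedSpace ℝ F] [CompleteSpace F]
    (J : H →ₗᵢ[ℝ] Lp ℝ 2 P) {X : Ω → 𝔛} (hX : MemLp X 2 P) (A : 𝔛 →L[ℝ] F) (a : H) :
    A (correlationOp J hX a) = ∫ ω, J a ω • A (X ω) ∂P := by
  rw [correlationOp_apply, ← A.integral_comp_comm (integrable_coeFn_smul _ hX)]
  simp

/-- `correlationOp` is the adjoint of `L ↦ g`, where `L X = J g`: both sides are `E[J g · J a]`. -/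
lemma dual_correlationOp (J : H →ₗᵢ[ℝ] Lp ℝ 2 P) {X : Ω → 𝔛} (hX : MemLp X 2 P)
    {L : StrongDual ℝ 𝔛} {g : H} (h : (fun ω => L (X ω)) =ᵐ[P] J g) (a : H) :
    L (correlationOp J hX a) = inner ℝ g a := by
  rw [map_correlationOp, ← J.inner_map_map, L2.inner_def]
  refine integral_congr_ae ?_
  filter_upwards [h] with ω hω
  rw [hω]
  simp

/-- By Cauchy–Schwarz in `L²(P)`, a bound on `A X` in mean square becomes an operator norm bound. -/
lemma norm_comp_correlationOp_le (J : H →ₗᵢ[ℝ] Lp ℝ 2 P) {X : Ω → 𝔛} (hX : MemLp X 2 P)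
    (A : 𝔛 →L[ℝ] 𝔛) :
    ‖A ∘L correlationOp J hX‖ ≤ (eLpNorm (fun ω => A (X ω)) 2 P).toReal := by
  refine ContinuousLinearMap.opNorm_le_bound _ ENNReal.toReal_nonneg fun a => ?_
  rw [ContinuousLinearMap.comp_apply, map_correlationOp, ← J.norm_map]
  exact norm_integral_coeFn_smul_le (J a) (A.comp_memLp' hX)

end CorrelationOperator

/-! ### Finite-rank images of a Gaussian element -/

section FiniteRank

variable {𝔛 : Type*} [NormedAddCommGroup 𝔛] [NormedSpace ℝ 𝔛]

lemma exists_eq_sum_smul_of_finiteDimensional_range (T : 𝔛 →L[ℝ] 𝔛)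
    [FiniteDimensional ℝ (LinearMap.range (T : 𝔛 →ₗ[ℝ] 𝔛))] :
    ∃ (n : ℕ) (L : Fin n → StrongDual ℝ 𝔛) (w : Fin n → 𝔛), ∀ x, T x = ∑ i, L i x • w i := by
  let V := LinearMap.range (T : 𝔛 →ₗ[ℝ] 𝔛)
  let b := Module.finBasis ℝ V
  let T' : 𝔛 →L[ℝ] V := T.codRestrict V fun x => ⟨x, rfl⟩
  refine ⟨_, fun i => (LinearMap.toContinuousLinearMap (b.coord i)) ∘L T', fun i => b i, fun x => ?_⟩
  have h := congrArg (Subtype.val) (b.sum_repr (T' x))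
  rw [Submodule.coe_sum] at h
  exact h.symm

/-- A finite rank operator applied to `X` only sees finitely many orthonormal directions. -/
lemma exists_orthonormal_of_finiteRank {Ω H : Type*} [MeasurableSpace Ω] {P : Measure Ω}
    [NormedAddCommGroup H] [InnerProductSpace ℝ H] [CompleteSpace 𝔛]
    {J : H →ₗᵢ[ℝ] Lp ℝ 2 P} {X : Ω → 𝔛}
    (hXJ : ∀ L : StrongDual ℝ 𝔛, ∃ g, (fun ω => L (X ω)) =ᵐ[P] J g) (hX2 : MemLp X 2 P)
    (T : 𝔛 →L[ℝ] 𝔛) [FiniteDimensional ℝ (LinearMap.range (T : 𝔛 →ₗ[ℝ] 𝔛))] :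
    ∃ (N : ℕ) (e : Fin N → H), Orthonormal ℝ e ∧
      (∀ᵐ ω ∂P, T (X ω) = ∑ i, J (e i) ω • T (correlationOp J hX2 (e i))) ∧
      ∀ a, T (correlationOp J hX2 a)
        = ∑ i, inner ℝ (e i) a • T (correlationOp J hX2 (e i)) := by
  obtain ⟨n, L, w, hT⟩ := exists_eq_sum_smul_of_finiteDimensional_range T
  choose g hg using fun i => hXJ (L i)
  -- The functionals defining `T` correspond to finitely many `g i`; an orthonormal basis of their
  -- span expands `T X` and `T S a` with the same vectors `T S eₖ`.
  let E := Submodule.span ℝ (Set.range g)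
  have : FiniteDimensional ℝ E := FiniteDimensional.span_of_finite ℝ (Set.finite_range g)
  let b := stdOrthonormalBasis ℝ E
  have hgE (i : Fin n) : g i ∈ E := Submodule.subset_span ⟨i, rfl⟩
  have hexp (i : Fin n) : g i = ∑ k, inner ℝ (b k : H) (g i) • (b k : H) := by
    have h := congrArg Subtype.val (b.sum_repr ⟨g i, hgE i⟩)
    rw [Submodule.coe_sum] at h
    simpa [b.repr_apply_apply] using h.symm
  have hS (a : H) : T (correlationOp J hX2 a) = ∑ i, inner ℝ (g i) a • w i := by
    rw [hT]
    exact Finset.sum_congr rfl fun i _ => by rw [dual_correlationOp J hX2 (hg i)]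
  refine ⟨_, fun k => (b k : H), ?_, ?_, ?_⟩
  · exact b.orthonormal.comp_linearIsometry E.subtypeₗᵢ
  · have h1 (i : Fin n) : J (g i) =ᵐ[P] fun ω => ∑ k, inner ℝ (b k : H) (g i) * J (b k) ω := by
      conv_lhs => rw [hexp i]
      exact coeFn_sum_smul J _ _
    filter_upwards [ae_all_iff.2 hg, ae_all_iff.2 h1] with ω h2 h3
    rw [hT]
    simp_rw [h2, h3, hS, Finset.sum_smul, Finset.smul_sum, smul_smul]
    rw [Finset.sum_comm]
    refine Finset.sum_congr rfl fun k _ => Finset.sum_congr rfl fun i _ => ?_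
    rw [real_inner_comm, mul_comm]
  · intro a
    rw [hS]
    have h1 (i : Fin n) : inner ℝ (g i) a = ∑ k, inner ℝ (b k : H) (g i) * inner ℝ (b k : H) a := by
      conv_lhs => rw [hexp i]
      simp [sum_inner, real_inner_smul_left]
    simp_rw [h1, hS, Finset.sum_smul, Finset.smul_sum, smul_smul]
    rw [Finset.sum_comm]
    refine Finset.sum_congr rfl fun k _ => Finset.sum_congr rfl fun i _ => ?_
    rw [real_inner_comm, mul_comm]

end FiniteRank

/-! ### Exponential tails of remainders and compactness -/

section GaussianElement

variable {Ω H 𝔛 : Type*} [MeasurableSpace Ω] {P : Measure Ω}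
  [NormedAddCommGroup H] [InnerProductSpace ℝ H]
  [NormedAddCommGroup 𝔛] [NormedSpace ℝ 𝔛] [MeasurableSpace 𝔛] [BorelSpace 𝔛]
  {J : H →ₗᵢ[ℝ] Lp ℝ 2 P} {X : Ω → 𝔛}

lemma map_dual_comp_eq_gaussianReal (hJ : IsIsonormal J) (hX : Measurable X)
    (hXJ : ∀ L : StrongDual ℝ 𝔛, ∃ g, (fun ω => L (X ω)) =ᵐ[P] J g) (A : 𝔛 →L[ℝ] 𝔛)
    (L : StrongDual ℝ 𝔛) : ∃ v, (P.map (fun ω => A (X ω))).map L = gaussianReal 0 v := by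
  obtain ⟨g, hg⟩ := hXJ (L ∘L A)
  refine ⟨‖g‖₊ ^ 2, ?_⟩
  rw [Measure.map_map (by fun_prop) (by fun_prop)]
  exact ((hJ g).congr hg).map_eq

lemma isGaussian_map_comp (hJ : IsIsonormal J) (hX : Measurable X)
    (hXJ : ∀ L : StrongDual ℝ 𝔛, ∃ g, (fun ω => L (X ω)) =ᵐ[P] J g) (A : 𝔛 →L[ℝ] 𝔛) :
    IsGaussian (P.map (fun ω => A (X ω))) :=
  isGaussian_of_map_eq_gaussianReal fun L =>
    ⟨0, map_dual_comp_eq_gaussianReal hJ hX hXJ A L⟩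

variable [CompleteSpace 𝔛] [SecondCountableTopology 𝔛]

/-- All functionals of `X` are Gaussian, so its law is a Gaussian measure, which has a second
moment. -/
lemma memLp_two_of_dual (hJ : IsIsonormal J) (hX : Measurable X)
    (hXJ : ∀ L : StrongDual ℝ 𝔛, ∃ g, (fun ω => L (X ω)) =ᵐ[P] J g) : MemLp X 2 P := by
  have := isGaussian_map_comp hJ hX hXJ (.id ℝ 𝔛)
  have h := IsGaussian.memLp_two_id (μ := P.map (fun ω => ContinuousLinearMap.id ℝ 𝔛 (X ω)))
  rwa [memLp_map_measure_iff (by fun_prop) (by fun_prop)] at h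

variable [IsProbabilityMeasure P]

/-- If `A n → 0` strongly then `A n X` is eventually small in a Gaussian sense. -/
lemma eventually_lintegral_exp_sq_le (hJ : IsIsonormal J) (hX : Measurable X)
    (hXJ : ∀ L : StrongDual ℝ 𝔛, ∃ g, (fun ω => L (X ω)) =ᵐ[P] J g) {A : ℕ → 𝔛 →L[ℝ] 𝔛}
    (hA : ∀ x, Tendsto (fun n => A n x) atTop (𝓝 0)) :
    ∃ C : ℝ, 0 < C ∧ ∀ M : ℝ, 0 < M → ∀ᶠ n in atTop,
      ∫⁻ ω, ENNReal.ofReal (Real.exp (M * ‖A n (X ω)‖ ^ 2)) ∂P ≤ ENNReal.ofReal C := by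
  obtain ⟨c, C, hc, hC, h⟩ := exists_lintegral_exp_sq_norm_le (𝔛 := 𝔛)
  refine ⟨C, hC, fun M hM => ?_⟩
  -- The radius is chosen so that Fernique's exponent `c / a²` equals `M`. Convergence in
  -- probability puts mass `3/4` in that ball for large `n`, and `C` does not depend on `M`.
  set a := √(c / M) with ha
  have ha0 : 0 < a := Real.sqrt_pos.2 (by positivity)
  have haM : c * a⁻¹ ^ 2 = M := by
    rw [inv_pow, ha, Real.sq_sqrt (by positivity)]
    field_simp
  have hm (n : ℕ) : Measurable fun ω => A n (X ω) := by fun_prop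
  have h1 : TendstoInMeasure P (fun n ω => A n (X ω)) atTop (fun _ => 0) :=
    tendstoInMeasure_of_tendsto_ae (fun n => (hm n).aestronglyMeasurable)
      (Eventually.of_forall fun ω => hA (X ω))
  have h2 := (tendstoInMeasure_iff_norm.1 h1) a ha0
  have h3 : ∀ᶠ n in atTop, P {ω | a ≤ ‖A n (X ω) - 0‖} < 1 / 4 :=
    h2.eventually_lt_const (by simp)
  filter_upwards [h3] with n hn
  have := isGaussian_map_comp hJ hX hXJ (A n)
  have h4 := h (P.map (fun ω => A n (X ω))) (fun L => by
    obtain ⟨v, hv⟩ := map_dual_comp_eq_gaussianReal hJ hX hXJ (A n) L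
    have h5 := integral_map (μ := P.map (fun ω => A n (X ω))) (φ := L) (by fun_prop)
      (f := fun x : ℝ => x) (by fun_prop)
    rw [← h5, hv, integral_id_gaussianReal]) a ?_
  · rw [lintegral_map (by fun_prop) (hm n), haM] at h4
    exact h4
  · rw [Measure.map_apply (hm n) (measurableSet_le (by fun_prop) (by fun_prop))]
    have h5 : {ω | a ≤ ‖A n (X ω) - 0‖}ᶜ ⊆ (fun ω => A n (X ω)) ⁻¹' {x | ‖x‖ ≤ a} := by
      intro ω hω
      simp only [sub_zero, mem_compl_iff, mem_ofPred_eq, not_le] at hω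
      exact hω.le
    refine le_trans ?_ (measure_mono h5)
    rw [prob_compl_eq_one_sub (measurableSet_le (by fun_prop) (by fun_prop))]
    refine ENNReal.le_sub_of_add_le_right (by finiteness) ?_
    calc (3 / 4 : ℝ≥0∞) + P {ω | a ≤ ‖A n (X ω) - 0‖} ≤ 3 / 4 + 1 / 4 := by gcongr
      _ = 1 := by
        rw [ENNReal.div_add_div_same, ENNReal.div_eq_one_iff (by simp) (by simp)]
        norm_num

/-- Exponential Markov inequality with `M = l / δ²`. A single `n` serves all `ε` at once, because
`ε` enters only through scaling. -/
lemma eventually_measure_le_exp (hJ : IsIsonormal J) (hX : Measurable X)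
    (hXJ : ∀ L : StrongDual ℝ 𝔛, ∃ g, (fun ω => L (X ω)) =ᵐ[P] J g) {A : ℕ → 𝔛 →L[ℝ] 𝔛}
    (hA : ∀ x, Tendsto (fun n => A n x) atTop (𝓝 0)) {δ : ℝ} (hδ : 0 < δ) {l : ℝ} (hl : 0 < l) :
    ∃ C : ℝ, 0 < C ∧ ∀ᶠ n in atTop, ∀ ε : ℝ, 0 < ε →
      P {ω | δ ≤ √ε * ‖A n (X ω)‖} ≤ ENNReal.ofReal (C * Real.exp (-l / ε)) := by
  obtain ⟨C, hC, h⟩ := eventually_lintegral_exp_sq_le hJ hX hXJ hA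
  refine ⟨C, hC, ?_⟩
  filter_upwards [h (l / δ ^ 2) (by positivity)] with n hn ε hε
  have h1 : {ω | δ ≤ √ε * ‖A n (X ω)‖} ⊆ {ω | ENNReal.ofReal (Real.exp (l / ε))
      ≤ ENNReal.ofReal (Real.exp (l / δ ^ 2 * ‖A n (X ω)‖ ^ 2))} := by
    intro ω hω
    simp only [mem_ofPred_eq] at hω ⊢
    refine ENNReal.ofReal_le_ofReal (Real.exp_le_exp.2 ?_)
    have h2 : δ ^ 2 ≤ ε * ‖A n (X ω)‖ ^ 2 := by
      calc δ ^ 2 ≤ (√ε * ‖A n (X ω)‖) ^ 2 := by gcongr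
        _ = _ := by rw [mul_pow, Real.sq_sqrt hε.le]
    rw [div_mul_eq_mul_div, div_le_div_iff₀ hε (by positivity)]
    nlinarith
  refine (measure_mono h1).trans ?_
  have h3 := meas_ge_le_lintegral_div (μ := P)
    (f := fun ω => ENNReal.ofReal (Real.exp (l / δ ^ 2 * ‖A n (X ω)‖ ^ 2)))
    (by fun_prop) (ε := ENNReal.ofReal (Real.exp (l / ε)))
    (by simpa using Real.exp_pos _) ENNReal.ofReal_ne_top
  refine h3.trans ?_
  rw [neg_div, Real.exp_neg, ← div_eq_mul_inv, ENNReal.ofReal_div_of_pos (Real.exp_pos _)]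
  gcongr

/-- Strong convergence of `A n` improves to norm convergence after composition with the correlation
operator, since the exponential moments control `E ‖A n X‖²`. -/
lemma tendsto_norm_comp_correlationOp (hJ : IsIsonormal J) (hX : Measurable X)
    (hXJ : ∀ L : StrongDual ℝ 𝔛, ∃ g, (fun ω => L (X ω)) =ᵐ[P] J g) {A : ℕ → 𝔛 →L[ℝ] 𝔛}
    (hA : ∀ x, Tendsto (fun n => A n x) atTop (𝓝 0)) (hX2 : MemLp X 2 P) :
    Tendsto (fun n => ‖A n ∘L correlationOp J hX2‖) atTop (𝓝 0) := by
  obtain ⟨C, hC, h⟩ := eventually_lintegral_exp_sq_le hJ hX hXJ hA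
  rw [Metric.tendsto_atTop']
  intro η hη
  -- From `M x ≤ exp (M x)` one gets `E ‖A n X‖² ≤ C / M`; this `M` makes the bound `(η / 2)²`.
  obtain ⟨n₀, hn₀⟩ := eventually_atTop.1 (h (4 * C / η ^ 2) (by positivity))
  refine ⟨n₀, fun n hn => ?_⟩
  have h1 := hn₀ n hn.le
  rw [dist_zero_right, norm_norm]
  refine (norm_comp_correlationOp_le J hX2 (A n)).trans_lt ?_
  suffices eLpNorm (fun ω => A n (X ω)) 2 P ≤ ENNReal.ofReal (η / 2) from
    (ENNReal.toReal_le_of_le_ofReal (by positivity) this).trans_lt (by linarith)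
  rw [← ENNReal.rpow_le_rpow_iff (z := 2) (by norm_num),
    eLpNorm_eq_lintegral_rpow_enorm_toReal (by simp) (by simp)]
  simp only [ENNReal.toReal_ofNat, ENNReal.rpow_ofNat, one_div]
  rw [← ENNReal.rpow_natCast, ← ENNReal.rpow_mul]
  norm_num
  have h2 : ∀ ω, ENNReal.ofReal (4 * C / η ^ 2) * ‖A n (X ω)‖ₑ ^ 2
      ≤ ENNReal.ofReal (Real.exp (4 * C / η ^ 2 * ‖A n (X ω)‖ ^ 2)) := by
    intro ω
    rw [← ofReal_norm, ← ENNReal.ofReal_pow (norm_nonneg _), ← ENNReal.ofReal_mul (by positivity)]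
    refine ENNReal.ofReal_le_ofReal ?_
    linarith [Real.add_one_le_exp (4 * C / η ^ 2 * ‖A n (X ω)‖ ^ 2)]
  have h3 := (lintegral_mono h2).trans h1
  rw [lintegral_const_mul _ (by fun_prop)] at h3
  have h4 : ENNReal.ofReal C = ENNReal.ofReal (4 * C / η ^ 2) * ENNReal.ofReal (η / 2) ^ 2 := by
    rw [← ENNReal.ofReal_pow (by positivity), ← ENNReal.ofReal_mul (by positivity)]
    congr 1
    field_simp
    norm_num
  rw [h4] at h3
  exact (ENNReal.mul_le_mul_iff_right (by simpa using by positivity) ENNReal.ofReal_ne_top).1 h3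

/-- Images of balls under the correlation operator are compact. -/
lemma isCompact_image_correlationOp [CompleteSpace H] (hJ : IsIsonormal J) (hX : Measurable X)
    (hXJ : ∀ L : StrongDual ℝ 𝔛, ∃ g, (fun ω => L (X ω)) =ᵐ[P] J g) {T : ℕ → 𝔛 →L[ℝ] 𝔛}
    (hfin : ∀ n, FiniteDimensional ℝ (LinearMap.range (T n : 𝔛 →ₗ[ℝ] 𝔛)))
    (hT : ∀ x, Tendsto (fun n => T n x) atTop (𝓝 x)) (hX2 : MemLp X 2 P) (r : ℝ) :
    IsCompact (correlationOp J hX2 '' Metric.closedBall 0 r) := by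
  let S := correlationOp J hX2
  -- Riesz and Banach–Alaoglu make the ball weakly compact. Each `T n ∘ S` is weakly continuous,
  -- being of finite rank, and converges to `S` uniformly on the ball, so `S` is weak-to-norm
  -- continuous there.
  let D : WeakDual ℝ H → H := fun w => (InnerProductSpace.toDual ℝ H).symm (WeakDual.toStrongDual w)
  let B : Set (WeakDual ℝ H) := WeakDual.toStrongDual ⁻¹' Metric.closedBall 0 r
  have hB : IsCompact B := WeakDual.isCompact_closedBall _ _
  have himg : S '' Metric.closedBall 0 r = (S ∘ D) '' B := by
    rw [image_comp]
    congr 1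
    ext x
    constructor
    · intro hx
      refine ⟨WeakDual.toStrongDual.symm (InnerProductSpace.toDual ℝ H x), ?_, ?_⟩
      · simpa [B] using hx
      · simp [D]
    · rintro ⟨w, hw, rfl⟩
      simpa [B, D] using hw
  rw [himg]
  refine hB.image_of_continuousOn ?_
  have hnorm : Tendsto (fun n => ‖(T n - .id ℝ 𝔛) ∘L S‖) atTop (𝓝 0) := by
    refine tendsto_norm_comp_correlationOp hJ hX hXJ (fun x => ?_) hX2
    simpa using (hT x).sub_const x
  have hunif : TendstoUniformlyOn (fun n w => T n (S (D w))) (S ∘ D) atTop B := by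
    rw [Metric.tendstoUniformlyOn_iff]
    intro η hη
    have h1 : Tendsto (fun n => ‖(T n - .id ℝ 𝔛) ∘L S‖ * r) atTop (𝓝 0) := by
      simpa using hnorm.mul_const r
    filter_upwards [h1.eventually_lt_const hη] with n hn w hw
    have hwr : ‖D w‖ ≤ r := by simpa [B, D] using hw
    rw [dist_comm, dist_eq_norm]
    refine lt_of_le_of_lt ?_ hn
    refine (((T n - .id ℝ 𝔛) ∘L S).le_opNorm (D w)).trans ?_
    gcongr
  refine hunif.continuousOn (Frequently.of_forall fun n => ?_)
  obtain ⟨N, e, -, -, he⟩ := exists_orthonormal_of_finiteRank hXJ hX2 (T n)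
  refine Continuous.continuousOn ?_
  have h2 : (fun w => T n (S (D w))) = fun w : WeakDual ℝ H => ∑ i, w (e i) • T n (S (e i)) := by
    ext1 w
    rw [he]
    refine Finset.sum_congr rfl fun i _ => ?_
    congr 1
    rw [real_inner_comm]
    simp [D]
  rw [h2]
  refine continuous_finsetSum _ fun i _ => ?_
  exact (WeakDual.eval_continuous (e i)).smul continuous_const

end GaussianElement

/-! ### From exponential bounds to logarithmic rates -/

section LogAsymptotics

/-- The prefactor contributes `ε log K → 0`, which the gap between `l` and `l'` absorbs. -/
lemma eventually_mul_log_le {A : ℝ → ℝ≥0∞} {K l l' : ℝ} (hK : 0 < K) (hl : l < l')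
    (h : ∀ᶠ ε in 𝓝[>] (0 : ℝ), A ε ≤ ENNReal.ofReal (K * Real.exp (-l' / ε))) :
    ∀ᶠ ε : ℝ in 𝓝[>] 0, (ε : EReal) * ENNReal.log (A ε) ≤ (-l : ℝ) := by
  have h1 : Tendsto (fun ε : ℝ => ε * Real.log K) (𝓝[>] 0) (𝓝 0) := by
    have : Tendsto (fun ε : ℝ => ε * Real.log K) (𝓝 0) (𝓝 (0 * Real.log K)) :=
      (continuous_id.mul continuous_const).tendsto 0
    rw [zero_mul] at this
    exact this.mono_left nhdsWithin_le_nhds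
  filter_upwards [h, self_mem_nhdsWithin, h1.eventually_lt_const (sub_pos.2 hl)] with ε h2 hε h3
  have hε : 0 < ε := hε
  have h4 := ENNReal.log_monotone h2
  rw [ENNReal.log_ofReal_of_pos (by positivity), Real.log_mul hK.ne' (Real.exp_ne_zero _),
    Real.log_exp] at h4
  refine (mul_le_mul_of_nonneg_left h4 (EReal.coe_nonneg.2 hε.le)).trans ?_
  rw [← EReal.coe_mul, EReal.coe_le_coe_iff, mul_add, mul_div_cancel₀ _ hε.ne']
  linarith

lemma eventually_le_mul_log {A : ℝ → ℝ≥0∞} {k l l' : ℝ} (hk : 0 < k) (hl : l' < l)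
    (h : ∀ᶠ ε in 𝓝[>] (0 : ℝ), ENNReal.ofReal (k * Real.exp (-l' / ε)) ≤ A ε) :
    ∀ᶠ ε : ℝ in 𝓝[>] 0, ((-l : ℝ) : EReal) ≤ (ε : EReal) * ENNReal.log (A ε) := by
  have h1 : Tendsto (fun ε : ℝ => ε * Real.log k) (𝓝[>] 0) (𝓝 0) := by
    have : Tendsto (fun ε : ℝ => ε * Real.log k) (𝓝 0) (𝓝 (0 * Real.log k)) :=
      (continuous_id.mul continuous_const).tendsto 0
    rw [zero_mul] at this
    exact this.mono_left nhdsWithin_le_nhds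
  filter_upwards [h, self_mem_nhdsWithin, h1.eventually_const_lt (sub_neg.2 hl)] with ε h2 hε h3
  have hε : 0 < ε := hε
  have h4 := ENNReal.log_monotone h2
  rw [ENNReal.log_ofReal_of_pos (by positivity), Real.log_mul hk.ne' (Real.exp_ne_zero _),
    Real.log_exp] at h4
  refine le_trans ?_ (mul_le_mul_of_nonneg_left h4 (EReal.coe_nonneg.2 hε.le))
  rw [← EReal.coe_mul, EReal.coe_le_coe_iff, mul_add, mul_div_cancel₀ _ hε.ne']
  linarith

end LogAsymptotics

/-! ### Large deviations for a scaled Gaussian element -/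

section GaussianLDP

variable {Ω H 𝔛 : Type*} [MeasurableSpace Ω] {P : Measure Ω} [IsProbabilityMeasure P]
  [NormedAddCommGroup H] [InnerProductSpace ℝ H]
  [NormedAddCommGroup 𝔛] [NormedSpace ℝ 𝔛] [CompleteSpace 𝔛]
  [SecondCountableTopology 𝔛] [MeasurableSpace 𝔛] [BorelSpace 𝔛]
  {J : H →ₗᵢ[ℝ] Lp ℝ 2 P} {X : Ω → 𝔛}

/-- The compact image of the ball and the closed set `F` have disjoint thickenings. Hence `√ε X ∈ F`
forces either coordinate energy at least `l'` or a remainder of size at least `δ`, and both are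
exponentially rare. -/
lemma eventually_measure_le_of_disjoint [CompleteSpace H] (hJ : IsIsonormal J) (hX : Measurable X)
    (hXJ : ∀ L : StrongDual ℝ 𝔛, ∃ g, (fun ω => L (X ω)) =ᵐ[P] J g) {T : ℕ → 𝔛 →L[ℝ] 𝔛}
    (hfin : ∀ n, FiniteDimensional ℝ (LinearMap.range (T n : 𝔛 →ₗ[ℝ] 𝔛)))
    (hT : ∀ x, Tendsto (fun n => T n x) atTop (𝓝 x)) (hX2 : MemLp X 2 P)
    {F : Set 𝔛} (hF : IsClosed F) {l l' : ℝ} (hl : 0 ≤ l) (hll : l < l')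
    (hdisj : Disjoint (correlationOp J hX2 '' Metric.closedBall 0 √(2 * l')) F) :
    ∃ K : ℝ, 0 < K ∧ ∀ ε : ℝ, 0 < ε →
      P {ω | √ε • X ω ∈ F} ≤ ENNReal.ofReal (K * Real.exp (-l / ε)) := by
  set S := correlationOp J hX2 with hS
  have hl' : 0 < l' := hl.trans_lt hll
  obtain ⟨ρ, hρ, hdisj2⟩ := hdisj.exists_thickenings
    (isCompact_image_correlationOp hJ hX hXJ hfin hT hX2 _) hF
  have hA : ∀ x, Tendsto (fun n => (T n - .id ℝ 𝔛) x) atTop (𝓝 0) := fun x => by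
    simpa using (hT x).sub_const x
  set δ := ρ / 2 with hδ
  have hδ0 : 0 < δ := by positivity
  obtain ⟨C, hC, htail⟩ := eventually_measure_le_exp hJ hX hXJ hA hδ0 hl'
  have hnorm : Tendsto (fun n => ‖(T n - .id ℝ 𝔛) ∘L S‖ * √(2 * l')) atTop (𝓝 0) := by
    simpa using (tendsto_norm_comp_correlationOp hJ hX hXJ hA hX2).mul_const √(2 * l')
  obtain ⟨n, hn1, hn2⟩ := (htail.and (hnorm.eventually_lt_const hδ0)).exists
  obtain ⟨N, e, he, heX, -⟩ := exists_orthonormal_of_finiteRank hXJ hX2 (T n)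
  obtain ⟨K, hK, hchi⟩ := hJ.measure_sum_sq_le he hl hll
  refine ⟨K + C, by positivity, fun ε hε => ?_⟩
  have hsub : {ω | √ε • X ω ∈ F} ≤ᵐ[P] ({ω | l' ≤ (∑ i, (√ε * J (e i) ω) ^ 2) / 2} ∪
      {ω | δ ≤ √ε * ‖(T n - .id ℝ 𝔛) (X ω)‖} : Set Ω) := by
    filter_upwards [heX] with ω hω hωF
    by_contra hcon
    have hcon : ¬ (l' ≤ (∑ i, (√ε * J (e i) ω) ^ 2) / 2 ∨
        δ ≤ √ε * ‖(T n - .id ℝ 𝔛) (X ω)‖) := hcon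
    push Not at hcon
    obtain ⟨h1, h2⟩ := hcon
    -- The random control read off from the coordinates: `T n (S a)` equals `√ε T n X`, so it would
    -- be close both to the image of the ball and to `F`.
    set a := ∑ i, (√ε * J (e i) ω) • e i with ha
    have hna : ‖a‖ ≤ √(2 * l') := by
      refine Real.le_sqrt_of_sq_le ?_
      have h3 : ‖a‖ ^ 2 = ∑ i, (√ε * J (e i) ω) ^ 2 := by
        rw [← real_inner_self_eq_norm_sq, ha, he.inner_sum]
        simp [pow_two]
      linarith
    have hTa : T n (S a) = √ε • T n (X ω) := by
      rw [hω, ha, map_sum, map_sum, Finset.smul_sum]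
      simp [smul_smul, hS]
    have h4 : ‖T n (S a) - S a‖ < δ := by
      refine lt_of_le_of_lt ?_ hn2
      refine (((T n - .id ℝ 𝔛) ∘L S).le_opNorm a).trans ?_
      gcongr
    have h5 : ‖T n (S a) - √ε • X ω‖ < δ := by
      have h6 : T n (S a) - √ε • X ω = √ε • ((T n - .id ℝ 𝔛) (X ω)) := by
        rw [hTa, ← smul_sub]; rfl
      rwa [h6, norm_smul, Real.norm_of_nonneg (Real.sqrt_nonneg _)]
    have h6 : T n (S a) ∉ Metric.thickening ρ F := Set.disjoint_left.1 hdisj2 ?_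
    · refine h6 ?_
      rw [Metric.mem_thickening_iff]
      exact ⟨_, hωF, by rw [dist_eq_norm]; linarith⟩
    · rw [Metric.mem_thickening_iff]
      exact ⟨S a, ⟨a, by simpa using hna, rfl⟩, by rw [dist_eq_norm]; linarith⟩
  refine (measure_mono_ae hsub).trans ((measure_union_le _ _).trans ?_)
  rw [add_mul, ENNReal.ofReal_add (by positivity) (by positivity)]
  refine add_le_add (hchi ε hε) ((hn1 ε hε).trans (ENNReal.ofReal_le_ofReal ?_))
  gcongr

/-- Keeping each coordinate near `⟨eᵢ, a⟩` and the remainder small keeps `√ε X` near `S a`. The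
window has the required probability, and the remainder costs less than half of it. -/
lemma eventually_le_measure_of_mem (hJ : IsIsonormal J) (hX : Measurable X)
    (hXJ : ∀ L : StrongDual ℝ 𝔛, ∃ g, (fun ω => L (X ω)) =ᵐ[P] J g) {T : ℕ → 𝔛 →L[ℝ] 𝔛}
    (hfin : ∀ n, FiniteDimensional ℝ (LinearMap.range (T n : 𝔛 →ₗ[ℝ] 𝔛)))
    (hT : ∀ x, Tendsto (fun n => T n x) atTop (𝓝 x)) (hX2 : MemLp X 2 P)
    {G : Set 𝔛} (hG : IsOpen G) {a : H} (ha : correlationOp J hX2 a ∈ G) {l : ℝ}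
    (hl : ‖a‖ ^ 2 / 2 < l) :
    ∃ k : ℝ, 0 < k ∧ ∀ᶠ ε in 𝓝[>] (0 : ℝ),
      ENNReal.ofReal (k * Real.exp (-l / ε)) ≤ P {ω | √ε • X ω ∈ G} := by
  set S := correlationOp J hX2 with hS
  have hl0 : 0 < l := lt_of_le_of_lt (by positivity) hl
  obtain ⟨ρ, hρ, hball⟩ := Metric.isOpen_iff.1 hG _ ha
  have hA : ∀ x, Tendsto (fun n => (T n - .id ℝ 𝔛) x) atTop (𝓝 0) := fun x => by
    simpa using (hT x).sub_const x
  set δ := ρ / 3 with hδ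
  have hδ0 : 0 < δ := by positivity
  -- The rate `l + 1` makes the bad event negligible against `exp (-l / ε)`.
  obtain ⟨C, hC, htail⟩ := eventually_measure_le_exp hJ hX hXJ hA hδ0
    (show 0 < l + 1 by positivity)
  have hnorm : ∀ᶠ n in atTop, ‖(T n - .id ℝ 𝔛) (S a)‖ < δ := by
    have := (hA (S a)).norm
    rw [norm_zero] at this
    exact this.eventually_lt_const hδ0
  obtain ⟨n, hn1, hn2⟩ := (htail.and hnorm).exists
  obtain ⟨N, e, he, heX, heS⟩ := exists_orthonormal_of_finiteRank hXJ hX2 (T n)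
  set α : Fin N → ℝ := fun i => inner ℝ (e i) a with hα
  -- At `η = 0` the first inequality is Bessel's inequality together with `‖a‖² / 2 < l`, and the
  -- second is `0 < δ`; by continuity both survive for small positive `η`.
  have hη : ∃ η : ℝ, 0 < η ∧ ∑ i, (|α i| + η) ^ 2 / 2 < l ∧ η * ∑ i, ‖T n (S (e i))‖ < δ := by
    have c1 : Continuous fun η : ℝ => ∑ i, (|α i| + η) ^ 2 / 2 := by fun_prop
    have c2 : Continuous fun η : ℝ => η * ∑ i, ‖T n (S (e i))‖ := by fun_prop
    have b1 : ∑ i, (|α i| + 0) ^ 2 / 2 < l := by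
      refine lt_of_le_of_lt ?_ hl
      rw [← Finset.sum_div]
      gcongr
      have := he.sum_inner_products_le (s := Finset.univ) a
      simpa [hα, sq_abs] using this
    have e1 : ∀ᶠ η in 𝓝 (0 : ℝ), ∑ i, (|α i| + η) ^ 2 / 2 < l :=
      (c1.tendsto 0).eventually_lt_const b1
    have e2 : ∀ᶠ η in 𝓝 (0 : ℝ), η * ∑ i, ‖T n (S (e i))‖ < δ :=
      (c2.tendsto 0).eventually_lt_const (by simpa using hδ0)
    have e3 : ∀ᶠ η in 𝓝[>] (0 : ℝ), η ∈ Ioi 0 := self_mem_nhdsWithin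
    obtain ⟨η, h1, h2⟩ := (((e1.and e2).filter_mono nhdsWithin_le_nhds).and e3).exists
    exact ⟨η, h2, h1⟩
  obtain ⟨η, hη, hη1, hη2⟩ := hη
  obtain ⟨k, hk, hlow⟩ := hJ.le_measure_forall_abs_sub_lt he α hη
  refine ⟨k / 2, by positivity, ?_⟩
  have hsmall : ∀ᶠ ε in 𝓝[>] (0 : ℝ), C * Real.exp (-1 / ε) ≤ k / 2 := by
    have h1 : Tendsto (fun ε : ℝ => C * Real.exp (-1 / ε)) (𝓝[>] 0) (𝓝 (C * 0)) := by
      refine Tendsto.const_mul _ (Real.tendsto_exp_atBot.comp ?_)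
      have h2 : (fun ε : ℝ => -1 / ε) = fun ε => -ε⁻¹ := by
        ext; rw [neg_div, one_div]
      refine Tendsto.congr (fun ε => (congrFun h2 ε).symm) ?_
      exact tendsto_neg_atTop_atBot.comp tendsto_inv_nhdsGT_zero
    rw [mul_zero] at h1
    exact (h1.eventually_lt_const (show 0 < k / 2 by positivity)).mono fun _ h => h.le
  have hone : ∀ᶠ ε in 𝓝[>] (0 : ℝ), ε ≤ 1 :=
    nhdsWithin_le_nhds ((eventually_lt_nhds one_pos).mono fun _ h => h.le)
  filter_upwards [hsmall, hone, self_mem_nhdsWithin] with ε h1 hε1 hε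
  have hε : 0 < ε := hε
  have hsub : {ω | ∀ i, |√ε * J (e i) ω - α i| < η} ≤ᵐ[P]
      ({ω | √ε • X ω ∈ G} ∪ {ω | δ ≤ √ε * ‖(T n - .id ℝ 𝔛) (X ω)‖} : Set Ω) := by
    filter_upwards [heX] with ω hω hωη
    have hωη : ∀ i, |√ε * J (e i) ω - α i| < η := hωη
    by_cases hb : δ ≤ √ε * ‖(T n - .id ℝ 𝔛) (X ω)‖
    · exact Or.inr hb
    refine Or.inl (hball ?_)
    rw [Metric.mem_ball, dist_eq_norm]
    push Not at hb
    have h3 : ‖√ε • T n (X ω) - T n (S a)‖ < δ := by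
      rw [hω, heS a, Finset.smul_sum, ← Finset.sum_sub_distrib]
      refine lt_of_le_of_lt ((norm_sum_le _ _).trans ?_) hη2
      rw [Finset.mul_sum]
      refine Finset.sum_le_sum fun i _ => ?_
      rw [smul_smul, ← sub_smul, norm_smul, Real.norm_eq_abs]
      have := (hωη i).le
      gcongr
    have h4 : ‖T n (S a) - S a‖ < δ := hn2
    have h5 : ‖√ε • T n (X ω) - √ε • X ω‖ < δ := by
      rw [← smul_sub, norm_smul, Real.norm_of_nonneg (Real.sqrt_nonneg _)]
      exact hb
    have h6 : √ε • X ω - S a = -(√ε • T n (X ω) - √ε • X ω) + (√ε • T n (X ω) - T n (S a))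
        + (T n (S a) - S a) := by abel
    rw [h6]
    have h7 := norm_add₃_le (a := -(√ε • T n (X ω) - √ε • X ω))
      (b := √ε • T n (X ω) - T n (S a)) (c := T n (S a) - S a)
    rw [norm_neg] at h7
    linarith
  have h8 := (measure_mono_ae hsub).trans (measure_union_le _ _)
  have h9 := (hlow ε hε hε1).trans (h8.trans (add_le_add_right (hn1 ε hε) _))
  have h10 : ENNReal.ofReal (k / 2 * Real.exp (-l / ε)) + ENNReal.ofReal (C * Real.exp (-(l + 1) / ε))
      ≤ ENNReal.ofReal (k * Real.exp (-(∑ i, (|α i| + η) ^ 2 / 2) / ε)) := by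
    rw [← ENNReal.ofReal_add (by positivity) (by positivity)]
    refine ENNReal.ofReal_le_ofReal ?_
    have h11 : C * Real.exp (-(l + 1) / ε) ≤ k / 2 * Real.exp (-l / ε) := by
      rw [show -(l + 1) / ε = -1 / ε + -l / ε by ring, Real.exp_add, ← mul_assoc]
      gcongr
    have h12 : Real.exp (-l / ε) ≤ Real.exp (-(∑ i, (|α i| + η) ^ 2 / 2) / ε) := by
      gcongr
    nlinarith
  exact (ENNReal.add_le_add_iff_right ENNReal.ofReal_ne_top).1 (h10.trans h9)

/-- The large deviation principle for `x₀ + √ε X` with `X` a centred Gaussian element. -/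
theorem satisfiesLDP_gaussian [CompleteSpace H] (hJ : IsIsonormal J) (hX : Measurable X)
    (hXJ : ∀ L : StrongDual ℝ 𝔛, ∃ g, (fun ω => L (X ω)) =ᵐ[P] J g) {T : ℕ → 𝔛 →L[ℝ] 𝔛}
    (hfin : ∀ n, FiniteDimensional ℝ (LinearMap.range (T n : 𝔛 →ₗ[ℝ] 𝔛)))
    (hT : ∀ x, Tendsto (fun n => T n x) atTop (𝓝 x)) (hX2 : MemLp X 2 P) (x₀ : 𝔛)
    {I : 𝔛 → ℝ≥0∞} (hI : ∀ h, I h = ⨅ (a : H) (_ : x₀ + correlationOp J hX2 a = h),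
      ENNReal.ofReal (‖a‖ ^ 2 / 2)) :
    SatisfiesLDP P (fun ε ω => x₀ + √ε • X ω) I := by
  set S := correlationOp J hX2 with hS
  have hIle (a : H) : I (x₀ + S a) ≤ ENNReal.ofReal (‖a‖ ^ 2 / 2) := by
    rw [hI]
    exact iInf₂_le (f := fun (b : H) (_ : x₀ + S b = x₀ + S a) => ENNReal.ofReal (‖b‖ ^ 2 / 2)) a rfl
  have hIlt {h : 𝔛} {c : ℝ≥0∞} (hc : I h < c) :
      ∃ a, x₀ + S a = h ∧ ENNReal.ofReal (‖a‖ ^ 2 / 2) < c := by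
    rw [hI, iInf_lt_iff] at hc
    obtain ⟨a, ha⟩ := hc
    rw [iInf_lt_iff] at ha
    obtain ⟨ha, hc⟩ := ha
    exact ⟨a, ha, hc⟩
  refine ⟨?_, ?_, ?_⟩
  · rw [lowerSemicontinuous_iff_isClosed_preimage]
    intro c
    -- Intersecting over `r > c` avoids any need for the infimum to be attained.
    have hset : I ⁻¹' Iic c = ⋂ (r : ℝ≥0) (_ : c < r),
        (x₀ + ·) '' (S '' Metric.closedBall 0 √(2 * r)) := by
      ext h
      simp only [mem_preimage, mem_Iic, mem_iInter]
      constructor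
      · intro hh r hr
        obtain ⟨a, ha, hac⟩ := hIlt (hh.trans_lt hr)
        refine ⟨S a, ⟨a, ?_, rfl⟩, ha⟩
        rw [mem_closedBall_zero_iff]
        refine Real.le_sqrt_of_sq_le ?_
        rw [← ENNReal.ofReal_coe_nnreal] at hac
        have := (ENNReal.ofReal_lt_ofReal_iff_of_nonneg (by positivity)).1 hac
        linarith
      · intro hh
        refine ENNReal.le_of_forall_pos_le_add ?_
        intro r hr hc
        lift c to ℝ≥0 using hc.ne
        obtain ⟨_, ⟨a, ha, rfl⟩, rfl⟩ := hh (c + r) (by exact_mod_cast lt_add_of_pos_right c hr)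
        refine (hIle a).trans ?_
        rw [← ENNReal.coe_add, ← ENNReal.ofReal_coe_nnreal]
        refine ENNReal.ofReal_le_ofReal ?_
        rw [mem_closedBall_zero_iff] at ha
        have h1 : ‖a‖ ^ 2 ≤ √(2 * ((c + r : ℝ≥0) : ℝ)) ^ 2 := by gcongr
        rw [Real.sq_sqrt (by positivity)] at h1
        linarith
    rw [hset]
    refine isClosed_iInter fun r => isClosed_iInter fun _ => ?_
    exact ((isCompact_image_correlationOp hJ hX hXJ hfin hT hX2 _).image
      (continuous_const_add x₀)).isClosed
  · intro F hF
    rw [EReal.le_neg]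
    refine EReal.ge_of_forall_gt_iff_ge.1 fun l hl => ?_
    rw [EReal.le_neg, ← EReal.coe_neg]
    obtain ⟨l', hl1, hl2⟩ := EReal.lt_iff_exists_real_btwn.1 hl
    rw [EReal.coe_lt_coe_iff] at hl1
    obtain ⟨K, hK, hb⟩ : ∃ K : ℝ, 0 < K ∧ ∀ ε : ℝ, 0 < ε →
        P {ω | x₀ + √ε • X ω ∈ F} ≤ ENNReal.ofReal (K * Real.exp (-l' / ε)) := by
      -- For negative `l'` the bound is trivial, as probabilities are at most 1. Otherwise a second
      -- level `l''` below the infimum over `F` supplies the ball whose image misses `F`.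
      rcases lt_or_ge l' 0 with hneg | hpos
      · refine ⟨1, one_pos, fun ε hε => prob_le_one.trans ?_⟩
        rw [one_mul, ENNReal.one_le_ofReal, Real.one_le_exp_iff]
        exact div_nonneg (by linarith) hε.le
      · obtain ⟨l'', h1, h2⟩ := EReal.lt_iff_exists_real_btwn.1 hl2
        rw [EReal.coe_lt_coe_iff] at h1
        refine eventually_measure_le_of_disjoint hJ hX hXJ hfin hT hX2
          (F := (x₀ + ·) ⁻¹' F) (hF.preimage (continuous_const_add x₀)) hpos h1 ?_
        rw [Set.disjoint_left]
        rintro _ ⟨a, ha, rfl⟩ haF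
        refine absurd h2 (not_lt.2 ((iInf₂_le (x₀ + S a) haF).trans ?_))
        rw [mem_closedBall_zero_iff] at ha
        have h3 : ‖a‖ ^ 2 ≤ √(2 * l'') ^ 2 := by gcongr
        rw [Real.sq_sqrt (by linarith)] at h3
        have h4 : I (x₀ + S a) ≤ ENNReal.ofReal l'' :=
          (hIle a).trans (ENNReal.ofReal_le_ofReal (by linarith))
        refine (EReal.coe_ennreal_le_coe_ennreal_iff.2 h4).trans ?_
        rw [EReal.coe_ennreal_ofReal, max_eq_left (by linarith)]
    refine limsup_le_of_le (by isBoundedDefault) ?_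
    exact eventually_mul_log_le hK hl1
      (eventually_nhdsWithin_of_forall fun ε hε => hb ε hε)
  · intro G hG
    rw [EReal.neg_le]
    refine le_iInf₂ fun h hh => ?_
    refine EReal.le_of_forall_lt_iff_le.1 fun l hl => ?_
    rw [EReal.neg_le, ← EReal.coe_neg]
    have hl0 : 0 ≤ l := by
      have : (0 : EReal) < l := lt_of_le_of_lt (EReal.coe_ennreal_nonneg _) hl
      exact_mod_cast this.le
    have hl' : I h < ENNReal.ofReal l := by
      rw [← EReal.coe_ennreal_lt_coe_ennreal_iff, EReal.coe_ennreal_ofReal, max_eq_left hl0]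
      exact hl
    obtain ⟨a, rfl, hac⟩ := hIlt hl'
    have hac' := (ENNReal.ofReal_lt_ofReal_iff_of_nonneg (by positivity)).1 hac
    obtain ⟨l', h1, h2⟩ := exists_between hac'
    obtain ⟨k, hk, hev⟩ := eventually_le_measure_of_mem hJ hX hXJ hfin hT hX2
      (G := (x₀ + ·) ⁻¹' G) (hG.preimage (continuous_const_add x₀)) hh h1
    refine le_liminf_of_le (by isBoundedDefault) ?_
    exact eventually_le_mul_log hk h2 hev

end GaussianLDP

/-! ### Deterministic dyadic chaining -/

section Chaining

/-- `F n k` stands for the value at `k / 2ⁿ`, with `k / 2` the parent index. Refinement increments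
make the approximations uniformly Cauchy, and neighbour increments control oscillation within one
level. -/
lemma exists_continuous_of_chain {V : Type*} [NormedAddCommGroup V] [CompleteSpace V]
    {F : ℕ → ℕ → V} {δ : ℕ → ℝ} (hδ : Summable δ)
    (h1 : ∀ n, ∀ k ≤ 2 ^ (n + 1), ‖F (n + 1) k - F n (k / 2)‖ ≤ δ n)
    (h2 : ∀ n, ∀ k < 2 ^ n, ‖F n (k + 1) - F n k‖ ≤ δ n) :
    ∃ x : C(Icc (0 : ℝ) 1, V), ∀ t : Icc (0 : ℝ) 1,
      Tendsto (fun n => F n ⌊(2 : ℝ) ^ n * t⌋₊) atTop (𝓝 (x t)) := by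
  set f : ℕ → Icc (0 : ℝ) 1 → V := fun n t => F n ⌊(2 : ℝ) ^ n * t⌋₊ with hf
  have hfloor (n : ℕ) (t : Icc (0 : ℝ) 1) : ⌊(2 : ℝ) ^ n * t⌋₊ ≤ 2 ^ n := by
    refine Nat.floor_le_of_le ?_
    push_cast
    exact mul_le_of_le_one_right (by positivity) t.2.2
  have hstep (t : Icc (0 : ℝ) 1) (n : ℕ) : dist (f n t) (f (n + 1) t) ≤ δ n := by
    rw [dist_comm, dist_eq_norm]
    have h3 : ⌊(2 : ℝ) ^ n * t⌋₊ = ⌊(2 : ℝ) ^ (n + 1) * t⌋₊ / 2 := by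
      rw [← Nat.floor_div_ofNat]
      congr 1
      ring
    simp only [hf]
    rw [h3]
    exact h1 n _ (hfloor _ _)
  have hlim (t : Icc (0 : ℝ) 1) : ∃ x, Tendsto (fun n => f n t) atTop (𝓝 x) :=
    cauchySeq_tendsto_of_complete (cauchySeq_of_dist_le_of_summable δ (hstep t) hδ)
  choose x hx using hlim
  have hR (n : ℕ) (t : Icc (0 : ℝ) 1) : dist (f n t) (x t) ≤ ∑' m, δ (n + m) :=
    dist_le_tsum_of_dist_le_of_tendsto δ (hstep t) hδ (hx t) n
  have hR0 : Tendsto (fun n => 2 * (∑' m, δ (n + m)) + δ n) atTop (𝓝 0) := by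
    have h3 := tendsto_sum_nat_add δ
    simp_rw [add_comm _ (_ : ℕ)] at h3
    simpa using (h3.const_mul 2).add hδ.tendsto_atTop_zero
  refine ⟨⟨x, ?_⟩, hx⟩
  rw [Metric.continuous_iff]
  intro t ε hε
  obtain ⟨n, hn⟩ := (hR0.eventually_lt_const hε).exists
  refine ⟨(2 ^ n)⁻¹, by positivity, fun s hst => ?_⟩
  -- Points less than `2⁻ⁿ` apart lie in the same dyadic cell or in adjacent ones.
  have key : ∀ s t : Icc (0 : ℝ) 1, s ≤ t → (t : ℝ) - s < (2 ^ n)⁻¹ →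
      dist (f n s) (f n t) ≤ δ n := by
    intro s t hle hlt
    have ha : ⌊(2 : ℝ) ^ n * s⌋₊ ≤ ⌊(2 : ℝ) ^ n * t⌋₊ := by
      refine Nat.floor_le_floor ?_
      have : (s : ℝ) ≤ t := hle
      gcongr
    have hb : ⌊(2 : ℝ) ^ n * t⌋₊ ≤ ⌊(2 : ℝ) ^ n * s⌋₊ + 1 := by
      rw [← Nat.floor_add_one (mul_nonneg (by positivity) s.2.1)]
      refine Nat.floor_le_floor ?_
      have h3 := mul_lt_mul_of_pos_left hlt (show (0 : ℝ) < 2 ^ n by positivity)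
      rw [mul_inv_cancel₀ (by positivity)] at h3
      linarith
    rcases Nat.lt_or_ge ⌊(2 : ℝ) ^ n * s⌋₊ ⌊(2 : ℝ) ^ n * t⌋₊ with hc | hc
    · have hd : ⌊(2 : ℝ) ^ n * t⌋₊ = ⌊(2 : ℝ) ^ n * s⌋₊ + 1 := by omega
      simp only [hf]
      rw [hd, dist_comm, dist_eq_norm]
      exact h2 n _ (lt_of_lt_of_le hc (hfloor n t))
    · have hd : ⌊(2 : ℝ) ^ n * t⌋₊ = ⌊(2 : ℝ) ^ n * s⌋₊ := by omega
      simp only [hf]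
      rw [hd, dist_self]
      exact (norm_nonneg _).trans (h1 n 0 (by positivity))
  have hd : dist (f n s) (f n t) ≤ δ n := by
    rw [Subtype.dist_eq, Real.dist_eq, abs_lt] at hst
    rcases le_total s t with h | h
    · exact key s t h (by linarith)
    · rw [dist_comm]
      exact key t s h (by linarith)
  have h3 := dist_triangle4 (x s) (f n s) (f n t) (x t)
  have h4 := hR n s
  rw [dist_comm] at h4
  exact lt_of_le_of_lt (h3.trans (by linarith [hR n t])) hn

/-- Summable `L¹` increments make the sequence Cauchy almost everywhere, and the limit in measure
identifies its limit. Writing the limit as a `limsup` keeps measurability automatic. -/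
lemma ae_limsup_eq_of_tsum {α : Type*} [MeasurableSpace α] {μ : Measure α} {g : ℕ → α → ℝ}
    {ζ : α → ℝ} (hg : ∀ n, AEMeasurable (g n) μ)
    (hsum : ∑' n, ∫⁻ x, ‖g (n + 1) x - g n x‖ₑ ∂μ ≠ ∞) (hζ : TendstoInMeasure μ g atTop ζ) :
    ∀ᵐ x ∂μ, limsup (fun n => g n x) atTop = ζ x := by
  have hm (n : ℕ) : AEMeasurable (fun x => ‖g (n + 1) x - g n x‖ₑ) μ :=
    ((hg (n + 1)).sub (hg n)).enorm
  rw [← lintegral_tsum hm] at hsum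
  have h1 := ae_lt_top' (AEMeasurable.tsum hm) hsum
  obtain ⟨ms, hms, hms2⟩ := hζ.exists_seq_tendsto_ae
  filter_upwards [h1, hms2] with x h2 h3
  have h4 : Summable fun n => dist (g n x) (g n.succ x) := by
    have h5 : ∑' n, ((‖g (n + 1) x - g n x‖₊ : ℝ≥0) : ℝ≥0∞) ≠ ∞ := h2.ne
    have h6 := NNReal.summable_coe.2 (ENNReal.tsum_coe_ne_top_iff_summable.1 h5)
    refine h6.congr fun n => ?_
    rw [dist_comm, dist_eq_norm]
    rfl
  obtain ⟨l, hl⟩ := cauchySeq_tendsto_of_complete (cauchySeq_of_summable_dist h4)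
  rw [hl.limsup_eq]
  exact tendsto_nhds_unique (hl.comp hms.tendsto_atTop) h3

end Chaining

/-! ### A jointly measurable version of the field -/

section Field

variable {Ω H : Type*} [MeasurableSpace Ω] {P : Measure Ω}
  [NormedAddCommGroup H] [InnerProductSpace ℝ H]

/-- The Gaussian field `J (k u t)` sampled at dyadic points. -/
noncomputable def gridField (J : H →ₗᵢ[ℝ] Lp ℝ 2 P) (k : ℝ → ℝ → H) (n j : ℕ) (u : ℝ) (ω : Ω) : ℝ :=
  J (k (⌊(2 : ℝ) ^ n * u⌋ / 2 ^ n) (j / 2 ^ n)) ω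

/-- A version of the Gaussian field `J (k u t)`, the limit of its dyadic approximations. -/
noncomputable def fieldVersion (J : H →ₗᵢ[ℝ] Lp ℝ 2 P) (k : ℝ → ℝ → H) (u t : ℝ) (ω : Ω) : ℝ :=
  limsup (fun n => gridField J k n ⌊(2 : ℝ) ^ n * t⌋₊ u ω) atTop

lemma measurable_gridField (J : H →ₗᵢ[ℝ] Lp ℝ 2 P) (k : ℝ → ℝ → H) (n j : ℕ) :
    Measurable fun x : ℝ × Ω => gridField J k n j x.1 x.2 := by
  -- The variable `u` enters only through an integer, so joint measurability is a countable
  -- statement.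
  have h1 : Measurable fun x : ℤ × Ω => J (k (x.1 / 2 ^ n) (j / 2 ^ n)) x.2 :=
    measurable_from_prod_countable_right fun i => measurable_coeFn_Lp (J (k (i / 2 ^ n) (j / 2 ^ n)))
  exact h1.comp ((Int.measurable_floor.comp (measurable_fst.const_mul _)).prodMk measurable_snd)

lemma measurable_fieldVersion (J : H →ₗᵢ[ℝ] Lp ℝ 2 P) (k : ℝ → ℝ → H) (t : ℝ) :
    Measurable fun x : ℝ × Ω => fieldVersion J k x.1 t x.2 :=
  Measurable.limsup fun n => measurable_gridField J k n _

lemma abs_floor_div_sub_le (n : ℕ) (u : ℝ) : |⌊(2 : ℝ) ^ n * u⌋ / 2 ^ n - u| ≤ (1 / 2) ^ n := by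
  have h : (0 : ℝ) < 2 ^ n := by positivity
  rw [show (⌊(2 : ℝ) ^ n * u⌋ : ℝ) / 2 ^ n - u = (⌊(2 : ℝ) ^ n * u⌋ - 2 ^ n * u) / 2 ^ n by
    field_simp, abs_div, abs_of_pos h, one_div, inv_pow, ← one_div]
  gcongr
  rw [abs_le]
  constructor <;> linarith [Int.floor_le ((2 : ℝ) ^ n * u), Int.lt_floor_add_one ((2 : ℝ) ^ n * u)]

lemma abs_natFloor_div_sub_le (n : ℕ) {t : ℝ} (ht : 0 ≤ t) :
    |⌊(2 : ℝ) ^ n * t⌋₊ / 2 ^ n - t| ≤ (1 / 2) ^ n := by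
  have h := abs_floor_div_sub_le n t
  rwa [← natCast_floor_eq_intCast_floor (by positivity)] at h

lemma natFloor_div_mem_Icc (n : ℕ) {t : ℝ} (ht : t ∈ Icc (0 : ℝ) 1) :
    (⌊(2 : ℝ) ^ n * t⌋₊ : ℝ) / 2 ^ n ∈ Icc (0 : ℝ) 1 := by
  refine ⟨by positivity, ?_⟩
  rw [div_le_one (by positivity)]
  refine (Nat.floor_le (mul_nonneg (by positivity) ht.1)).trans ?_
  exact mul_le_of_le_one_right (by positivity) ht.2

variable {J : H →ₗᵢ[ℝ] Lp ℝ 2 P} {k : ℝ → ℝ → H} {C : ℝ}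

/-- The factor 4 is `2 + 2`: both roundings of `u` are within `2⁻ⁿ` of `u`, and the times differ by
at most `2 · 2⁻ⁿ`. -/
lemma norm_floor_sub_floor_le {H : Type*} [NormedAddCommGroup H] {k : ℝ → ℝ → H} (hC : 0 ≤ C)
    (hk : ∀ u u', ∀ t ∈ Icc (0 : ℝ) 1, ∀ t' ∈ Icc (0 : ℝ) 1,
      ‖k u t - k u' t'‖ ^ 2 ≤ C * (|u - u'| + |t - t'|)) (n m : ℕ) (hnm : n ≤ m) (u : ℝ) {t t' : ℝ}
    (ht : t ∈ Icc (0 : ℝ) 1) (ht' : t' ∈ Icc (0 : ℝ) 1) (htt : |t - t'| ≤ 2 * (1 / 2) ^ n) :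
    ‖k (⌊(2 : ℝ) ^ m * u⌋ / 2 ^ m) t - k (⌊(2 : ℝ) ^ n * u⌋ / 2 ^ n) t'‖ ^ 2
      ≤ 4 * C * (1 / 2) ^ n := by
  refine (hk _ _ _ ht _ ht').trans ?_
  have h1 := abs_floor_div_sub_le n u
  have h2 := (abs_floor_div_sub_le m u).trans
    (pow_le_pow_of_le_one (by norm_num : (0 : ℝ) ≤ 1 / 2) (by norm_num) hnm)
  have h3 := abs_sub_le ((⌊(2 : ℝ) ^ m * u⌋ : ℝ) / 2 ^ m) u (⌊(2 : ℝ) ^ n * u⌋ / 2 ^ n)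
  rw [abs_sub_comm u] at h3
  rw [show 4 * C * (1 / 2 : ℝ) ^ n = C * (4 * (1 / 2) ^ n) by ring]
  gcongr
  linarith

lemma enorm_sub_eq_lintegral_le [IsProbabilityMeasure P] (J : H →ₗᵢ[ℝ] Lp ℝ 2 P) (f g : H) :
    ∫⁻ ω, ‖J f ω - J g ω‖ₑ ∂P ≤ ‖f - g‖ₑ := by
  have h1 : ‖f - g‖ₑ = eLpNorm (J (f - g)) 2 P := by
    rw [← Lp.enorm_def, ← ofReal_norm, ← ofReal_norm, J.norm_map]
  rw [h1, map_sub, eLpNorm_congr_ae (Lp.coeFn_sub (J f) (J g))]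
  refine le_trans ?_ (eLpNorm_le_eLpNorm_of_exponent_le (p := 1) (by norm_num)
    ((Lp.aestronglyMeasurable _).sub (Lp.aestronglyMeasurable _)))
  rw [eLpNorm_one_eq_lintegral_enorm]
  rfl

/-- For fixed `(u, t)` consecutive dyadic approximations differ in mean by at most a constant times
`2^(-n/2)`, which is summable. -/
lemma fieldVersion_ae_eq [IsProbabilityMeasure P] (hC : 0 ≤ C)
    (hk : ∀ u u', ∀ t ∈ Icc (0 : ℝ) 1, ∀ t' ∈ Icc (0 : ℝ) 1,
      ‖k u t - k u' t'‖ ^ 2 ≤ C * (|u - u'| + |t - t'|)) (u : ℝ) {t : ℝ}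
    (ht : t ∈ Icc (0 : ℝ) 1) : fieldVersion J k u t =ᵐ[P] J (k u t) := by
  set f : ℕ → H := fun n => k (⌊(2 : ℝ) ^ n * u⌋ / 2 ^ n) (⌊(2 : ℝ) ^ n * t⌋₊ / 2 ^ n) with hf
  have hhalf : (0 : ℝ) ≤ √(1 / 2) ∧ √(1 / 2 : ℝ) < 1 :=
    ⟨by positivity, by rw [Real.sqrt_lt' one_pos]; norm_num⟩
  refine ae_limsup_eq_of_tsum (g := fun n => J (f n)) (ζ := J (k u t))
    (fun n => (measurable_coeFn_Lp _).aemeasurable) ?_ ?_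
  · have h1 (n : ℕ) : ∫⁻ ω, ‖J (f (n + 1)) ω - J (f n) ω‖ₑ ∂P
        ≤ ENNReal.ofReal (√(4 * C) * √(1 / 2) ^ n) := by
      refine (enorm_sub_eq_lintegral_le J _ _).trans ?_
      rw [← ofReal_norm]
      refine ENNReal.ofReal_le_ofReal ?_
      refine (sq_le_sq₀ (norm_nonneg _) (by positivity)).1 ?_
      rw [mul_pow, Real.sq_sqrt (by positivity), ← pow_mul, mul_comm n 2, pow_mul,
        Real.sq_sqrt (by positivity)]
      refine norm_floor_sub_floor_le hC hk n (n + 1) n.le_succ u (natFloor_div_mem_Icc _ ht)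
        (natFloor_div_mem_Icc _ ht) ?_
      have h2 := abs_natFloor_div_sub_le n ht.1
      have h3 := (abs_natFloor_div_sub_le (n + 1) ht.1).trans
        (pow_le_pow_of_le_one (by norm_num : (0 : ℝ) ≤ 1 / 2) (by norm_num) n.le_succ)
      have h4 := abs_sub_le ((⌊(2 : ℝ) ^ (n + 1) * t⌋₊ : ℝ) / 2 ^ (n + 1)) t
        (⌊(2 : ℝ) ^ n * t⌋₊ / 2 ^ n)
      rw [abs_sub_comm t] at h4
      linarith
    refine ((ENNReal.tsum_le_tsum h1).trans_lt ?_).ne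
    exact ((summable_geometric_of_lt_one hhalf.1 hhalf.2).mul_left _).tsum_ofReal_lt_top
  · have h1 : Tendsto f atTop (𝓝 (k u t)) := by
      rw [tendsto_iff_norm_sub_tendsto_zero]
      have h2 : Tendsto (fun n => ‖f n - k u t‖ ^ 2) atTop (𝓝 0) := by
        refine squeeze_zero (fun n => by positivity)
          (g := fun n => C * ((1 / 2) ^ n + (1 / 2) ^ n)) (fun n => ?_) ?_
        · refine (hk _ _ _ (natFloor_div_mem_Icc n ht) _ ht).trans ?_
          gcongr
          · exact abs_floor_div_sub_le n u
          · exact abs_natFloor_div_sub_le n ht.1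
        · have h3 := tendsto_pow_atTop_nhds_zero_of_lt_one (by norm_num : (0 : ℝ) ≤ 1 / 2)
            (by norm_num)
          simpa using (h3.add h3).const_mul C
      have h3 := (Real.continuous_sqrt.tendsto _).comp h2
      simpa [Function.comp_def, Real.sqrt_sq] using h3
    exact tendstoInMeasure_of_tendsto_Lp ((J.continuous.tendsto _).comp h1)

end Field

/-! ### Pathwise continuity from fourth-power increments -/

section SamplePaths

lemma eLpNorm_two_le_of_lintegral_pow_four {α : Type*} [MeasurableSpace α] {μ : Measure α}
    [IsProbabilityMeasure μ] {f : α → ℝ} (hf : AEStronglyMeasurable f μ) {b : ℝ} (hb : 0 ≤ b)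
    (h : ∫⁻ u, ‖f u‖ₑ ^ 4 ∂μ ≤ ENNReal.ofReal b) :
    eLpNorm f 2 μ ≤ ENNReal.ofReal (b ^ (1 / 4 : ℝ)) := by
  refine (eLpNorm_le_eLpNorm_of_exponent_le (q := 4) (by norm_num) hf).trans ?_
  rw [eLpNorm_eq_lintegral_rpow_enorm_toReal (by norm_num) (by norm_num),
    ← ENNReal.ofReal_rpow_of_nonneg hb (by norm_num)]
  have h4 : (4 : ℝ≥0∞).toReal = ((4 : ℕ) : ℝ) := by norm_num
  simp_rw [h4, ENNReal.rpow_natCast]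
  exact ENNReal.rpow_le_rpow h (by norm_num)

-- Increments `b (2/3)ⁿ` in fourth power are `(b (2/3)ⁿ)^(1/4)` in `L²`, hence summable: chaining
-- gives a path, and the pointwise `limsup` represents it at every time. It is applied with `ω`
-- frozen.
open Classical in
lemma exists_continuous_of_lintegral_pow_four {μ : Measure ℝ} [IsProbabilityMeasure μ]
    {g : ℕ → ℕ → ℝ → ℝ} (hg : ∀ n j, Measurable (g n j))
    (h4 : ∀ n, ∀ j ≤ 2 ^ n, ∫⁻ u, ‖g n j u‖ₑ ^ 4 ∂μ ≠ ∞) {b : ℝ} (hb : 0 ≤ b)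
    (h1 : ∀ n, ∀ j ≤ 2 ^ (n + 1),
      ∫⁻ u, ‖g (n + 1) j u - g n (j / 2) u‖ₑ ^ 4 ∂μ ≤ ENNReal.ofReal (b * (2 / 3) ^ n))
    (h2 : ∀ n, ∀ j < 2 ^ n,
      ∫⁻ u, ‖g n (j + 1) u - g n j u‖ₑ ^ 4 ∂μ ≤ ENNReal.ofReal (b * (2 / 3) ^ n)) :
    ∃ x : C(Icc (0 : ℝ) 1, Lp ℝ 2 μ), ∀ t : Icc (0 : ℝ) 1,
      x t =ᵐ[μ] fun u => limsup (fun n => g n ⌊(2 : ℝ) ^ n * t⌋₊ u) atTop := by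
  have hmem : ∀ n, ∀ j ≤ 2 ^ n, MemLp (g n j) 2 μ := by
    intro n j hj
    refine ⟨(hg n j).aestronglyMeasurable, ?_⟩
    refine (eLpNorm_two_le_of_lintegral_pow_four (hg n j).aestronglyMeasurable
      ENNReal.toReal_nonneg (ENNReal.ofReal_toReal (h4 n j hj)).ge).trans_lt ENNReal.ofReal_lt_top
  set F : ℕ → ℕ → Lp ℝ 2 μ := fun n j => if h : MemLp (g n j) 2 μ then h.toLp else 0 with hF
  have hFe : ∀ n, ∀ j ≤ 2 ^ n, F n j =ᵐ[μ] g n j := by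
    intro n j hj
    simp only [hF, dif_pos (hmem n j hj)]
    exact (hmem n j hj).coeFn_toLp
  set δ : ℕ → ℝ := fun n => (b * (2 / 3) ^ n) ^ (1 / 4 : ℝ) with hδd
  have hδ : Summable δ := by
    have : δ = fun n => b ^ (1 / 4 : ℝ) * ((2 / 3 : ℝ) ^ (1 / 4 : ℝ)) ^ n := by
      ext n
      simp only [hδd]
      rw [Real.mul_rpow hb (by positivity), ← Real.rpow_natCast, ← Real.rpow_natCast,
        ← Real.rpow_mul (by norm_num), ← Real.rpow_mul (by norm_num), mul_comm (n : ℝ)]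
    rw [this]
    exact (summable_geometric_of_lt_one (by positivity)
      (Real.rpow_lt_one (by norm_num) (by norm_num) (by norm_num))).mul_left _
  have hnorm {n m i j : ℕ} (hi : i ≤ 2 ^ n) (hj : j ≤ 2 ^ m) {c : ℝ} (hc : 0 ≤ c)
      (h : eLpNorm (fun u => g n i u - g m j u) 2 μ ≤ ENNReal.ofReal c) :
      ‖F n i - F m j‖ ≤ c := by
    rw [Lp.norm_def]
    refine ENNReal.toReal_le_of_le_ofReal hc (le_trans (le_of_eq ?_) h)
    refine eLpNorm_congr_ae ?_
    filter_upwards [Lp.coeFn_sub (F n i) (F m j), hFe n i hi, hFe m j hj] with u h3 h4 h5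
    rw [h3, Pi.sub_apply, h4, h5]
  have hd (n m i j : ℕ) : AEStronglyMeasurable (fun u => g n i u - g m j u) μ :=
    ((hg n i).sub (hg m j)).aestronglyMeasurable
  have hδ0 (n : ℕ) : 0 ≤ δ n := by simp only [hδd]; positivity
  obtain ⟨x, hx⟩ := exists_continuous_of_chain (F := F) hδ
    (fun n k hk => hnorm hk (by omega) (hδ0 n)
      (eLpNorm_two_le_of_lintegral_pow_four (hd _ _ _ _) (by positivity) (h1 n k hk)))
    (fun n k hk => hnorm hk hk.le (hδ0 n)
      (eLpNorm_two_le_of_lintegral_pow_four (hd _ _ _ _) (by positivity) (h2 n k hk)))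
  refine ⟨x, fun t => ?_⟩
  have hfloor (n : ℕ) : ⌊(2 : ℝ) ^ n * t⌋₊ ≤ 2 ^ n := by
    refine Nat.floor_le_of_le ?_
    push_cast
    exact mul_le_of_le_one_right (by positivity) t.2.2
  symm
  refine ae_limsup_eq_of_tsum (g := fun n => g n ⌊(2 : ℝ) ^ n * t⌋₊)
    (fun n => (hg _ _).aemeasurable) ?_ ?_
  · have h3 (n : ℕ) : ∫⁻ u, ‖g (n + 1) ⌊(2 : ℝ) ^ (n + 1) * t⌋₊ u - g n ⌊(2 : ℝ) ^ n * t⌋₊ u‖ₑ ∂μ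
        ≤ ENNReal.ofReal (δ n) := by
      rw [← eLpNorm_one_eq_lintegral_enorm]
      refine (eLpNorm_le_eLpNorm_of_exponent_le (q := 2) (by norm_num) (hd _ _ _ _)).trans ?_
      refine eLpNorm_two_le_of_lintegral_pow_four (hd _ _ _ _) (by positivity) ?_
      rw [show ⌊(2 : ℝ) ^ n * t⌋₊ = ⌊(2 : ℝ) ^ (n + 1) * t⌋₊ / 2 by
        rw [← Nat.floor_div_ofNat]
        congr 1
        ring]
      exact h1 n _ (hfloor _)
    exact ((ENNReal.tsum_le_tsum h3).trans_lt hδ.tsum_ofReal_lt_top).ne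
  · exact (tendstoInMeasure_of_tendsto_Lp (hx t)).congr (fun n => hFe _ _ (hfloor n)) ae_eq_rfl

end SamplePaths

/-! ### Almost sure continuity of the field in time -/

section FieldPaths

variable {Ω H : Type*} [MeasurableSpace Ω] {P : Measure Ω} [IsProbabilityMeasure P]
  [NormedAddCommGroup H] [InnerProductSpace ℝ H] {J : H →ₗᵢ[ℝ] Lp ℝ 2 P}

/-- Scaling to a unit vector. The standard normal fourth moment is left unevaluated since only its
finiteness matters. -/
lemma IsIsonormal.lintegral_pow_four (hJ : IsIsonormal J) (f : H) :
    ∫⁻ ω, ‖J f ω‖ₑ ^ 4 ∂P = (∫⁻ x, ‖x‖ₑ ^ 4 ∂(gaussianReal 0 1)) * ‖f‖ₑ ^ 4 := by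
  rcases eq_or_ne f 0 with rfl | hf
  · have : ∫⁻ ω, ‖(0 : Lp ℝ 2 P) ω‖ₑ ^ 4 ∂P = ∫⁻ ω, 0 ∂P :=
      lintegral_congr fun ω => by simp
    rw [map_zero, enorm_zero, this]
    simp
  · have h0 : ‖f‖ ≠ 0 := norm_ne_zero_iff.2 hf
    have h1 : ‖(‖f‖⁻¹ : ℝ) • f‖ = 1 := by
      rw [norm_smul, norm_inv, norm_norm, inv_mul_cancel₀ h0]
    have h2 := (hJ.hasLaw_of_norm_one h1).lintegral_comp
      (f := fun x : ℝ => ‖x‖ₑ ^ 4) (by fun_prop)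
    rw [← h2, ← lintegral_mul_const _ (((measurable_coeFn_Lp _).enorm).pow_const 4)]
    refine lintegral_congr_ae ?_
    have h3 : J f = ‖f‖ • J ((‖f‖⁻¹ : ℝ) • f) := by
      rw [map_smul, smul_smul, mul_inv_cancel₀ h0, one_smul]
    filter_upwards [Lp.coeFn_smul ‖f‖ (J ((‖f‖⁻¹ : ℝ) • f))] with ω h4
    rw [h3, h4, Pi.smul_apply, smul_eq_mul, enorm_mul, mul_pow, enorm_norm, mul_comm]

lemma lintegral_pow_four_gaussianReal_ne_top : ∫⁻ x, ‖x‖ₑ ^ 4 ∂(gaussianReal 0 1) ≠ ∞ := by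
  have h := (memLp_id_gaussianReal (μ := 0) (v := 1) 4).2
  rw [eLpNorm_lt_top_iff_lintegral_rpow_enorm_lt_top (by norm_num) (by simp)] at h
  have h4 : (((4 : ℝ≥0) : ℝ≥0∞)).toReal = ((4 : ℕ) : ℝ) := by norm_num
  simp_rw [h4, ENNReal.rpow_natCast] at h
  exact h.ne

lemma IsIsonormal.lintegral_sub_pow_four_le (hJ : IsIsonormal J) {f g : H} {b : ℝ}
    (h : ‖f - g‖ ^ 2 ≤ b) :
    ∫⁻ ω, ‖J f ω - J g ω‖ₑ ^ 4 ∂P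
      ≤ (∫⁻ x, ‖x‖ₑ ^ 4 ∂(gaussianReal 0 1)) * ENNReal.ofReal (b ^ 2) := by
  have h1 : ∫⁻ ω, ‖J f ω - J g ω‖ₑ ^ 4 ∂P = ∫⁻ ω, ‖J (f - g) ω‖ₑ ^ 4 ∂P := by
    refine lintegral_congr_ae ?_
    rw [map_sub]
    filter_upwards [Lp.coeFn_sub (J f) (J g)] with ω h2
    rw [h2, Pi.sub_apply]
  rw [h1, hJ.lintegral_pow_four]
  gcongr
  rw [← ofReal_norm, ← ENNReal.ofReal_pow (norm_nonneg _)]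
  refine ENNReal.ofReal_le_ofReal ?_
  calc ‖f - g‖ ^ 4 = (‖f - g‖ ^ 2) ^ 2 := by ring
    _ ≤ b ^ 2 := by gcongr

variable {k : ℝ → ℝ → H} {C : ℝ} {μ : Measure ℝ} [IsProbabilityMeasure μ]

lemma lintegral_lintegral_le_of_forall {G : ℝ → Ω → ℝ} (hG : Measurable fun x : ℝ × Ω => G x.1 x.2)
    {B : ℝ≥0∞} (h : ∀ u, ∫⁻ ω, ‖G u ω‖ₑ ^ 4 ∂P ≤ B) :
    ∫⁻ ω, ∫⁻ u, ‖G u ω‖ₑ ^ 4 ∂μ ∂P ≤ B := by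
  rw [lintegral_lintegral_swap]
  · exact (lintegral_mono h).trans (by simp)
  · exact ((hG.comp measurable_swap).enorm.pow_const 4).aemeasurable

lemma div_two_pow_mem_Icc {n j : ℕ} (hj : j ≤ 2 ^ n) : (j : ℝ) / 2 ^ n ∈ Icc (0 : ℝ) 1 := by
  refine ⟨by positivity, ?_⟩
  rw [div_le_one (by positivity)]
  exact_mod_cast hj

lemma abs_div_two_pow_sub_le (n j : ℕ) :
    |(j : ℝ) / 2 ^ (n + 1) - ((j / 2 : ℕ) : ℝ) / 2 ^ n| ≤ 2 * (1 / 2) ^ n := by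
  have h1 : (j : ℝ) = 2 * ((j / 2 : ℕ) : ℝ) + ((j % 2 : ℕ) : ℝ) := by
    exact_mod_cast (Nat.div_add_mod j 2).symm
  have h2 : ((j % 2 : ℕ) : ℝ) ≤ 1 := by
    exact_mod_cast Nat.le_of_lt_succ (Nat.mod_lt j two_pos)
  have h3 : (j : ℝ) / 2 ^ (n + 1) - ((j / 2 : ℕ) : ℝ) / 2 ^ n
      = ((j % 2 : ℕ) : ℝ) / 2 * (1 / 2) ^ n := by
    rw [h1, one_div, inv_pow]
    field_simp
    ring
  rw [h3, abs_of_nonneg (by positivity)]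
  gcongr
  linarith

lemma IsIsonormal.lintegral_gridField_refine_le (hJ : IsIsonormal J) (hC : 0 ≤ C)
    (hk : ∀ u u', ∀ t ∈ Icc (0 : ℝ) 1, ∀ t' ∈ Icc (0 : ℝ) 1,
      ‖k u t - k u' t'‖ ^ 2 ≤ C * (|u - u'| + |t - t'|)) {n j : ℕ} (hj : j ≤ 2 ^ (n + 1)) :
    ∫⁻ ω, ∫⁻ u, ‖gridField J k (n + 1) j u ω - gridField J k n (j / 2) u ω‖ₑ ^ 4 ∂μ ∂P
      ≤ (∫⁻ x, ‖x‖ₑ ^ 4 ∂(gaussianReal 0 1)) * ENNReal.ofReal ((4 * C * (1 / 2) ^ n) ^ 2) :=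
  lintegral_lintegral_le_of_forall
    ((measurable_gridField J k _ _).sub (measurable_gridField J k _ _)) fun u =>
    hJ.lintegral_sub_pow_four_le <| norm_floor_sub_floor_le hC hk n (n + 1) n.le_succ u
      (div_two_pow_mem_Icc hj) (div_two_pow_mem_Icc (by omega)) (abs_div_two_pow_sub_le n j)

lemma IsIsonormal.lintegral_gridField_succ_le (hJ : IsIsonormal J) (hC : 0 ≤ C)
    (hk : ∀ u u', ∀ t ∈ Icc (0 : ℝ) 1, ∀ t' ∈ Icc (0 : ℝ) 1,
      ‖k u t - k u' t'‖ ^ 2 ≤ C * (|u - u'| + |t - t'|)) {n j : ℕ} (hj : j < 2 ^ n) :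
    ∫⁻ ω, ∫⁻ u, ‖gridField J k n (j + 1) u ω - gridField J k n j u ω‖ₑ ^ 4 ∂μ ∂P
      ≤ (∫⁻ x, ‖x‖ₑ ^ 4 ∂(gaussianReal 0 1)) * ENNReal.ofReal ((4 * C * (1 / 2) ^ n) ^ 2) :=
  lintegral_lintegral_le_of_forall
    ((measurable_gridField J k _ _).sub (measurable_gridField J k _ _)) fun u =>
    hJ.lintegral_sub_pow_four_le <| norm_floor_sub_floor_le hC hk n n le_rfl u
      (div_two_pow_mem_Icc hj) (div_two_pow_mem_Icc hj.le) <| by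
        rw [← sub_div, Nat.cast_succ, add_sub_cancel_left, abs_of_nonneg (by positivity), one_div,
          one_div, inv_pow]
        linarith [show (0 : ℝ) ≤ (2 ^ n)⁻¹ by positivity]

lemma measurable_gridField_left {P : Measure Ω} (J : H →ₗᵢ[ℝ] Lp ℝ 2 P) (k : ℝ → ℝ → H) (n j : ℕ)
    (ω : Ω) : Measurable fun u => gridField J k n j u ω :=
  Measurable.of_uncurry_right (f := gridField J k n j) (measurable_gridField J k n j)

/-- The total fourth-power increment of the field on the `n`-th dyadic grid. -/
noncomputable def gridOscillation (J : H →ₗᵢ[ℝ] Lp ℝ 2 P) (k : ℝ → ℝ → H) (μ : Measure ℝ) (n : ℕ)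
    (ω : Ω) : ℝ≥0∞ :=
  ∑ j ∈ Finset.range (2 ^ (n + 1) + 1),
      ∫⁻ u, ‖gridField J k (n + 1) j u ω - gridField J k n (j / 2) u ω‖ₑ ^ 4 ∂μ +
    ∑ j ∈ Finset.range (2 ^ n), ∫⁻ u, ‖gridField J k n (j + 1) u ω - gridField J k n j u ω‖ₑ ^ 4 ∂μ

lemma measurable_lintegral_gridField_sub {P : Measure Ω} (J : H →ₗᵢ[ℝ] Lp ℝ 2 P) (k : ℝ → ℝ → H)
    (μ : Measure ℝ) [SFinite μ] (n m i j : ℕ) :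
    Measurable fun ω => ∫⁻ u, ‖gridField J k n i u ω - gridField J k m j u ω‖ₑ ^ 4 ∂μ :=
  Measurable.lintegral_prod_left'
    (((measurable_gridField J k n i).sub (measurable_gridField J k m j)).enorm.pow_const 4)

lemma measurable_gridOscillation {P : Measure Ω} (J : H →ₗᵢ[ℝ] Lp ℝ 2 P) (k : ℝ → ℝ → H) (μ : Measure ℝ)
    [IsProbabilityMeasure μ] (n : ℕ) : Measurable (gridOscillation J k μ n) :=
  (Finset.measurable_fun_sum _ fun _ _ => measurable_lintegral_gridField_sub J k μ _ _ _ _).add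
    (Finset.measurable_fun_sum _ fun _ _ => measurable_lintegral_gridField_sub J k μ _ _ _ _)

/-- About `2ⁿ` increments, each of fourth moment of order `4⁻ⁿ`. Second moments would only give a
bound of order 1, which is why fourth powers are used. -/
lemma IsIsonormal.lintegral_gridOscillation_le (hJ : IsIsonormal J) (hC : 0 ≤ C)
    (hk : ∀ u u', ∀ t ∈ Icc (0 : ℝ) 1, ∀ t' ∈ Icc (0 : ℝ) 1,
      ‖k u t - k u' t'‖ ^ 2 ≤ C * (|u - u'| + |t - t'|)) (n : ℕ) :
    ∫⁻ ω, gridOscillation J k μ n ω ∂P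
      ≤ (∫⁻ x, ‖x‖ₑ ^ 4 ∂(gaussianReal 0 1)) * ENNReal.ofReal (64 * C ^ 2 * (1 / 2) ^ n) := by
  set M := ∫⁻ x, ‖x‖ₑ ^ 4 ∂(gaussianReal 0 1)
  simp only [gridOscillation]
  rw [lintegral_add_left
    (Finset.measurable_fun_sum _ fun _ _ => measurable_lintegral_gridField_sub J k μ _ _ _ _),
    lintegral_finsetSum _ fun _ _ => measurable_lintegral_gridField_sub J k μ _ _ _ _,
    lintegral_finsetSum _ fun _ _ => measurable_lintegral_gridField_sub J k μ _ _ _ _]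
  refine (add_le_add (Finset.sum_le_sum fun j hj => hJ.lintegral_gridField_refine_le hC hk
    (Nat.lt_succ_iff.1 (Finset.mem_range.1 hj))) (Finset.sum_le_sum fun j hj =>
    hJ.lintegral_gridField_succ_le hC hk (Finset.mem_range.1 hj))).trans ?_
  simp only [Finset.sum_const, Finset.card_range, nsmul_eq_mul]
  rw [← add_mul, ← Nat.cast_add, mul_left_comm, ← ENNReal.ofReal_natCast,
    ← ENNReal.ofReal_mul (by positivity)]
  refine mul_le_mul_right (ENNReal.ofReal_le_ofReal ?_) _
  push_cast
  have h2 : (1 : ℝ) ≤ 2 ^ n := one_le_pow₀ (by norm_num)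
  have h3 : (2 : ℝ) ^ n * (1 / 2) ^ n = 1 := by rw [← mul_pow]; norm_num
  calc (2 ^ (n + 1) + 1 + 2 ^ n : ℝ) * (4 * C * (1 / 2) ^ n) ^ 2
      ≤ (4 * 2 ^ n) * (4 * C * (1 / 2) ^ n) ^ 2 := by
        gcongr
        rw [pow_succ]
        linarith
    _ = 64 * C ^ 2 * (1 / 2) ^ n * (2 ^ n * (1 / 2) ^ n) := by ring
    _ = 64 * C ^ 2 * (1 / 2) ^ n := by rw [h3, mul_one]

lemma IsIsonormal.ae_lintegral_gridField_ne_top (hJ : IsIsonormal J)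
    (hk0 : ∀ u, ∀ t ∈ Icc (0 : ℝ) 1, ‖k u t‖ ≤ C) :
    ∀ᵐ ω ∂P, ∀ n, ∀ j ≤ 2 ^ n, ∫⁻ u, ‖gridField J k n j u ω‖ₑ ^ 4 ∂μ ≠ ∞ := by
  rw [ae_all_iff]
  intro n
  rw [ae_all_iff]
  intro j
  by_cases hj : j ≤ 2 ^ n
  · have hm : Measurable fun ω => ∫⁻ u, ‖gridField J k n j u ω‖ₑ ^ 4 ∂μ :=
      Measurable.lintegral_prod_left' ((measurable_gridField J k n j).enorm.pow_const 4)
    have h1 : ∫⁻ ω, ∫⁻ u, ‖gridField J k n j u ω‖ₑ ^ 4 ∂μ ∂P ≠ ∞ := by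
      refine ((lintegral_lintegral_le_of_forall (measurable_gridField J k n j)
        (B := (∫⁻ x, ‖x‖ₑ ^ 4 ∂(gaussianReal 0 1)) * ENNReal.ofReal (C ^ 4))
        fun u => ?_).trans_lt (ENNReal.mul_lt_top
          lintegral_pow_four_gaussianReal_ne_top.lt_top ENNReal.ofReal_lt_top)).ne
      simp only [gridField]
      rw [hJ.lintegral_pow_four]
      gcongr
      rw [← ofReal_norm, ← ENNReal.ofReal_pow (norm_nonneg _)]
      refine ENNReal.ofReal_le_ofReal ?_
      gcongr
      exact hk0 _ _ (div_two_pow_mem_Icc hj)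
    filter_upwards [ae_lt_top hm h1] with ω h _ using h.ne
  · exact ae_of_all _ fun ω h => absurd h hj

/-- The weight `(3/2)ⁿ` turns the decay `2⁻ⁿ` into `(3/4)ⁿ`, still summable; almost sure finiteness
of the weighted sum then gives each path the rate `(2/3)ⁿ`. -/
lemma IsIsonormal.lintegral_tsum_gridOscillation_ne_top (hJ : IsIsonormal J) (hC : 0 ≤ C)
    (hk : ∀ u u', ∀ t ∈ Icc (0 : ℝ) 1, ∀ t' ∈ Icc (0 : ℝ) 1,
      ‖k u t - k u' t'‖ ^ 2 ≤ C * (|u - u'| + |t - t'|)) :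
    ∫⁻ ω, ∑' n, ENNReal.ofReal ((3 / 2) ^ n) * gridOscillation J k μ n ω ∂P ≠ ∞ := by
  have hm (n : ℕ) : Measurable fun ω =>
      ENNReal.ofReal ((3 / 2) ^ n) * gridOscillation J k μ n ω :=
    (measurable_gridOscillation J k μ n).const_mul _
  rw [lintegral_tsum fun n => (hm n).aemeasurable]
  have h1 (n : ℕ) : ∫⁻ ω, ENNReal.ofReal ((3 / 2) ^ n) * gridOscillation J k μ n ω ∂P
      ≤ (∫⁻ x, ‖x‖ₑ ^ 4 ∂(gaussianReal 0 1)) *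
        ENNReal.ofReal (64 * C ^ 2 * (3 / 4) ^ n) := by
    rw [lintegral_const_mul _ (measurable_gridOscillation J k μ n)]
    refine (mul_le_mul_right (hJ.lintegral_gridOscillation_le hC hk n) _).trans (le_of_eq ?_)
    rw [mul_left_comm, ← ENNReal.ofReal_mul (by positivity)]
    congr 2
    rw [show (3 / 4 : ℝ) = 3 / 2 * (1 / 2) by norm_num, mul_pow]
    ring
  refine ((ENNReal.tsum_le_tsum h1).trans_lt ?_).ne
  rw [ENNReal.tsum_mul_left]
  refine ENNReal.mul_lt_top lintegral_pow_four_gaussianReal_ne_top.lt_top ?_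
  exact ((summable_geometric_of_lt_one (by norm_num) (by norm_num)).mul_left _).tsum_ofReal_lt_top

lemma lintegral_gridField_refine_le_gridOscillation {P : Measure Ω} (J : H →ₗᵢ[ℝ] Lp ℝ 2 P)
    (k : ℝ → ℝ → H) (μ : Measure ℝ) {n j : ℕ} (hj : j ≤ 2 ^ (n + 1)) (ω : Ω) :
    ∫⁻ u, ‖gridField J k (n + 1) j u ω - gridField J k n (j / 2) u ω‖ₑ ^ 4 ∂μ
      ≤ gridOscillation J k μ n ω := by
  have hj' : j ∈ Finset.range (2 ^ (n + 1) + 1) := by rw [Finset.mem_range]; omega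
  exact le_add_right (Finset.single_le_sum
    (f := fun j => ∫⁻ u, ‖gridField J k (n + 1) j u ω - gridField J k n (j / 2) u ω‖ₑ ^ 4 ∂μ)
    (fun _ _ => bot_le) hj')

lemma lintegral_gridField_succ_le_gridOscillation {P : Measure Ω} (J : H →ₗᵢ[ℝ] Lp ℝ 2 P)
    (k : ℝ → ℝ → H) (μ : Measure ℝ) {n j : ℕ} (hj : j < 2 ^ n) (ω : Ω) :
    ∫⁻ u, ‖gridField J k n (j + 1) u ω - gridField J k n j u ω‖ₑ ^ 4 ∂μ
      ≤ gridOscillation J k μ n ω :=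
  le_add_left (Finset.single_le_sum
    (f := fun j => ∫⁻ u, ‖gridField J k n (j + 1) u ω - gridField J k n j u ω‖ₑ ^ 4 ∂μ)
    (fun _ _ => bot_le) (Finset.mem_range.2 hj))

lemma IsIsonormal.ae_exists_continuous_version (hJ : IsIsonormal J) (hC : 0 ≤ C)
    (hk : ∀ u u', ∀ t ∈ Icc (0 : ℝ) 1, ∀ t' ∈ Icc (0 : ℝ) 1,
      ‖k u t - k u' t'‖ ^ 2 ≤ C * (|u - u'| + |t - t'|))
    (hk0 : ∀ u, ∀ t ∈ Icc (0 : ℝ) 1, ‖k u t‖ ≤ C) :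
    ∀ᵐ ω ∂P, ∃ x : C(Icc (0 : ℝ) 1, Lp ℝ 2 μ), ∀ t : Icc (0 : ℝ) 1,
      x t =ᵐ[μ] fun u => fieldVersion J k u t ω := by
  have hm (n : ℕ) : Measurable fun ω =>
      ENNReal.ofReal ((3 / 2) ^ n) * gridOscillation J k μ n ω :=
    (measurable_gridOscillation J k μ n).const_mul _
  have hsum : ∀ᵐ ω ∂P, ∑' n, ENNReal.ofReal ((3 / 2) ^ n) * gridOscillation J k μ n ω < ∞ :=
    ae_lt_top (Measurable.tsum hm) (hJ.lintegral_tsum_gridOscillation_ne_top (μ := μ) hC hk)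
  filter_upwards [hJ.ae_lintegral_gridField_ne_top (μ := μ) hk0, hsum] with ω h1 h2
  obtain ⟨B, hB⟩ : ∃ B, B = ∑' n, ENNReal.ofReal ((3 / 2) ^ n) * gridOscillation J k μ n ω :=
    ⟨_, rfl⟩
  rw [← hB] at h2
  have hosc (n : ℕ) : gridOscillation J k μ n ω ≤ ENNReal.ofReal (B.toReal * (2 / 3) ^ n) := by
    have h3 : ENNReal.ofReal ((3 / 2) ^ n) * gridOscillation J k μ n ω ≤ B :=
      hB ▸ ENNReal.le_tsum n
    rw [ENNReal.ofReal_mul ENNReal.toReal_nonneg, ENNReal.ofReal_toReal h2.ne]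
    calc gridOscillation J k μ n ω
        = ENNReal.ofReal ((3 / 2) ^ n) * gridOscillation J k μ n ω *
            ENNReal.ofReal ((2 / 3) ^ n) := by
          rw [mul_right_comm, ← ENNReal.ofReal_mul (by positivity), ← mul_pow]
          norm_num
      _ ≤ B * ENNReal.ofReal ((2 / 3) ^ n) := by gcongr
  exact exists_continuous_of_lintegral_pow_four (μ := μ) (g := fun n j u => gridField J k n j u ω)
    (fun n j => measurable_gridField_left J k n j ω) h1 ENNReal.toReal_nonneg
    (fun n j hj => (lintegral_gridField_refine_le_gridOscillation J k μ hj ω).trans (hosc n))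
    fun n j hj => (lintegral_gridField_succ_le_gridOscillation J k μ hj ω).trans (hosc n)

end FieldPaths

/-- This lets instance search find second countability of the `L²` spaces. -/
instance fact_two_ne_top : Fact ((2 : ℝ≥0∞) ≠ ∞) := ⟨by simp⟩

/-! ### Finite-rank approximation in `C([0,1], E)` -/

section Approximation

variable {E : Type*} [NormedAddCommGroup E] [InnerProductSpace ℝ E]

/-- The span of the first `n` elements of a dense sequence. -/
noncomputable def denseSpan (E : Type*) [NormedAddCommGroup E] [InnerProductSpace ℝ E]
    [TopologicalSpace.SeparableSpace E] (n : ℕ) : Submodule ℝ E :=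
  Submodule.span ℝ (TopologicalSpace.denseSeq E '' Iio n)

instance [TopologicalSpace.SeparableSpace E] (n : ℕ) : FiniteDimensional ℝ (denseSpan E n) :=
  FiniteDimensional.span_of_finite ℝ ((Set.finite_Iio n).image _)

lemma tendsto_starProjection_denseSpan [TopologicalSpace.SeparableSpace E] (x : E) :
    Tendsto (fun n => (denseSpan E n).starProjection x) atTop (𝓝 x) := by
  refine Submodule.starProjection_tendsto_self (denseSpan E)
    (fun m n h => Submodule.span_mono (image_mono (Iio_subset_Iio h))) x ?_
  rw [top_le_iff, ← Submodule.dense_iff_topologicalClosure_eq_top]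
  refine (TopologicalSpace.denseRange_denseSeq E).mono ?_
  rintro _ ⟨n, rfl⟩
  exact Submodule.mem_iSup_of_mem (n + 1)
    (Submodule.subset_span (mem_image_of_mem _ (Nat.lt_succ_self n)))

lemma measurable_starProjection {Ω : Type*} [MeasurableSpace Ω] [MeasurableSpace E] [BorelSpace E]
    [SecondCountableTopology E] (U : Submodule ℝ E) [FiniteDimensional ℝ U] {X : Ω → E}
    (hX : ∀ v : E, Measurable fun ω => inner ℝ v (X ω)) :
    Measurable fun ω => U.starProjection (X ω) := by
  have h (ω : Ω) : U.starProjection (X ω)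
      = ∑ i, inner ℝ (stdOrthonormalBasis ℝ U i : E) (X ω) • (stdOrthonormalBasis ℝ U i : E) := by
    rw [Submodule.starProjection_apply,
      (stdOrthonormalBasis ℝ U).orthogonalProjectionOnto_apply_eq_sum]
    simp
  simp_rw [h]
  exact Finset.measurable_fun_sum _ fun i _ => (hX _).smul_const _

/-- Multiplication of a vector by a fixed continuous scalar function. -/
noncomputable def smulConst {K : Type*} [TopologicalSpace K] [CompactSpace K] (b : C(K, ℝ)) :
    E →L[ℝ] C(K, E) :=
  LinearMap.mkContinuous
    { toFun := fun v => b • ContinuousMap.const K v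
      map_add' := fun v w => by ext; simp
      map_smul' := fun c v => by ext x; simp [smul_smul, mul_comm] } ‖b‖ fun v => by
    rw [ContinuousMap.norm_le _ (by positivity)]
    intro x
    simp only [LinearMap.coe_mk, AddHom.coe_mk, ContinuousMap.smul_apply', ContinuousMap.const_apply]
    rw [norm_smul]
    gcongr
    exact b.norm_coe_le_norm x

/-- The finite-rank operator on `C([0,1], E)` given by the Bernstein approximation followed by a
projection in `E`. -/
noncomputable def bernsteinProj (n : ℕ) (U : Submodule ℝ E) [U.HasOrthogonalProjection] :
    C(Icc (0 : ℝ) 1, E) →L[ℝ] C(Icc (0 : ℝ) 1, E) :=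
  (∑ i : Fin (n + 1), (smulConst (bernstein n i)).comp
      (U.subtypeL.comp (ContinuousLinearMap.proj (R := ℝ) (φ := fun _ : Fin (n + 1) => U) i))).comp
    (ContinuousLinearMap.pi fun i : Fin (n + 1) =>
      U.orthogonalProjectionOnto.comp (ContinuousMap.evalCLM ℝ (bernstein.z i)))

lemma bernsteinProj_apply (n : ℕ) (U : Submodule ℝ E) [U.HasOrthogonalProjection]
    (x : C(Icc (0 : ℝ) 1, E)) : bernsteinProj n U x
      = ∑ i : Fin (n + 1), smulConst (bernstein n i) (U.starProjection (x (bernstein.z i))) := by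
  simp only [bernsteinProj, ContinuousLinearMap.comp_apply, sum_apply]
  rfl

lemma bernsteinProj_eq (n : ℕ) (U : Submodule ℝ E) [U.HasOrthogonalProjection]
    (x : C(Icc (0 : ℝ) 1, E)) : bernsteinProj n U x
      = bernsteinApproximation n ((U.starProjection : C(E, E)).comp x) := by
  rw [bernsteinProj_apply]
  rfl

/-- The operator was built to factor through `Uⁿ⁺¹`, so its range is a quotient of a
finite-dimensional space. -/
lemma finiteDimensional_range_bernsteinProj (n : ℕ) (U : Submodule ℝ E) [FiniteDimensional ℝ U] :
    FiniteDimensional ℝ (LinearMap.range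
      (bernsteinProj n U : C(Icc (0 : ℝ) 1, E) →ₗ[ℝ] C(Icc (0 : ℝ) 1, E))) := by
  rw [bernsteinProj, ContinuousLinearMap.toLinearMap_comp]
  exact Submodule.finiteDimensional_of_le (LinearMap.range_comp_le_range _ _)

/-- Bernstein polynomials are nonnegative and sum to 1. -/
lemma norm_bernsteinApproximation_le (n : ℕ) (f : C(Icc (0 : ℝ) 1, E)) :
    ‖bernsteinApproximation n f‖ ≤ ‖f‖ := by
  rw [ContinuousMap.norm_le _ (norm_nonneg _)]
  intro t
  rw [bernsteinApproximation.apply]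
  refine (norm_sum_le _ _).trans ?_
  calc ∑ i : Fin (n + 1), ‖bernstein n i t • f (bernstein.z i)‖
      ≤ ∑ i : Fin (n + 1), bernstein n i t * ‖f‖ := by
        refine Finset.sum_le_sum fun i _ => ?_
        rw [norm_smul, Real.norm_of_nonneg bernstein_nonneg]
        exact mul_le_mul_of_nonneg_left (f.norm_coe_le_norm _) bernstein_nonneg
    _ = ‖f‖ := by rw [← Finset.sum_mul, bernstein.probability, one_mul]

lemma tendsto_bernsteinProj [TopologicalSpace.SeparableSpace E] (x : C(Icc (0 : ℝ) 1, E)) :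
    Tendsto (fun n => bernsteinProj n (denseSpan E n) x) atTop (𝓝 x) := by
  set y : ℕ → C(Icc (0 : ℝ) 1, E) := fun n =>
    ((denseSpan E n).starProjection : C(E, E)).comp x with hy
  have h1 : Tendsto y atTop (𝓝 x) := by
    rw [ContinuousMap.tendsto_iff_tendstoUniformly]
    -- Projections are contractions, so the projected paths inherit the modulus of continuity of
    -- `x`; equicontinuity on a compact interval makes pointwise convergence uniform.
    have heq : Equicontinuous fun n t => y n t := by
      intro t
      rw [Metric.equicontinuousAt_iff]
      intro ε hε
      obtain ⟨δ, hδ, h⟩ := Metric.continuousAt_iff.1 x.continuous.continuousAt ε hε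
      refine ⟨δ, hδ, fun s hs n => lt_of_le_of_lt ?_ (h hs)⟩
      change dist ((denseSpan E n).starProjection (x t)) ((denseSpan E n).starProjection (x s)) ≤ _
      rw [dist_comm, dist_eq_norm, dist_eq_norm, ← map_sub]
      exact (denseSpan E n).norm_starProjection_apply_le _
    have := (heq.tendsto_uniformFun_iff_pi atTop x).2
      (tendsto_pi_nhds.2 fun t => tendsto_starProjection_denseSpan (x t))
    exact UniformFun.tendsto_iff_tendstoUniformly.1 this
  have h2 : Tendsto (fun n => bernsteinApproximation n (y n - x)) atTop (𝓝 0) := by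
    refine squeeze_zero_norm (fun n => norm_bernsteinApproximation_le n _) ?_
    exact tendsto_iff_norm_sub_tendsto_zero.1 h1
  have h3 := h2.add (bernsteinApproximation_uniform x)
  rw [zero_add] at h3
  refine h3.congr fun n => ?_
  rw [bernsteinProj_eq]
  ext t
  simp only [ContinuousMap.add_apply, bernsteinApproximation.apply, ContinuousMap.sub_apply, smul_sub,
    Finset.sum_sub_distrib, sub_add_cancel]
  rfl

/-- Each approximation `bernsteinProj` depends on finitely many scalar products with values of the
path, and the path is their limit. Borel measurability thus reduces to scalars. -/
lemma measurable_continuousMap_of_inner {Ω : Type*} [MeasurableSpace Ω]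
    [SecondCountableTopology E] [MeasurableSpace C(Icc (0 : ℝ) 1, E)]
    [BorelSpace C(Icc (0 : ℝ) 1, E)] {X : Ω → C(Icc (0 : ℝ) 1, E)}
    (hX : ∀ (t : Icc (0 : ℝ) 1) (v : E), Measurable fun ω => inner ℝ v (X ω t)) : Measurable X := by
  borelize E
  refine measurable_of_tendsto_metrizable (f := fun n ω => bernsteinProj n (denseSpan E n) (X ω))
    (fun n => ?_) (tendsto_pi_nhds.2 fun ω => tendsto_bernsteinProj (X ω))
  simp_rw [bernsteinProj_apply]
  exact Finset.measurable_fun_sum _ fun i _ =>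
    (smulConst _).continuous.measurable.comp (measurable_starProjection _ (hX _))

end Approximation

/-! ### Scalar products of the field stay in the Gaussian space -/

section Weak

variable {Ω H : Type*} [MeasurableSpace Ω] {P : Measure Ω} [IsProbabilityMeasure P]
  [NormedAddCommGroup H] [InnerProductSpace ℝ H] {J : H →ₗᵢ[ℝ] Lp ℝ 2 P}
  {μ : Measure ℝ} [IsProbabilityMeasure μ] {y : ℝ → Ω → ℝ} {f : ℝ → H} {C : ℝ}

lemma integrable_prod_sq_of_ae_eq (hy : Measurable fun x : ℝ × Ω => y x.1 x.2)
    (hyf : ∀ u, y u =ᵐ[P] J (f u)) (hf : Continuous f) (hfC : ∀ u, ‖f u‖ ≤ C) :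
    Integrable (fun x : ℝ × Ω => y x.1 x.2 ^ 2) (μ.prod P) := by
  rw [integrable_prod_iff (hy.pow_const 2).aestronglyMeasurable]
  constructor
  · refine ae_of_all _ fun u => ?_
    refine ((memLp_two_iff_integrable_sq (Lp.aestronglyMeasurable _)).1 (Lp.memLp (J (f u)))).congr ?_
    filter_upwards [hyf u] with ω h
    rw [h]
  · have h (u : ℝ) : ∫ ω, ‖y u ω ^ 2‖ ∂P = ‖f u‖ ^ 2 := by
      rw [← J.norm_map, norm_sq_eq_integral_sq]
      refine integral_congr_ae ?_
      filter_upwards [hyf u] with ω h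
      rw [h, Real.norm_of_nonneg (sq_nonneg _)]
    simp_rw [h]
    refine Integrable.of_bound (by fun_prop) (C ^ 2) (ae_of_all _ fun u => ?_)
    rw [Real.norm_of_nonneg (sq_nonneg _)]
    gcongr
    exact hfC u

lemma integrable_prod_mul_of_ae_eq (hy : Measurable fun x : ℝ × Ω => y x.1 x.2)
    (hyf : ∀ u, y u =ᵐ[P] J (f u)) (hf : Continuous f) (hfC : ∀ u, ‖f u‖ ≤ C)
    (v : Lp ℝ 2 μ) (η : Lp ℝ 2 P) :
    Integrable (fun x : ℝ × Ω => y x.1 x.2 * (v x.1 * η x.2)) (μ.prod P) := by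
  refine MemLp.integrable_mul (p := 2) (q := 2) ?_ ?_
  · exact (memLp_two_iff_integrable_sq hy.aestronglyMeasurable).2
      (integrable_prod_sq_of_ae_eq hy hyf hf hfC)
  · rw [memLp_two_iff_integrable_sq (by
      exact (((measurable_coeFn_Lp v).comp measurable_fst).mul
        ((measurable_coeFn_Lp η).comp measurable_snd)).aestronglyMeasurable)]
    simp_rw [mul_pow]
    exact ((memLp_two_iff_integrable_sq (Lp.aestronglyMeasurable _)).1 (Lp.memLp v)).mul_prod
      ((memLp_two_iff_integrable_sq (Lp.aestronglyMeasurable _)).1 (Lp.memLp η))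

variable {ξ : Ω → Lp ℝ 2 μ}

lemma inner_eq_integral_mul_of_ae_eq {Ω : Type*} {μ : Measure ℝ} {y : ℝ → Ω → ℝ}
    {ξ : Ω → Lp ℝ 2 μ} {ω : Ω} (h : ξ ω =ᵐ[μ] fun u => y u ω) (v : Lp ℝ 2 μ) :
    inner ℝ v (ξ ω) = ∫ u, v u * y u ω ∂μ := by
  rw [L2.inner_def]
  refine integral_congr_ae ?_
  filter_upwards [h] with u hu
  simp [hu, mul_comm]

lemma measurable_integral_mul (hy : Measurable fun x : ℝ × Ω => y x.1 x.2) (v : Lp ℝ 2 μ) :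
    Measurable fun ω => ∫ u, v u * y u ω ∂μ :=
  (StronglyMeasurable.integral_prod_left (f := fun u ω => v u * y u ω)
    ((((measurable_coeFn_Lp v).comp measurable_fst).mul hy).stronglyMeasurable)).measurable

lemma integral_mul_inner (hy : Measurable fun x : ℝ × Ω => y x.1 x.2)
    (hyf : ∀ u, y u =ᵐ[P] J (f u)) (hf : Continuous f) (hfC : ∀ u, ‖f u‖ ≤ C)
    (hξ : ∀ᵐ ω ∂P, ξ ω =ᵐ[μ] fun u => y u ω) (v : Lp ℝ 2 μ) (η : Lp ℝ 2 P) :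
    ∫ ω, η ω * inner ℝ v (ξ ω) ∂P = ∫ u, v u * inner ℝ (J (f u)) η ∂μ := by
  have h1 : ∫ ω, η ω * inner ℝ v (ξ ω) ∂P = ∫ ω, ∫ u, y u ω * (v u * η ω) ∂μ ∂P := by
    refine integral_congr_ae ?_
    filter_upwards [hξ] with ω h
    rw [inner_eq_integral_mul_of_ae_eq h, ← integral_const_mul]
    exact integral_congr_ae (ae_of_all _ fun u => by ring)
  rw [h1, ← integral_integral_swap (integrable_prod_mul_of_ae_eq hy hyf hf hfC v η)]
  refine integral_congr_ae (ae_of_all _ fun u => ?_)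
  simp only
  rw [L2.inner_def, ← integral_const_mul]
  refine integral_congr_ae ?_
  filter_upwards [hyf u] with ω h
  simp only [h, RCLike.inner_apply, conj_trivial]
  ring

lemma memLp_two_inner (hy : Measurable fun x : ℝ × Ω => y x.1 x.2)
    (hyf : ∀ u, y u =ᵐ[P] J (f u)) (hf : Continuous f) (hfC : ∀ u, ‖f u‖ ≤ C)
    (hξ : ∀ᵐ ω ∂P, ξ ω =ᵐ[μ] fun u => y u ω) (v : Lp ℝ 2 μ) :
    MemLp (fun ω => inner ℝ v (ξ ω)) 2 P := by
  have hm : AEStronglyMeasurable (fun ω => inner ℝ v (ξ ω)) P := by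
    refine ⟨_, (measurable_integral_mul hy v).stronglyMeasurable, ?_⟩
    filter_upwards [hξ] with ω h using inner_eq_integral_mul_of_ae_eq h v
  rw [memLp_two_iff_integrable_sq hm]
  refine ((integrable_prod_sq_of_ae_eq (μ := μ) hy hyf hf hfC).integral_prod_right.const_mul
    (‖v‖ ^ 2)).mono' (hm.pow 2) ?_
  filter_upwards [hξ] with ω h
  have h1 : ∫ u, y u ω ^ 2 ∂μ = ‖ξ ω‖ ^ 2 := by
    rw [norm_sq_eq_integral_sq]
    refine integral_congr_ae ?_
    filter_upwards [h] with u hu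
    rw [hu]
  rw [h1, norm_pow, ← mul_pow]
  gcongr
  exact norm_inner_le_norm _ _

/-- Fubini shows that `⟨v, ξ⟩` is orthogonal to whatever is orthogonal to the range of `J`. That
range is closed, because `J` is an isometry on a complete space, so it contains `⟨v, ξ⟩`. -/
lemma exists_inner_ae_eq [CompleteSpace H] (hy : Measurable fun x : ℝ × Ω => y x.1 x.2)
    (hyf : ∀ u, y u =ᵐ[P] J (f u)) (hf : Continuous f) (hfC : ∀ u, ‖f u‖ ≤ C)
    (hξ : ∀ᵐ ω ∂P, ξ ω =ᵐ[μ] fun u => y u ω) (v : Lp ℝ 2 μ) :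
    ∃ g, (fun ω => inner ℝ v (ξ ω)) =ᵐ[P] J g := by
  have hζ := memLp_two_inner hy hyf hf hfC hξ v
  set R : Submodule ℝ (Lp ℝ 2 P) := LinearMap.range J.toLinearMap with hR
  have hcl : IsClosed (R : Set (Lp ℝ 2 P)) := by
    rw [hR, LinearMap.coe_range]
    exact J.isometry.isClosedEmbedding.isClosed_range
  have : CompleteSpace R := hcl.completeSpace_coe
  have hmem : hζ.toLp ∈ Rᗮᗮ := by
    rw [Submodule.mem_orthogonal]
    intro η hη
    rw [L2.inner_def]
    have h1 := integral_mul_inner hy hyf hf hfC hξ v η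
    rw [show ∫ u, v u * inner ℝ (J (f u)) η ∂μ = 0 by
      refine integral_eq_zero_of_ae (ae_of_all _ fun u => ?_)
      simp [(Submodule.mem_orthogonal _ _).1 hη (J (f u)) ⟨f u, rfl⟩]] at h1
    rw [← h1]
    refine integral_congr_ae ?_
    filter_upwards [hζ.coeFn_toLp] with ω h
    simp [h, mul_comm]
  rw [Submodule.orthogonal_orthogonal] at hmem
  obtain ⟨g, hg⟩ := hmem
  refine ⟨g, ?_⟩
  have hg' : J g = hζ.toLp := hg
  rw [hg']
  exact hζ.coeFn_toLp.symm

end Weak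

/-! ### The field as a Gaussian random element of path space -/

section PathElement

variable {Ω H : Type*} [MeasurableSpace Ω] {P : Measure Ω} [IsProbabilityMeasure P]
  [NormedAddCommGroup H] [InnerProductSpace ℝ H] {J : H →ₗᵢ[ℝ] Lp ℝ 2 P}
  {μ : Measure ℝ} [IsProbabilityMeasure μ] {k : ℝ → ℝ → H} {C : ℝ}

lemma IsIsonormal.exists_pathElement [MeasurableSpace C(Icc (0 : ℝ) 1, Lp ℝ 2 μ)]
    [BorelSpace C(Icc (0 : ℝ) 1, Lp ℝ 2 μ)] (hJ : IsIsonormal J) (hC : 0 ≤ C)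
    (hk : ∀ u u', ∀ t ∈ Icc (0 : ℝ) 1, ∀ t' ∈ Icc (0 : ℝ) 1,
      ‖k u t - k u' t'‖ ^ 2 ≤ C * (|u - u'| + |t - t'|))
    (hk0 : ∀ u, ∀ t ∈ Icc (0 : ℝ) 1, ‖k u t‖ ≤ C) :
    ∃ X : Ω → C(Icc (0 : ℝ) 1, Lp ℝ 2 μ), Measurable X ∧
      ∀ᵐ ω ∂P, ∀ t : Icc (0 : ℝ) 1, X ω t =ᵐ[μ] fun u => fieldVersion J k u t ω := by
  classical
  have h0 := hJ.ae_exists_continuous_version (μ := μ) hC hk hk0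
  -- The set of good `ω` need not be measurable, so the path is set to 0 on a measurable null set
  -- containing the bad ones.
  obtain ⟨B, hsub, hB, hPB⟩ := exists_measurable_superset_of_null (mem_ae_iff.1 h0)
  have hgood : ∀ ω ∉ B, ∃ x : C(Icc (0 : ℝ) 1, Lp ℝ 2 μ), ∀ t : Icc (0 : ℝ) 1,
      x t =ᵐ[μ] fun u => fieldVersion J k u t ω := by
    intro ω hω
    by_contra h
    exact hω (hsub h)
  choose x hx using hgood
  set X : Ω → C(Icc (0 : ℝ) 1, Lp ℝ 2 μ) := fun ω => if h : ω ∈ B then 0 else x ω h with hX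
  have hXx {ω : Ω} (h : ω ∉ B) : X ω = x ω h := by simp only [hX, dif_neg h]
  refine ⟨X, ?_, ?_⟩
  · refine measurable_continuousMap_of_inner fun t v => ?_
    have h1 : (fun ω => inner ℝ v (X ω t))
        = Bᶜ.indicator fun ω => ∫ u, v u * fieldVersion J k u t ω ∂μ := by
      ext ω
      by_cases h : ω ∈ B
      · rw [indicator_of_notMem (by simpa using h)]
        simp [hX, h]
      · rw [indicator_of_mem (by simpa using h), hXx h]
        exact inner_eq_integral_mul_of_ae_eq (ξ := fun _ => x ω h t)
          (y := fun u ω => fieldVersion J k u t ω) (hx ω h t) v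
    rw [h1]
    exact (measurable_integral_mul (measurable_fieldVersion J k t) v).indicator hB.compl
  · have : ∀ᵐ ω ∂P, ω ∉ B := by
      rw [ae_iff]
      simpa using hPB
    filter_upwards [this] with ω h
    rw [hXx h]
    exact hx ω h

variable {X : Ω → C(Icc (0 : ℝ) 1, Lp ℝ 2 μ)}

lemma continuous_kernel {H : Type*} [NormedAddCommGroup H] {k : ℝ → ℝ → H}
    (hk : ∀ u u', ∀ t ∈ Icc (0 : ℝ) 1, ∀ t' ∈ Icc (0 : ℝ) 1,
      ‖k u t - k u' t'‖ ^ 2 ≤ C * (|u - u'| + |t - t'|)) (t : Icc (0 : ℝ) 1) :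
    Continuous fun u => k u t := by
  rw [continuous_iff_continuousAt]
  intro u
  rw [ContinuousAt, tendsto_iff_norm_sub_tendsto_zero]
  have h1 : Tendsto (fun u' => ‖k u' t - k u t‖ ^ 2) (𝓝 u) (𝓝 0) := by
    refine squeeze_zero (fun _ => by positivity) (fun u' => hk u' u t t.2 t t.2) ?_
    have : Continuous fun u' => C * (|u' - u| + |(t : ℝ) - t|) := by fun_prop
    simpa using this.tendsto u
  have h2 := (Real.continuous_sqrt.tendsto _).comp h1
  simpa [Function.comp_def, Real.sqrt_sq] using h2

/-- Composed with `bernsteinProj`, a functional becomes a finite sum of scalar products with values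
of the path, and the range of `J` is closed under almost sure limits. No description of the dual of
the path space is needed. -/
lemma IsIsonormal.exists_dual_ae_eq [CompleteSpace H] (hJ : IsIsonormal J) (hC : 0 ≤ C)
    (hk : ∀ u u', ∀ t ∈ Icc (0 : ℝ) 1, ∀ t' ∈ Icc (0 : ℝ) 1,
      ‖k u t - k u' t'‖ ^ 2 ≤ C * (|u - u'| + |t - t'|))
    (hk0 : ∀ u, ∀ t ∈ Icc (0 : ℝ) 1, ‖k u t‖ ≤ C)
    (hX : ∀ᵐ ω ∂P, ∀ t : Icc (0 : ℝ) 1, X ω t =ᵐ[μ] fun u => fieldVersion J k u t ω)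
    (L : StrongDual ℝ C(Icc (0 : ℝ) 1, Lp ℝ 2 μ)) : ∃ g, (fun ω => L (X ω)) =ᵐ[P] J g := by
  have h1 (t : Icc (0 : ℝ) 1) (v : Lp ℝ 2 μ) :
      ∃ g, (fun ω => inner ℝ v (X ω t)) =ᵐ[P] J g :=
    exists_inner_ae_eq (measurable_fieldVersion J k t)
      (fun u => fieldVersion_ae_eq hC hk u t.2) (continuous_kernel hk t)
      (fun u => hk0 u t t.2) (hX.mono fun ω h => h t) v
  have h2 (n : ℕ) : ∃ g, (fun ω => L (bernsteinProj n (denseSpan _ n) (X ω))) =ᵐ[P] J g := by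
    set w : Fin (n + 1) → Lp ℝ 2 μ := fun i => (InnerProductSpace.toDual ℝ (Lp ℝ 2 μ)).symm
      (L.comp ((smulConst (bernstein n i)).comp (denseSpan (Lp ℝ 2 μ) n).starProjection)) with hw
    choose g hg using fun i : Fin (n + 1) => h1 (bernstein.z i) (w i)
    refine ⟨∑ i, (fun _ => (1 : ℝ)) i • g i, ?_⟩
    have hg' : ∀ᵐ ω ∂P, ∀ i, inner ℝ (w i) (X ω (bernstein.z i)) = J (g i) ω :=
      ae_all_iff.2 hg
    filter_upwards [hg', coeFn_sum_smul J (fun _ => 1) g] with ω h3 h4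
    rw [h4, bernsteinProj_apply, map_sum]
    refine Finset.sum_congr rfl fun i _ => ?_
    rw [← h3, one_mul, hw, InnerProductSpace.toDual_symm_apply]
    rfl
  choose g hg using h2
  refine hJ.exists_of_tendsto_ae (f := g) ?_
  have hg' : ∀ᵐ ω ∂P, ∀ n, L (bernsteinProj n (denseSpan _ n) (X ω)) = J (g n) ω :=
    ae_all_iff.2 hg
  filter_upwards [hg'] with ω h
  simp_rw [← h]
  exact (L.continuous.tendsto _).comp (tendsto_bernsteinProj (X ω))

/-- Formally `E[J a · J (k u t)] = ⟨k u t, a⟩`; Fubini justifies this after pairing with an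
arbitrary `v`. -/
lemma correlationOp_pathElement_apply (hC : 0 ≤ C)
    (hk : ∀ u u', ∀ t ∈ Icc (0 : ℝ) 1, ∀ t' ∈ Icc (0 : ℝ) 1,
      ‖k u t - k u' t'‖ ^ 2 ≤ C * (|u - u'| + |t - t'|))
    (hk0 : ∀ u, ∀ t ∈ Icc (0 : ℝ) 1, ‖k u t‖ ≤ C)
    (hX : ∀ᵐ ω ∂P, ∀ t : Icc (0 : ℝ) 1, X ω t =ᵐ[μ] fun u => fieldVersion J k u t ω)
    (hX2 : MemLp X 2 P) (a : H) (t : Icc (0 : ℝ) 1) :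
    correlationOp J hX2 a t =ᵐ[μ] fun u => inner ℝ (k u t) a := by
  have hcont := continuous_kernel hk t
  have hmem : MemLp (fun u => inner ℝ (k u t) a) 2 μ := by
    refine MemLp.of_bound (by fun_prop) (C * ‖a‖) (ae_of_all _ fun u => ?_)
    refine (norm_inner_le_norm _ _).trans ?_
    gcongr
    exact hk0 u t t.2
  have h1 : correlationOp J hX2 a t = hmem.toLp := by
    refine ext_inner_left ℝ fun v => ?_
    have h2 := map_correlationOp J hX2 ((innerSL ℝ v).comp (ContinuousMap.evalCLM ℝ t)) a
    have h3 := integral_mul_inner (measurable_fieldVersion J k t)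
      (fun u => fieldVersion_ae_eq hC hk u t.2) hcont (fun u => hk0 u t t.2)
      (hX.mono fun ω h => h t) v (J a)
    have h4 : inner ℝ v (correlationOp J hX2 a t) = ∫ ω, J a ω * inner ℝ v (X ω t) ∂P := h2
    rw [h4, h3, L2.inner_def]
    refine integral_congr_ae ?_
    filter_upwards [hmem.coeFn_toLp] with u hu
    rw [hu, J.inner_map_map]
    simp [mul_comm]
  rw [h1]
  exact hmem.coeFn_toLp

end PathElement

/-! ### Convolution, Plancherel and the normalization of the transform -/

section FourierConvolution

lemma memLp_comp_sub_left {F : Type*} [NormedAddCommGroup F] {f : ℝ → F} {p : ℝ≥0∞}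
    (hf : MemLp f p) (u : ℝ) : MemLp (fun x => f (u - x)) p :=
  hf.comp_measurePreserving (Measure.measurePreserving_sub_left volume u)

lemma tendsto_integral_mul_of_tendsto {f : ℝ → ℂ} (hf : MemLp f 2) {b : ℕ → Lp ℂ 2 (volume : Measure ℝ)}
    {a : Lp ℂ 2 (volume : Measure ℝ)} (h : Tendsto b atTop (𝓝 a)) :
    Tendsto (fun n => ∫ p, f p * b n p) atTop (𝓝 (∫ p, f p * a p)) := by
  have hf' : MemLp (fun p => (starRingEnd ℂ) (f p)) 2 := hf.star
  have h1 (c : Lp ℂ 2 (volume : Measure ℝ)) : ∫ p, f p * c p = inner ℂ hf'.toLp c := by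
    rw [L2.inner_def]
    refine integral_congr_ae ?_
    filter_upwards [hf'.coeFn_toLp] with p hp
    rw [hp]
    simp [mul_comm]
  simp_rw [h1]
  exact ((innerSL ℂ hf'.toLp).continuous.tendsto _).comp h

/-- Convolution with a Schwartz function acts on `L²` as a Fourier multiplier. -/
lemma exists_ae_eq_convolution_fourier_eq (ψ : 𝓢(ℝ, ℂ)) (a : Lp ℂ 2 (volume : Measure ℝ)) :
    ∃ A : Lp ℂ 2 (volume : Measure ℝ), (A =ᵐ[volume] fun u => ∫ p, ψ (u - p) * a p) ∧
      ((𝓕 A : Lp ℂ 2 (volume : Measure ℝ)) : ℝ → ℂ) =ᵐ[volume]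
        fun ξ => 𝓕 ψ ξ * (𝓕 a : Lp ℂ 2 (volume : Measure ℝ)) ξ := by
  set D := SchwartzMap.seminorm ℝ 0 0 (𝓕 ψ) with hD
  have hψ (ξ : ℝ) : ‖𝓕 ψ ξ‖ ≤ D := SchwartzMap.norm_le_seminorm ℝ (𝓕 ψ) ξ
  have hmul : MemLp (fun ξ => 𝓕 ψ ξ * (𝓕 a : Lp ℂ 2 (volume : Measure ℝ)) ξ) 2 := by
    refine MemLp.of_le_mul (c := D) (Lp.memLp (𝓕 a : Lp ℂ 2 (volume : Measure ℝ)))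
      ((𝓕 ψ).continuous.aestronglyMeasurable.mul (Lp.aestronglyMeasurable _))
      (ae_of_all _ fun ξ => ?_)
    rw [norm_mul]
    gcongr
    exact hψ ξ
  -- The convolution is defined on the Fourier side, where the multiplier is bounded by `D`, and is
  -- then matched with the integral through Schwartz approximations of `a`.
  refine ⟨𝓕⁻ hmul.toLp, ?_, ?_⟩
  swap
  · rw [FourierTransform.fourier_fourierInv_eq]
    exact hmul.coeFn_toLp
  have hdense := SchwartzMap.denseRange_toLpCLM (E := ℝ) (F := ℂ) (p := 2)
    (μ := (volume : Measure ℝ)) (by simp)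
  obtain ⟨b, hb, hba⟩ := mem_closure_iff_seq_limit.1 (hdense a)
  choose g hg using hb
  have hg' (n : ℕ) : (g n).toLp 2 = b n := hg n
  set c : ℕ → 𝓢(ℝ, ℂ) := fun n => SchwartzMap.convolution (ContinuousLinearMap.mul ℂ ℂ) (g n) ψ
    with hc
  have hsub (f g : Lp ℂ 2 (volume : Measure ℝ)) : 𝓕 (f - g) = 𝓕 f - 𝓕 g :=
    (Lp.fourierTransformₗᵢ ℝ ℂ).map_sub f g
  have hlim : Tendsto (fun n => (c n).toLp 2) atTop 
      (𝓝 (𝓕⁻ hmul.toLp : Lp ℂ 2 (volume : Measure ℝ))) := by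
    rw [tendsto_iff_norm_sub_tendsto_zero]
    refine squeeze_zero (fun _ => norm_nonneg _) (g := fun n => D * ‖b n - a‖) (fun n => ?_) ?_
    · rw [← Lp.norm_fourier_eq, ← Lp.norm_fourier_eq (b n - a), hsub, hsub,
        FourierTransform.fourier_fourierInv_eq, ← hg' n,
        SchwartzMap.toLp_fourier_eq, SchwartzMap.toLp_fourier_eq, hc,
        SchwartzMap.fourier_convolution]
      refine Lp.norm_le_mul_norm_of_ae_le_mul ?_
      filter_upwards [Lp.coeFn_sub ((SchwartzMap.pairing (ContinuousLinearMap.mul ℂ ℂ) (𝓕 (g n))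
        (𝓕 ψ)).toLp 2) hmul.toLp, Lp.coeFn_sub ((𝓕 (g n)).toLp 2) (𝓕 a), hmul.coeFn_toLp,
        SchwartzMap.coeFn_toLp (𝓕 (g n)) 2, SchwartzMap.coeFn_toLp (SchwartzMap.pairing
        (ContinuousLinearMap.mul ℂ ℂ) (𝓕 (g n)) (𝓕 ψ)) 2] with ξ h1 h2 h3 h4 h5
      rw [h1, h2, Pi.sub_apply, Pi.sub_apply, h3, h4, h5, SchwartzMap.pairing_apply_apply,
        ContinuousLinearMap.mul_apply', mul_comm, ← mul_sub, norm_mul]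
      gcongr
      exact hψ ξ
    · simpa using (tendsto_iff_norm_sub_tendsto_zero.1 hba).const_mul D
  -- The `L²` limit holds almost everywhere along a subsequence, while the integrals converge for
  -- every `u` by pairing with `ψ(u - ·) ∈ L²`.
  obtain ⟨ms, hms, hae⟩ := (tendstoInMeasure_of_tendsto_Lp hlim).exists_seq_tendsto_ae
  filter_upwards [hae, ae_all_iff.2 fun n => SchwartzMap.coeFn_toLp (c n) 2 volume] with u h1 h2
  refine tendsto_nhds_unique h1 ?_
  have h3 := (tendsto_integral_mul_of_tendsto (memLp_comp_sub_left (ψ.memLp 2) u) hba).comp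
    hms.tendsto_atTop
  refine h3.congr fun n => ?_
  simp only [Function.comp_apply]
  rw [h2, hc, SchwartzMap.convolution_apply, MeasureTheory.convolution_def, ← hg']
  refine integral_congr_ae ?_
  filter_upwards [SchwartzMap.coeFn_toLp (g (ms n)) 2] with p hp
  rw [hp, ContinuousLinearMap.mul_apply', mul_comm]

lemma ae_comp_div {c : ℝ} (hc : c ≠ 0) {p : ℝ → Prop} (h : ∀ᵐ x, p x) : ∀ᵐ l : ℝ, p (l / c) := by
  have h1 : ∀ᵐ x ∂(Measure.map (fun l : ℝ => l * c⁻¹) volume), p x := by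
    rw [Real.map_volume_mul_right (inv_ne_zero hc)]
    exact Measure.ae_smul_measure h _
  exact ae_of_ae_map (by fun_prop) h1

lemma fourierL2_congr {f g : ℝ → ℝ} (h : f =ᵐ[volume] g) : fourierL2 f = fourierL2 g := by
  have h' : (fun u => (f u : ℂ)) =ᵐ[volume] fun u => (g u : ℂ) := h.mono fun u hu => by simp [hu]
  ext l
  by_cases hf : MemLp (fun u => (f u : ℂ)) 2 volume
  · have hg := hf.ae_eq h'
    rw [fourierL2, fourierL2, dif_pos hf, dif_pos hg]
    rw [(MemLp.toLp_eq_toLp_iff hf hg).2 h']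
  · have hg : ¬ MemLp (fun u => (g u : ℂ)) 2 volume := fun hg => hf (hg.ae_eq h'.symm)
    rw [fourierL2, fourierL2, dif_neg hf, dif_neg hg]

/-- Plancherel's identity. -/
lemma lintegral_fourierL2_sq {f : ℝ → ℝ} (hf : MemLp f 2 volume) :
    ∫⁻ l, ‖fourierL2 f l‖ₑ ^ 2 = ENNReal.ofReal (2 * Real.pi) * ∫⁻ u, ‖f u‖ₑ ^ 2 := by
  have hπ : (2 * Real.pi) ≠ 0 := by positivity
  have hf' : MemLp (fun u => (f u : ℂ)) 2 volume := hf.ofReal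
  have hsq {E : Type} [NormedAddCommGroup E] (g : ℝ → E) :
      ∫⁻ u, ‖g u‖ₑ ^ 2 = eLpNorm g 2 volume ^ 2 := by
    have := eLpNorm_nnreal_pow_eq_lintegral (f := g) (μ := volume) (p := 2) (by norm_num)
    simpa using this.symm
  simp only [fourierL2, dif_pos hf']
  set A : Lp ℂ 2 (volume : Measure ℝ) := 𝓕 hf'.toLp with hA
  -- The dilation `l / 2π` is the sole source of the factor `2π`, since `𝓕` itself is unitary.
  have h1 : ∫⁻ l, ‖A (l / (2 * Real.pi))‖ₑ ^ 2
      = ∫⁻ x, ‖A x‖ₑ ^ 2 ∂(Measure.map (fun l : ℝ => l * (2 * Real.pi)⁻¹) volume) := by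
    rw [lintegral_map ((Lp.stronglyMeasurable A).measurable.enorm.pow_const 2) (by fun_prop)]
    rfl
  rw [h1, Real.map_volume_mul_right (inv_ne_zero hπ), lintegral_smul_measure, inv_inv,
    abs_of_pos (by positivity), smul_eq_mul, hsq, ← Lp.enorm_def, ← ofReal_norm, hA,
    Lp.norm_fourier_eq, ofReal_norm, Lp.enorm_def, eLpNorm_congr_ae hf'.coeFn_toLp, ← hsq]
  simp_rw [← ofReal_norm, Complex.norm_real]

lemma fourierInt_eq (φ : 𝓢(ℝ, ℝ)) (l : ℝ) :
    fourierInt φ l = 𝓕 (φ.postcompCLM Complex.ofRealCLM) (l / (2 * Real.pi)) := by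
  rw [SchwartzMap.fourier_coe, Real.fourier_real_eq_integral_exp_smul, fourierInt]
  refine integral_congr_ae (ae_of_all _ fun u => ?_)
  simp only [SchwartzMap.postcompCLM_apply, Complex.ofRealCLM_apply, smul_eq_mul]
  congr 2
  push_cast
  field_simp

lemma memLp_convolution_and_fourierL2_eq (φ : 𝓢(ℝ, ℝ)) {a : ℝ → ℝ} (ha : MemLp a 2 volume) :
    MemLp (fun u => ∫ p, φ (u - p) * a p) 2 volume ∧
      fourierL2 (fun u => ∫ p, φ (u - p) * a p) =ᵐ[volume]
        fun l => fourierInt φ l * fourierL2 a l := by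
  set ψ : 𝓢(ℝ, ℂ) := φ.postcompCLM Complex.ofRealCLM with hψ
  have ha' : MemLp (fun u => (a u : ℂ)) 2 volume := ha.ofReal
  obtain ⟨A, hA, hFA⟩ := exists_ae_eq_convolution_fourier_eq ψ ha'.toLp
  have h1 (u : ℝ) : ∫ p, ψ (u - p) * ha'.toLp (fun u => (a u : ℂ)) p
      = ((∫ p, φ (u - p) * a p : ℝ) : ℂ) := by
    rw [← integral_complex_ofReal]
    refine integral_congr_ae ?_
    filter_upwards [ha'.coeFn_toLp] with p hp
    rw [hp]
    simp [hψ]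
  simp_rw [h1] at hA
  have hf' : MemLp (fun u => ((∫ p, φ (u - p) * a p : ℝ) : ℂ)) 2 volume := (Lp.memLp A).ae_eq hA
  have hAe : hf'.toLp = A := Lp.ext (hf'.coeFn_toLp.trans hA.symm)
  refine ⟨by simpa using hf'.re, ?_⟩
  filter_upwards [ae_comp_div (c := 2 * Real.pi) (by positivity) hFA] with l hl
  rw [fourierL2, fourierL2, dif_pos hf', dif_pos ha', hAe, hl, fourierInt_eq]

/-- The energy of `φ * a` is the energy of `a`. -/
lemma lintegral_fourierL2_convolution_div (φ : 𝓢(ℝ, ℝ))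
    (hφ : ∀ᵐ l : ℝ ∂volume, fourierInt φ l ≠ 0) {a : ℝ → ℝ} (ha : MemLp a 2 volume) {f : ℝ → ℝ}
    (hf : f =ᵐ[volume] fun u => ∫ p, φ (u - p) * a p) :
    ∫⁻ l, ‖fourierL2 f l / fourierInt φ l‖ₑ ^ 2
      = ENNReal.ofReal (2 * Real.pi) * ∫⁻ u, ‖a u‖ₑ ^ 2 := by
  rw [← lintegral_fourierL2_sq ha, fourierL2_congr hf]
  refine lintegral_congr_ae ?_
  filter_upwards [hφ, (memLp_convolution_and_fourierL2_eq φ ha).2] with l h1 h2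
  rw [h2, mul_div_cancel_left₀ _ h1]

end FourierConvolution

/-! ### Kernel estimates -/

section Kernel

lemma halfPlaneMeasure_eq_prod :
    halfPlaneMeasure = (volume : Measure ℝ).prod (volume.restrict (Ici (0 : ℝ))) := by
  rw [halfPlaneMeasure, Measure.volume_eq_prod, ← Measure.prod_restrict, Measure.restrict_univ]

lemma memLp_mul_halfPlane {g w : ℝ → ℝ} (hg : MemLp g 2 volume)
    (hw : MemLp w 2 (volume.restrict (Ici (0 : ℝ)))) :
    MemLp (fun x : ℝ × ℝ => g x.1 * w x.2) 2 halfPlaneMeasure := by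
  rw [halfPlaneMeasure_eq_prod]
  refine (memLp_two_iff_integrable_sq (hg.1.comp_fst.mul hw.1.comp_snd)).2 ?_
  simp only [Pi.mul_apply, mul_pow]
  exact hg.integrable_sq.mul_prod hw.integrable_sq

lemma integral_mul_halfPlane_sq (g w : ℝ → ℝ) :
    ∫ x, (g x.1 * w x.2) ^ 2 ∂halfPlaneMeasure
      = (∫ p, g p ^ 2) * ∫ s in Ici (0 : ℝ), w s ^ 2 := by
  simp_rw [mul_pow]
  rw [halfPlaneMeasure_eq_prod, integral_prod_mul (fun p => g p ^ 2) fun s => w s ^ 2]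

/-- The indicator function of `[0, t]`. -/
noncomputable def timeIndicator (t s : ℝ) : ℝ := (Icc (0 : ℝ) t).indicator (fun _ => 1) s

lemma memLp_timeIndicator (t : ℝ) : MemLp (timeIndicator t) 2 (volume.restrict (Ici (0 : ℝ))) :=
  memLp_indicator_const 2 measurableSet_Icc 1 (Or.inr (by
    refine ((Measure.restrict_apply_le _ _).trans_lt ?_).ne
    simp))

lemma integral_timeIndicator_sub_sq {t t' : ℝ} (ht : 0 ≤ t) (ht' : 0 ≤ t') :
    ∫ s in Ici (0 : ℝ), (timeIndicator t s - timeIndicator t' s) ^ 2 = |t - t'| := by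
  wlog h : t' ≤ t generalizing t t'
  · rw [abs_sub_comm, ← this ht' ht (le_of_not_ge h)]
    exact integral_congr_ae (ae_of_all _ fun s => by ring)
  have h1 : (fun s => (timeIndicator t s - timeIndicator t' s) ^ 2)
      = (Ioc t' t).indicator fun _ => (1 : ℝ) := by
    ext s
    simp only [timeIndicator, indicator, mem_Icc, mem_Ioc]
    split_ifs <;> first | (norm_num; done) | (exfalso; grind)
  rw [h1, setIntegral_indicator measurableSet_Ioc,
    inter_eq_right.2 (show Ioc t' t ⊆ Ici 0 from fun s hs => ht'.trans hs.1.le)]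
  simp [abs_of_nonneg (sub_nonneg.2 h), h]

lemma integral_timeIndicator_sq {t : ℝ} (ht : 0 ≤ t) :
    ∫ s in Ici (0 : ℝ), timeIndicator t s ^ 2 = t := by
  have h1 : (fun s => timeIndicator t s ^ 2) = (Icc 0 t).indicator fun _ => (1 : ℝ) := by
    ext s
    simp only [timeIndicator, indicator]
    split_ifs <;> norm_num
  rw [h1, setIntegral_indicator measurableSet_Icc,
    inter_eq_right.2 (show Icc 0 t ⊆ Ici 0 from fun s hs => hs.1)]
  simp [ht]

variable (φ : 𝓢(ℝ, ℝ))

lemma indicator_eq_mul_timeIndicator (u t : ℝ) (x : ℝ × ℝ) :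
    (Icc (0 : ℝ) t).indicator (fun _ => φ (u - x.1)) x.2 = φ (u - x.1) * timeIndicator t x.2 := by
  simp only [timeIndicator, indicator]
  split_ifs <;> simp

lemma memLp_kernel (u t : ℝ) : MemLp
    (fun x : ℝ × ℝ => (Icc (0 : ℝ) t).indicator (fun _ => φ (u - x.1)) x.2) 2 halfPlaneMeasure := by
  simp_rw [indicator_eq_mul_timeIndicator]
  exact memLp_mul_halfPlane (memLp_comp_sub_left (φ.memLp 2) u) (memLp_timeIndicator t)

/-- The kernel `φ(u - p) 1_{[0,t]}(s)` of the field, as an element of `L²`. -/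
noncomputable def kernel (u t : ℝ) : Lp ℝ 2 halfPlaneMeasure := (memLp_kernel φ u t).toLp

lemma coeFn_kernel (u t : ℝ) :
    kernel φ u t =ᵐ[halfPlaneMeasure] fun x => φ (u - x.1) * timeIndicator t x.2 := by
  filter_upwards [(memLp_kernel φ u t).coeFn_toLp] with x hx
  rw [kernel, hx, indicator_eq_mul_timeIndicator]

lemma norm_kernel_sq {u t : ℝ} (ht : 0 ≤ t) : ‖kernel φ u t‖ ^ 2 = (∫ p, φ p ^ 2) * t := by
  rw [norm_sq_eq_integral_sq]
  rw [show ∫ x, kernel φ u t x ^ 2 ∂halfPlaneMeasure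
      = ∫ x, (φ (u - x.1) * timeIndicator t x.2) ^ 2 ∂halfPlaneMeasure by
    refine integral_congr_ae ?_
    filter_upwards [coeFn_kernel φ u t] with x hx
    rw [hx]]
  rw [integral_mul_halfPlane_sq (fun p => φ (u - p)) (timeIndicator t),
    integral_timeIndicator_sq ht, integral_sub_left_eq_self (fun p => φ p ^ 2)]

lemma norm_kernel_sub_time_sq (u : ℝ) {t t' : ℝ} (ht : 0 ≤ t) (ht' : 0 ≤ t') :
    ‖kernel φ u t - kernel φ u t'‖ ^ 2 = (∫ p, φ p ^ 2) * |t - t'| := by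
  rw [norm_sq_eq_integral_sq]
  rw [show ∫ x, (kernel φ u t - kernel φ u t') x ^ 2 ∂halfPlaneMeasure
      = ∫ x, (φ (u - x.1) * (timeIndicator t x.2 - timeIndicator t' x.2)) ^ 2
        ∂halfPlaneMeasure by
    refine integral_congr_ae ?_
    filter_upwards [coeFn_kernel φ u t, coeFn_kernel φ u t',
      Lp.coeFn_sub (kernel φ u t) (kernel φ u t')] with x h1 h2 h3
    rw [h3, Pi.sub_apply, h1, h2, mul_sub]]
  rw [integral_mul_halfPlane_sq (fun p => φ (u - p)) fun s => timeIndicator t s - timeIndicator t' s,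
    integral_timeIndicator_sub_sq ht ht', integral_sub_left_eq_self (fun p => φ p ^ 2)]

lemma norm_kernel_sub_space_sq (u u' : ℝ) {t : ℝ} (ht : 0 ≤ t) :
    ‖kernel φ u t - kernel φ u' t‖ ^ 2 = (∫ p, (φ (u - p) - φ (u' - p)) ^ 2) * t := by
  rw [norm_sq_eq_integral_sq]
  rw [show ∫ x, (kernel φ u t - kernel φ u' t) x ^ 2 ∂halfPlaneMeasure
      = ∫ x, ((φ (u - x.1) - φ (u' - x.1)) * timeIndicator t x.2) ^ 2
        ∂halfPlaneMeasure by
    refine integral_congr_ae ?_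
    filter_upwards [coeFn_kernel φ u t, coeFn_kernel φ u' t,
      Lp.coeFn_sub (kernel φ u t) (kernel φ u' t)] with x h1 h2 h3
    rw [h3, Pi.sub_apply, h1, h2, sub_mul]]
  rw [integral_mul_halfPlane_sq (fun p => φ (u - p) - φ (u' - p)) (timeIndicator t),
    integral_timeIndicator_sq ht]

/-- One factor of the square is bounded by the Lipschitz constant of `φ` and the other in `L¹`,
giving a linear bound for all `u, u'`. -/
lemma exists_integral_sub_sq_le :
    ∃ D, 0 ≤ D ∧ ∀ u u' : ℝ, ∫ p, (φ (u - p) - φ (u' - p)) ^ 2 ≤ D * |u - u'| := by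
  set L := SchwartzMap.seminorm ℝ 0 0 (SchwartzMap.derivCLM ℝ ℝ φ) with hL
  have hL0 : 0 ≤ L := apply_nonneg _ _
  have hlip : LipschitzWith L.toNNReal φ := by
    refine lipschitzWith_of_nnnorm_deriv_le φ.differentiable fun x => ?_
    rw [← SchwartzMap.derivCLM_apply ℝ φ x, ← NNReal.coe_le_coe, Real.coe_toNNReal _ hL0, coe_nnnorm]
    exact SchwartzMap.norm_le_seminorm ℝ _ x
  have hφ1 : Integrable fun p => |φ p| := φ.integrable.abs
  refine ⟨2 * L * ∫ p, |φ p|, by positivity, fun u u' => ?_⟩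
  have hint (u : ℝ) : Integrable fun p => |φ (u - p)| := hφ1.comp_sub_left u
  have hval (u : ℝ) : ∫ p, |φ (u - p)| = ∫ p, |φ p| :=
    integral_sub_left_eq_self (fun p => |φ p|) volume u
  calc ∫ p, (φ (u - p) - φ (u' - p)) ^ 2
      ≤ ∫ p, L * |u - u'| * (|φ (u - p)| + |φ (u' - p)|) := by
        refine integral_mono_of_nonneg (ae_of_all _ fun p => sq_nonneg _)
          (((hint u).add (hint u')).const_mul _) (ae_of_all _ fun p => ?_)
        have h1 := hlip.dist_le_mul (u - p) (u' - p)
        rw [Real.coe_toNNReal _ hL0, Real.dist_eq, Real.dist_eq, sub_sub_sub_cancel_right] at h1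
        simp only
        rw [← sq_abs, pow_two]
        exact mul_le_mul h1 (abs_sub _ _) (abs_nonneg _) (by positivity)
    _ = 2 * L * (∫ p, |φ p|) * |u - u'| := by
        rw [integral_const_mul, integral_add (hint u) (hint u'), hval, hval]
        ring

lemma exists_kernel_bounds : ∃ C, 0 ≤ C ∧
    (∀ u u', ∀ t ∈ Icc (0 : ℝ) 1, ∀ t' ∈ Icc (0 : ℝ) 1,
      ‖kernel φ u t - kernel φ u' t'‖ ^ 2 ≤ C * (|u - u'| + |t - t'|)) ∧
    ∀ u, ∀ t ∈ Icc (0 : ℝ) 1, ‖kernel φ u t‖ ≤ C := by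
  obtain ⟨D, hD, hDφ⟩ := exists_integral_sub_sq_le φ
  set N := ∫ p, φ p ^ 2 with hN
  have hN0 : 0 ≤ N := integral_nonneg fun p => sq_nonneg _
  refine ⟨2 * D + 2 * N + 1, by positivity, fun u u' t ht t' ht' => ?_, fun u t ht => ?_⟩
  · have h1 := norm_kernel_sub_space_sq φ u u' ht.1
    have h2 := norm_kernel_sub_time_sq φ u' ht.1 ht'.1
    have h3 : ‖kernel φ u t - kernel φ u' t‖ ^ 2 ≤ D * |u - u'| := by
      rw [h1]
      refine (mul_le_of_le_one_right (integral_nonneg fun p => sq_nonneg _) ht.2).trans (hDφ u u')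
    have h4 := norm_sub_le_norm_sub_add_norm_sub (kernel φ u t) (kernel φ u' t) (kernel φ u' t')
    have h5 : ‖kernel φ u t - kernel φ u' t'‖ ^ 2
        ≤ 2 * ‖kernel φ u t - kernel φ u' t‖ ^ 2 + 2 * ‖kernel φ u' t - kernel φ u' t'‖ ^ 2 := by
      refine (pow_le_pow_left₀ (norm_nonneg _) h4 2).trans ?_
      nlinarith [sq_nonneg (‖kernel φ u t - kernel φ u' t‖ - ‖kernel φ u' t - kernel φ u' t'‖)]
    rw [h2] at h5
    have h6 : 0 ≤ |u - u'| := abs_nonneg _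
    have h7 : 0 ≤ |t - t'| := abs_nonneg _
    have h8 : 0 ≤ D * |t - t'| := by positivity
    have h9 : 0 ≤ N * |u - u'| := by positivity
    linarith
  -- The bound `N ≤ (N + 1)²` avoids a square root in the constant.
  · refine le_trans ?_ (show N + 1 ≤ 2 * D + 2 * N + 1 by linarith)
    refine (sq_le_sq₀ (norm_nonneg _) (by positivity)).1 ?_
    rw [norm_kernel_sq φ ht.1]
    have := mul_le_of_le_one_right hN0 ht.2
    nlinarith

lemma inner_kernel (a : Lp ℝ 2 halfPlaneMeasure) (u : ℝ) {t : ℝ} (ht : 0 ≤ t) :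
    inner ℝ (kernel φ u t) a = ∫ s in (0 : ℝ)..t, ∫ p, φ (u - p) * a (p, s) := by
  have hint : Integrable (fun x => φ (u - x.1) * timeIndicator t x.2 * a x) halfPlaneMeasure :=
    (memLp_mul_halfPlane (memLp_comp_sub_left (φ.memLp 2) u)
      (memLp_timeIndicator t)).integrable_mul (Lp.memLp a)
  have h1 : inner ℝ (kernel φ u t) a
      = ∫ x, φ (u - x.1) * timeIndicator t x.2 * a x ∂halfPlaneMeasure := by
    rw [L2.inner_def]
    refine integral_congr_ae ?_
    filter_upwards [coeFn_kernel φ u t] with x hx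
    rw [hx]
    simp [mul_comm]
  rw [h1]
  -- The type of `a` mentions the measure; forgetting it lets the measure be rewritten as a product.
  generalize (a : ℝ × ℝ → ℝ) = f at hint ⊢
  rw [halfPlaneMeasure_eq_prod] at hint ⊢
  rw [ integral_prod_symm _ hint]
  have h3 (s : ℝ) : ∫ p, φ (u - p) * timeIndicator t s * f (p, s)
      = (Icc 0 t).indicator (fun s => ∫ p, φ (u - p) * f (p, s)) s := by
    by_cases hs : s ∈ Icc 0 t
    · simp only [timeIndicator, indicator_of_mem hs, mul_one]
    · simp only [timeIndicator, indicator_of_notMem hs, mul_zero, zero_mul, integral_zero]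
  simp only [h3]
  rw [setIntegral_indicator measurableSet_Icc,
    inter_eq_right.2 (show Icc 0 t ⊆ Ici 0 from fun s hs => hs.1),
    integral_Icc_eq_integral_Ioc, intervalIntegral.integral_of_le ht]

end Kernel

/-! ### Paths driven by a control and their time derivative -/

section Drift

/-- The space convolution `∫ φ(u - p) b(p, s) dp`. -/
noncomputable def spaceConv (φ : 𝓢(ℝ, ℝ)) (b : ℝ × ℝ → ℝ) (u s : ℝ) : ℝ :=
  ∫ p, φ (u - p) * b (p, s)

/-- The class of `u ↦ u` in `L²(μ)`. -/
noncomputable def idLp : Lp ℝ 2 stdNormal := (memLp_id_gaussianReal (μ := 0) (v := 1) 2).toLp id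

lemma coeFn_idLp : idLp =ᵐ[stdNormal] fun u => u :=
  (memLp_id_gaussianReal (μ := 0) (v := 1) 2).coeFn_toLp

variable {φ : 𝓢(ℝ, ℝ)} {b : ℝ × ℝ → ℝ}

lemma measurable_spaceConv (hb : Measurable b) :
    Measurable fun x : ℝ × ℝ => spaceConv φ b x.1 x.2 := by
  have h : Measurable fun y : (ℝ × ℝ) × ℝ => φ (y.1.1 - y.2) * b (y.2, y.1.2) :=
    (φ.continuous.measurable.comp (by fun_prop)).mul (hb.comp (by fun_prop))
  exact h.stronglyMeasurable.integral_prod_right.measurable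

lemma lintegral_enorm_sq_eq {α : Type*} [MeasurableSpace α] {m : Measure α} {f : α → ℝ}
    (hf : MemLp f 2 m) : ∫⁻ x, ‖f x‖ₑ ^ 2 ∂m = ENNReal.ofReal (∫ x, f x ^ 2 ∂m) := by
  rw [ofReal_integral_eq_lintegral_ofReal hf.integrable_sq (ae_of_all _ fun x => sq_nonneg _)]
  refine lintegral_congr fun x => ?_
  rw [← ofReal_norm, ← ENNReal.ofReal_pow (norm_nonneg _), Real.norm_eq_abs, sq_abs]

lemma memLp_two_of_lintegral_ne_top {α : Type*} [MeasurableSpace α] {m : Measure α} {f : α → ℝ}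
    (hf : AEStronglyMeasurable f m) (h : ∫⁻ x, ‖f x‖ₑ ^ 2 ∂m ≠ ∞) : MemLp f 2 m := by
  refine ⟨hf, ?_⟩
  rw [eLpNorm_lt_top_iff_lintegral_rpow_enorm_lt_top (by norm_num) (by norm_num)]
  simpa using h.lt_top

lemma ae_memLp_slice (hb : Measurable b) (hfin : ∫⁻ t in Icc (0 : ℝ) 1, ∫⁻ p, ‖b (p, t)‖ₑ ^ 2 ≠ ∞) :
    ∀ᵐ t ∂(volume.restrict (Icc (0 : ℝ) 1)), MemLp (fun p => b (p, t)) 2 volume := by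
  have hm : Measurable fun t => ∫⁻ p, ‖b (p, t)‖ₑ ^ 2 :=
    Measurable.lintegral_prod_left' (hb.enorm.pow_const 2)
  filter_upwards [ae_lt_top hm hfin] with t ht
  exact memLp_two_of_lintegral_ne_top
    (hb.comp measurable_prodMk_right).aestronglyMeasurable ht.ne

/-- The bound `|xy| ≤ x² + y²` is uniform in `u` and integrable in `s` for a square integrable
control, so one majorant serves all the Fubini and Bochner arguments. -/
lemma abs_spaceConv_le {s : ℝ} (hs : MemLp (fun p => b (p, s)) 2 volume) (u : ℝ) :
    |spaceConv φ b u s| ≤ (∫ p, φ p ^ 2) + ∫ p, b (p, s) ^ 2 := by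
  have h1 : Integrable fun p => φ (u - p) ^ 2 := (memLp_comp_sub_left (φ.memLp 2) u).integrable_sq
  have h2 : Integrable fun p => b (p, s) ^ 2 := hs.integrable_sq
  rw [← integral_sub_left_eq_self (fun p => φ p ^ 2) volume u, ← integral_add h1 h2,
    ← Real.norm_eq_abs, spaceConv]
  refine norm_integral_le_of_norm_le (h1.add h2) (ae_of_all _ fun p => ?_)
  rw [Real.norm_eq_abs, abs_mul, ← sq_abs (φ (u - p)), ← sq_abs (b (p, s))]
  nlinarith [sq_nonneg (|φ (u - p)| - |b (p, s)|), sq_nonneg (|φ (u - p)|), sq_nonneg |b (p, s)|]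

lemma memLp_spaceConv (hb : Measurable b) {s : ℝ} (hs : MemLp (fun p => b (p, s)) 2 volume) :
    MemLp (fun u => spaceConv φ b u s) 2 stdNormal :=
  MemLp.of_bound ((measurable_spaceConv hb).comp
    (measurable_prodMk_right (y := s))).aestronglyMeasurable _
    (ae_of_all _ fun u => abs_spaceConv_le hs u)

open Classical in
/-- The drift `∫ φ(· - p) b(p, s) dp` as an element of `L²(μ)`. -/
noncomputable def drift (φ : 𝓢(ℝ, ℝ)) (b : ℝ × ℝ → ℝ) (s : ℝ) : Lp ℝ 2 stdNormal :=
  if h : MemLp (fun u => spaceConv φ b u s) 2 stdNormal then h.toLp else 0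

lemma coeFn_drift (hb : Measurable b) {s : ℝ} (hs : MemLp (fun p => b (p, s)) 2 volume) :
    drift φ b s =ᵐ[stdNormal] fun u => spaceConv φ b u s := by
  rw [drift, dif_pos (memLp_spaceConv hb hs)]
  exact MemLp.coeFn_toLp _

lemma norm_drift_le (hb : Measurable b) {s : ℝ} (hs : MemLp (fun p => b (p, s)) 2 volume) :
    ‖drift φ b s‖ ≤ (∫ p, φ p ^ 2) + ∫ p, b (p, s) ^ 2 := by
  have h0 : 0 ≤ (∫ p, φ p ^ 2) + ∫ p, b (p, s) ^ 2 := by positivity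
  have := Lp.norm_le_of_ae_bound (f := drift φ b s) h0 (by
    filter_upwards [coeFn_drift hb hs] with u hu
    rw [hu]
    exact abs_spaceConv_le hs u)
  simpa [measureUnivNNReal] using this

lemma integrableOn_slice_sq (hb : Measurable b)
    (hfin : ∫⁻ t in Icc (0 : ℝ) 1, ∫⁻ p, ‖b (p, t)‖ₑ ^ 2 ≠ ∞) :
    IntegrableOn (fun s => (∫ p, φ p ^ 2) + ∫ p, b (p, s) ^ 2) (Icc 0 1) := by
  refine Integrable.add (integrable_const _) ?_
  have hm : Measurable fun s => ∫ p, b (p, s) ^ 2 :=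
    (hb.pow_const 2).stronglyMeasurable.integral_prod_left'.measurable
  refine ⟨hm.aestronglyMeasurable, ?_⟩
  refine lt_of_le_of_lt (le_of_eq ?_) hfin.lt_top
  refine lintegral_congr_ae ?_
  filter_upwards [ae_memLp_slice hb hfin] with s hs
  rw [lintegral_enorm_sq_eq hs, Real.enorm_of_nonneg (integral_nonneg fun p => sq_nonneg _)]

lemma inner_drift (hb : Measurable b) {s : ℝ} (hs : MemLp (fun p => b (p, s)) 2 volume)
    (v : Lp ℝ 2 stdNormal) :
    inner ℝ v (drift φ b s) = ∫ u, v u * spaceConv φ b u s ∂stdNormal :=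
  inner_eq_integral_mul_of_ae_eq (ξ := drift φ b) (y := spaceConv φ b) (coeFn_drift hb hs) v

lemma measurable_integral_mul_spaceConv (hb : Measurable b) (v : Lp ℝ 2 stdNormal) :
    Measurable fun s => ∫ u, v u * spaceConv φ b u s ∂stdNormal :=
  measurable_integral_mul (measurable_spaceConv hb) v

/-- Pettis' theorem in the separable Hilbert case, through projections onto finite-dimensional
subspaces. -/
lemma aestronglyMeasurable_of_inner {α E : Type*} [MeasurableSpace α] {m : Measure α}
    [NormedAddCommGroup E] [InnerProductSpace ℝ E] [SecondCountableTopology E] {X : α → E}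
    (hX : ∀ v : E, Measurable fun ω => inner ℝ v (X ω)) : AEStronglyMeasurable X m := by
  borelize E
  exact (measurable_of_tendsto_metrizable (fun n => measurable_starProjection (denseSpan E n) hX)
    (tendsto_pi_nhds.2 fun ω => tendsto_starProjection_denseSpan (X ω))).aestronglyMeasurable

lemma measurable_inner_drift (hb : Measurable b) (v : Lp ℝ 2 stdNormal) :
    Measurable fun s => inner ℝ v (drift φ b s) := by
  have hm (s : ℝ) : AEStronglyMeasurable (fun u => spaceConv φ b u s) stdNormal :=
    ((measurable_spaceConv hb).comp (measurable_prodMk_right (y := s))).aestronglyMeasurable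
  have hset : MeasurableSet {s | ∫⁻ u, ‖spaceConv φ b u s‖ₑ ^ 2 ∂stdNormal ≠ ∞} :=
    (Measurable.lintegral_prod_left' ((measurable_spaceConv hb).enorm.pow_const 2))
      (measurableSet_singleton ∞).compl
  -- Where the slice is not in `L²(μ)` the drift has default value 0, which the indicator
  -- reproduces; measurability thus holds for every `s`.
  have h1 : (fun s => inner ℝ v (drift φ b s))
      = {s | ∫⁻ u, ‖spaceConv φ b u s‖ₑ ^ 2 ∂stdNormal ≠ ∞}.indicator
        fun s => ∫ u, v u * spaceConv φ b u s ∂stdNormal := by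
    ext s
    by_cases hs : ∫⁻ u, ‖spaceConv φ b u s‖ₑ ^ 2 ∂stdNormal ≠ ∞
    · rw [indicator_of_mem (by exact hs)]
      refine inner_eq_integral_mul_of_ae_eq (ξ := drift φ b) (y := spaceConv φ b) ?_ v
      rw [drift, dif_pos (memLp_two_of_lintegral_ne_top (hm s) hs)]
      exact MemLp.coeFn_toLp _
    · rw [indicator_of_notMem (by exact hs), drift, dif_neg, inner_zero_right]
      intro h
      exact hs (by rw [lintegral_enorm_sq_eq h]; exact ENNReal.ofReal_ne_top)
  rw [h1]
  exact (measurable_integral_mul_spaceConv hb v).indicator hset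

lemma integrableOn_drift (hb : Measurable b)
    (hfin : ∫⁻ t in Icc (0 : ℝ) 1, ∫⁻ p, ‖b (p, t)‖ₑ ^ 2 ≠ ∞) :
    IntegrableOn (drift φ b) (Icc 0 1) := by
  refine (integrableOn_slice_sq (φ := φ) hb hfin).mono'
    (aestronglyMeasurable_of_inner (measurable_inner_drift hb)) ?_
  filter_upwards [ae_memLp_slice hb hfin] with s hs using norm_drift_le hb hs

/-- The Bochner integral in `L²(μ)` and the pointwise integral have the same scalar product with
every `v`, by Fubini. -/
lemma integral_drift (hb : Measurable b)
    (hfin : ∫⁻ t in Icc (0 : ℝ) 1, ∫⁻ p, ‖b (p, t)‖ₑ ^ 2 ≠ ∞) {t : ℝ} (ht : t ∈ Icc (0 : ℝ) 1) :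
    (∫ s in (0 : ℝ)..t, drift φ b s : Lp ℝ 2 stdNormal) =ᵐ[stdNormal]
      fun u => ∫ s in (0 : ℝ)..t, spaceConv φ b u s := by
  have hsub : Ioc 0 t ⊆ Icc (0 : ℝ) 1 := fun s hs => ⟨hs.1.le, hs.2.trans ht.2⟩
  have hgood : ∀ᵐ s ∂(volume.restrict (Ioc 0 t)), MemLp (fun p => b (p, s)) 2 volume :=
    ae_restrict_of_ae_restrict_of_subset hsub (ae_memLp_slice hb hfin)
  have hbd : IntegrableOn (fun s => (∫ p, φ p ^ 2) + ∫ p, b (p, s) ^ 2) (Ioc 0 t) :=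
    (integrableOn_slice_sq (φ := φ) hb hfin).mono_set hsub
  have hmeas : Measurable fun u => ∫ s in (0 : ℝ)..t, spaceConv φ b u s := by
    simp_rw [intervalIntegral.integral_of_le ht.1]
    exact (measurable_spaceConv hb).stronglyMeasurable.integral_prod_right'.measurable
  have hmem : MemLp (fun u => ∫ s in (0 : ℝ)..t, spaceConv φ b u s) 2 stdNormal := by
    refine MemLp.of_bound hmeas.aestronglyMeasurable
      (∫ s in Ioc 0 t, ((∫ p, φ p ^ 2) + ∫ p, b (p, s) ^ 2)) (ae_of_all _ fun u => ?_)
    rw [intervalIntegral.integral_of_le ht.1]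
    exact norm_integral_le_of_norm_le hbd (hgood.mono fun s hs => abs_spaceConv_le hs u)
  have heq : (∫ s in (0 : ℝ)..t, drift φ b s) = hmem.toLp := by
    refine ext_inner_left ℝ fun v => ?_
    have hint : Integrable (fun x : ℝ × ℝ => v x.2 * spaceConv φ b x.2 x.1)
        ((volume.restrict (Ioc 0 t)).prod stdNormal) := by
      refine Integrable.mono' (hbd.mul_prod ((Lp.memLp v).integrable (by norm_num)).norm)
        (((measurable_coeFn_Lp v).comp measurable_snd).mul
          ((measurable_spaceConv hb).comp measurable_swap)).aestronglyMeasurable ?_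
      filter_upwards [Measure.quasiMeasurePreserving_fst.ae hgood] with x hx
      rw [norm_mul, mul_comm]
      gcongr
      exact abs_spaceConv_le hx _
    rw [intervalIntegral.integral_of_le ht.1,
      ← integral_inner ((integrableOn_drift hb hfin).mono_set hsub) v]
    have h1 : ∫ s in Ioc 0 t, inner ℝ v (drift φ b s)
        = ∫ s in Ioc 0 t, ∫ u, v u * spaceConv φ b u s ∂stdNormal :=
      integral_congr_ae (hgood.mono fun s hs => inner_drift hb hs v)
    rw [h1, integral_integral_swap hint, L2.inner_def]
    refine integral_congr_ae ?_
    filter_upwards [hmem.coeFn_toLp] with u hu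
    rw [hu, integral_const_mul, intervalIntegral.integral_of_le ht.1]
    simp [mul_comm]
  rw [heq]
  exact hmem.coeFn_toLp

lemma timeDeriv_ae_eq_drift (hb : Measurable b)
    (hfin : ∫⁻ t in Icc (0 : ℝ) 1, ∫⁻ p, ‖b (p, t)‖ₑ ^ 2 ≠ ∞) {h : PathSpace}
    (hh : ∀ t : Icc (0 : ℝ) 1, (h t : ℝ → ℝ) =ᵐ[stdNormal]
      fun u => u + ∫ s in (0 : ℝ)..t, spaceConv φ b u s) :
    ∀ᵐ t ∂(volume.restrict (Icc (0 : ℝ) 1)), timeDeriv h t = drift φ b t := by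
  have hval (t : Icc (0 : ℝ) 1) : h t = idLp + ∫ s in (0 : ℝ)..t, drift φ b s := by
    refine Lp.ext ?_
    filter_upwards [hh t, coeFn_idLp, integral_drift (φ := φ) hb hfin t.2,
      Lp.coeFn_add idLp (∫ s in (0 : ℝ)..t, drift φ b s)] with u h1 h2 h3 h4
    rw [h1, h4, Pi.add_apply, h2, h3]
  have hII : IntervalIntegrable (drift φ b) volume 0 1 := by
    rw [intervalIntegrable_iff_integrableOn_Icc_of_le zero_le_one]
    exact integrableOn_drift hb hfin
  have hderiv := hII.ae_hasDerivAt_integral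
  -- The endpoints are discarded because `IccExtend` agrees with the path on a neighbourhood only at
  -- interior times; Lebesgue differentiation then gives the derivative.
  rw [← restrict_Ioo_eq_restrict_Icc, ae_restrict_iff' measurableSet_Ioo]
  filter_upwards [hderiv] with t ht hmem
  rw [uIcc_of_le zero_le_one] at ht
  have h1 := (ht (Ioo_subset_Icc_self hmem) 0 (by simp)).const_add idLp
  refine (h1.congr_of_eventuallyEq ?_).deriv
  filter_upwards [Ioo_mem_nhds hmem.1 hmem.2] with s hs
  rw [IccExtend_of_mem _ _ (Ioo_subset_Icc_self hs), hval]

/-- The rate function is the energy of the control. -/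
lemma rateFunction_eq (hφ : ∀ᵐ l : ℝ ∂volume, fourierInt φ l ≠ 0) (hb : Measurable b)
    (hfin : ∫⁻ t in Icc (0 : ℝ) 1, ∫⁻ p, ‖b (p, t)‖ₑ ^ 2 ≠ ∞) {h : PathSpace}
    (hmem : h ∈ skeletonSet φ)
    (hh : ∀ t : Icc (0 : ℝ) 1, (h t : ℝ → ℝ) =ᵐ[stdNormal]
      fun u => u + ∫ s in (0 : ℝ)..t, spaceConv φ b u s) :
    rateFunction φ h
      = ENNReal.ofReal (1 / 2) * ∫⁻ t in Icc (0 : ℝ) 1, ∫⁻ p, ‖b (p, t)‖ₑ ^ 2 := by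
  rw [rateFunction, if_pos hmem]
  have h1 : ∫⁻ t in Icc (0 : ℝ) 1, ∫⁻ l : ℝ,
        ‖fourierL2 (timeDeriv h t : ℝ → ℝ) l / fourierInt φ l‖ₑ ^ 2
      = ∫⁻ t in Icc (0 : ℝ) 1, ENNReal.ofReal (2 * Real.pi) * ∫⁻ p, ‖b (p, t)‖ₑ ^ 2 := by
    refine lintegral_congr_ae ?_
    filter_upwards [timeDeriv_ae_eq_drift hb hfin hh, ae_memLp_slice hb hfin] with t h2 h3
    refine lintegral_fourierL2_convolution_div φ hφ h3 ?_
    rw [h2]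
    -- Lebesgue measure is absolutely continuous with respect to `μ`, so a representative in `L²(μ)`
    -- determines the function Lebesgue almost everywhere.
    exact (gaussianReal_absolutelyContinuous' 0 one_ne_zero).ae_le (coeFn_drift hb h3)
  rw [h1, lintegral_const_mul' _ _ ENNReal.ofReal_ne_top, ← mul_assoc,
    ← ENNReal.ofReal_mul (by positivity)]
  congr 2
  field_simp
  norm_num

end Drift

/-! ### The rate function as least control energy -/

section Skeleton

variable {φ : 𝓢(ℝ, ℝ)}

/-- The strip `ℝ × [0, 1]`. -/
abbrev strip : Set (ℝ × ℝ) := univ ×ˢ Icc (0 : ℝ) 1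

lemma measurableSet_strip : MeasurableSet strip := MeasurableSet.univ.prod measurableSet_Icc

lemma halfPlaneMeasure_restrict_strip :
    halfPlaneMeasure.restrict strip = volume.restrict strip := by
  rw [halfPlaneMeasure, Measure.restrict_restrict measurableSet_strip,
    inter_eq_left.2 (prod_mono le_rfl fun s hs => hs.1)]

lemma lintegral_strip {f : ℝ × ℝ → ℝ≥0∞} (hf : Measurable f) :
    ∫⁻ x in strip, f x = ∫⁻ t in Icc (0 : ℝ) 1, ∫⁻ p, f (p, t) := by
  rw [Measure.volume_eq_prod, ← Measure.prod_restrict, Measure.restrict_univ,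
    lintegral_prod_symm' _ hf]

lemma enorm_sq_eq_lintegral (b : Lp ℝ 2 halfPlaneMeasure) :
    ‖b‖ₑ ^ 2 = ∫⁻ x, ‖b x‖ₑ ^ 2 ∂halfPlaneMeasure := by
  rw [lintegral_enorm_sq_eq (Lp.memLp b), ← norm_sq_eq_integral_sq, ← ofReal_norm,
    ENNReal.ofReal_pow (norm_nonneg _)]

lemma lintegral_strip_le (b : Lp ℝ 2 halfPlaneMeasure) :
    ∫⁻ t in Icc (0 : ℝ) 1, ∫⁻ p, ‖b (p, t)‖ₑ ^ 2 ≤ ‖b‖ₑ ^ 2 := by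
  rw [← lintegral_strip ((measurable_coeFn_Lp b).enorm.pow_const 2),
    ← halfPlaneMeasure_restrict_strip, enorm_sq_eq_lintegral]
  exact setLIntegral_le_lintegral _ _

lemma mem_skeletonSet (b : Lp ℝ 2 halfPlaneMeasure) {h : PathSpace}
    (hh : ∀ t : Icc (0 : ℝ) 1, (h t : ℝ → ℝ) =ᵐ[stdNormal]
      fun u => u + ∫ s in (0 : ℝ)..t, spaceConv φ b u s) : h ∈ skeletonSet φ :=
  ⟨b, halfPlaneMeasure_restrict_strip ▸ (Lp.memLp b).restrict strip, hh⟩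

/-- The control is extended by zero outside the strip, so that its full norm is its energy on the
strip. -/
lemma exists_of_mem_skeletonSet {h : PathSpace} (hmem : h ∈ skeletonSet φ) :
    ∃ b : Lp ℝ 2 halfPlaneMeasure,
      ‖b‖ₑ ^ 2 ≤ ∫⁻ t in Icc (0 : ℝ) 1, ∫⁻ p, ‖b (p, t)‖ₑ ^ 2 ∧
      ∀ t : Icc (0 : ℝ) 1, (h t : ℝ → ℝ) =ᵐ[stdNormal]
        fun u => u + ∫ s in (0 : ℝ)..t, spaceConv φ b u s := by
  obtain ⟨a, ha, hha⟩ := hmem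
  have hmem : MemLp (strip.indicator a) 2 halfPlaneMeasure := by
    rw [memLp_indicator_iff_restrict measurableSet_strip, halfPlaneMeasure_restrict_strip]
    exact ha
  have hae := hmem.coeFn_toLp
  refine ⟨hmem.toLp, ?_, fun t => ?_⟩
  · rw [← lintegral_strip ((measurable_coeFn_Lp _).enorm.pow_const 2),
      ← halfPlaneMeasure_restrict_strip, enorm_sq_eq_lintegral,
      ← lintegral_indicator measurableSet_strip]
    refine (lintegral_congr_ae ?_).le
    filter_upwards [hae] with x hx
    by_cases hs : x ∈ strip
    · rw [indicator_of_mem hs]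
    · rw [indicator_of_notMem hs, hx, indicator_of_notMem hs]
      simp
  · have hslice : ∀ᵐ s ∂(volume.restrict (Ici (0 : ℝ))), ∀ᵐ p : ℝ,
        (hmem.toLp : ℝ × ℝ → ℝ) (p, s) = strip.indicator a (p, s) := by
      have h1 : ∀ᵐ x ∂((volume : Measure ℝ).prod (volume.restrict (Ici (0 : ℝ)))),
          (hmem.toLp : ℝ × ℝ → ℝ) x = strip.indicator a x := by
        rw [← halfPlaneMeasure_eq_prod]
        exact hae
      exact Measure.ae_ae_of_ae_prod (Measure.measurePreserving_swap.quasiMeasurePreserving.ae h1)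
    refine (hha t).trans (ae_of_all _ fun u => ?_)
    simp only
    congr 1
    rw [intervalIntegral.integral_of_le t.2.1, intervalIntegral.integral_of_le t.2.1]
    refine integral_congr_ae ?_
    have hsub : Ioc 0 (t : ℝ) ⊆ Ici 0 := fun s hs => hs.1.le
    filter_upwards [ae_restrict_of_ae_restrict_of_subset hsub hslice,
      ae_restrict_mem measurableSet_Ioc] with s hs hst
    refine integral_congr_ae ?_
    filter_upwards [hs] with p hp
    rw [hp, indicator_of_mem (show (p, s) ∈ strip from ⟨mem_univ _, hst.1.le, hst.2.trans t.2.2⟩)]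

/-- The rate function is the least energy of a control that steers to the given path. -/
lemma rateFunction_eq_iInf (hφ : ∀ᵐ l : ℝ ∂volume, fourierInt φ l ≠ 0)
    {S : Lp ℝ 2 halfPlaneMeasure → PathSpace}
    (hS : ∀ b, ∀ t : Icc (0 : ℝ) 1, (S b t : ℝ → ℝ) =ᵐ[stdNormal]
      fun u => u + ∫ s in (0 : ℝ)..t, spaceConv φ b u s) (h : PathSpace) :
    rateFunction φ h = ⨅ (b : Lp ℝ 2 halfPlaneMeasure) (_ : S b = h),
      ENNReal.ofReal (‖b‖ ^ 2 / 2) := by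
  have hnorm (b : Lp ℝ 2 halfPlaneMeasure) :
      ENNReal.ofReal (‖b‖ ^ 2 / 2) = ENNReal.ofReal (1 / 2) * ‖b‖ₑ ^ 2 := by
    rw [← ofReal_norm, ← ENNReal.ofReal_pow (norm_nonneg _), ← ENNReal.ofReal_mul (by norm_num)]
    congr 1
    ring
  have hrate (b : Lp ℝ 2 halfPlaneMeasure) : rateFunction φ (S b)
      = ENNReal.ofReal (1 / 2) * ∫⁻ t in Icc (0 : ℝ) 1, ∫⁻ p, ‖b (p, t)‖ₑ ^ 2 :=
    rateFunction_eq hφ (measurable_coeFn_Lp b)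
      ((lintegral_strip_le b).trans_lt (by finiteness)).ne (mem_skeletonSet b (hS b)) (hS b)
  refine le_antisymm ?_ ?_
  -- Any steering control computes the rate from its restriction to the strip; energy spent after
  -- time 1 only increases the norm. The reverse inequality uses the control that vanishes off the
  -- strip.
  · refine le_iInf₂ fun b hb => ?_
    rw [← hb, hrate, hnorm]
    gcongr
    exact lintegral_strip_le b
  · by_cases hmem : h ∈ skeletonSet φ
    · obtain ⟨b, hb, hhb⟩ := exists_of_mem_skeletonSet hmem
      have hbh : S b = h := by
        ext1 t
        exact Lp.ext ((hS b t).trans (hhb t).symm)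
      refine (iInf₂_le b hbh).trans ?_
      rw [← hbh, hrate, hnorm]
      gcongr
    · rw [rateFunction, if_neg hmem]
      exact le_top

end Skeleton

/-! ### Identification of all versions of the field -/

section WhiteNoiseField

lemma SatisfiesLDP.congr {𝔛 Ω : Type*} [TopologicalSpace 𝔛] [MeasurableSpace Ω] {P : Measure Ω}
    {Y Z : ℝ → Ω → 𝔛} {I : 𝔛 → ℝ≥0∞} (h : SatisfiesLDP P Y I)
    (hYZ : ∀ ε, 0 < ε → Z ε =ᵐ[P] Y ε) : SatisfiesLDP P Z I := by
  have key (A : Set 𝔛) : (fun ε : ℝ => (ε : EReal) * ENNReal.log (P {ω | Z ε ω ∈ A}))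
      =ᶠ[𝓝[>] 0] fun ε : ℝ => (ε : EReal) * ENNReal.log (P {ω | Y ε ω ∈ A}) := by
    filter_upwards [self_mem_nhdsWithin] with ε hε
    congr 2
    refine measure_congr ?_
    filter_upwards [hYZ ε hε] with ω hω
    exact propext (by change Z ε ω ∈ A ↔ Y ε ω ∈ A; rw [hω])
  refine ⟨h.1, fun F hF => ?_, fun G hG => ?_⟩
  · rw [limsup_congr (key F)]
    exact h.2 F hF
  · rw [liminf_congr (key G)]
    exact h.3 G hG

variable {Ω : Type*} [MeasurableSpace Ω] {P : Measure Ω} [IsProbabilityMeasure P]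
  {W : Set (ℝ × ℝ) → Ω → ℝ} {φ : 𝓢(ℝ, ℝ)} {C : ℝ}

lemma isField_fieldVersion (hW : IsWhiteNoise W halfPlaneMeasure P) (hC : 0 ≤ C)
    (hk : ∀ u u', ∀ t ∈ Icc (0 : ℝ) 1, ∀ t' ∈ Icc (0 : ℝ) 1,
      ‖kernel φ u t - kernel φ u' t'‖ ^ 2 ≤ C * (|u - u'| + |t - t'|)) (ε : ℝ) :
    IsField W P φ ε fun u t ω => u + √ε * fieldVersion (wiener hW) (kernel φ) u t ω := by
  intro u t ht
  refine ⟨wiener hW (kernel φ u t), hasWienerIntegral_wiener hW (memLp_kernel φ u t), ?_⟩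
  filter_upwards [fieldVersion_ae_eq (J := wiener hW) hC hk u ht] with ω hω
  rw [hω]

lemma IsField.ae_eq {ε : ℝ} {y : ℝ → ℝ → Ω → ℝ} (hy : IsField W P φ ε y)
    (hW : IsWhiteNoise W halfPlaneMeasure P) (hC : 0 ≤ C)
    (hk : ∀ u u', ∀ t ∈ Icc (0 : ℝ) 1, ∀ t' ∈ Icc (0 : ℝ) 1,
      ‖kernel φ u t - kernel φ u' t'‖ ^ 2 ≤ C * (|u - u'| + |t - t'|)) (u : ℝ) {t : ℝ}
    (ht : t ∈ Icc (0 : ℝ) 1) :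
    y u t =ᵐ[P] fun ω => u + √ε * fieldVersion (wiener hW) (kernel φ) u t ω := by
  obtain ⟨J, hJ, hyJ⟩ := hy u t ht
  filter_upwards [hyJ, hJ.ae_eq hW, fieldVersion_ae_eq (J := wiener hW) hC hk u ht]
    with ω h1 h2 h3
  rw [h1, h3, h2]
  rfl

/-- The path `t ↦ (u ↦ u)`. -/
noncomputable def idPath : PathSpace := ContinuousMap.const _ idLp

lemma coeFn_idPath_add {c : ℝ} {x : PathSpace} {t : Icc (0 : ℝ) 1} {f : ℝ → ℝ}
    (hx : (x t : ℝ → ℝ) =ᵐ[stdNormal] f) :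
    ((idPath + c • x) t : ℝ → ℝ) =ᵐ[stdNormal] fun u => u + c * f u := by
  filter_upwards [hx, coeFn_idLp, Lp.coeFn_add idLp (c • x t), Lp.coeFn_smul c (x t)]
    with u h1 h2 h3 h4
  change (idLp + c • x t) u = _
  rw [h3, Pi.add_apply, h4, Pi.smul_apply, h1, h2, smul_eq_mul]

/-- Joint measurability lets Fubini exchange "for each `u`, almost surely" with "almost surely, for
almost every `u`". This is done on a countable dense set of times, and continuity of paths extends
it to all times. -/
lemma IsFieldElement.ae_eq {ε : ℝ} {Y : Ω → PathSpace} (hY : IsFieldElement W P φ ε Y)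
    (hW : IsWhiteNoise W halfPlaneMeasure P) (hC : 0 ≤ C)
    (hk : ∀ u u', ∀ t ∈ Icc (0 : ℝ) 1, ∀ t' ∈ Icc (0 : ℝ) 1,
      ‖kernel φ u t - kernel φ u' t'‖ ^ 2 ≤ C * (|u - u'| + |t - t'|)) {X : Ω → PathSpace}
    (hX : ∀ᵐ ω ∂P, ∀ t : Icc (0 : ℝ) 1,
      X ω t =ᵐ[stdNormal] fun u => fieldVersion (wiener hW) (kernel φ) u t ω) :
    Y =ᵐ[P] fun ω => idPath + √ε • X ω := by
  obtain ⟨-, y, hy, hym, hYy⟩ := hY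
  have h1 (t : Icc (0 : ℝ) 1) : ∀ᵐ ω ∂P, ∀ᵐ u ∂stdNormal,
      y u t ω = u + √ε * fieldVersion (wiener hW) (kernel φ) u t ω := by
    have hm : MeasurableSet {x : Ω × ℝ |
        y x.2 t x.1 = x.2 + √ε * fieldVersion (wiener hW) (kernel φ) x.2 t x.1} :=
      measurableSet_eq_fun ((hym t t.2).comp measurable_swap) (measurable_snd.add
        (((measurable_fieldVersion (wiener hW) (kernel φ) t).comp measurable_swap).const_mul _))
    refine (Measure.ae_ae_comm (p := fun ω u =>
      y u t ω = u + √ε * fieldVersion (wiener hW) (kernel φ) u t ω) hm).2 ?_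
    exact ae_of_all _ fun u => hy.ae_eq hW hC hk u t.2
  have h2 : ∀ᵐ ω ∂P, ∀ n : ℕ, ∀ᵐ u ∂stdNormal,
      y u (TopologicalSpace.denseSeq (Icc (0 : ℝ) 1) n) ω
        = u + √ε * fieldVersion (wiener hW) (kernel φ) u
          (TopologicalSpace.denseSeq (Icc (0 : ℝ) 1) n) ω :=
    ae_all_iff.2 fun n => h1 _
  filter_upwards [h2, hYy, hX] with ω h3 h4 h5
  refine DFunLike.coe_injective ?_
  refine (TopologicalSpace.denseRange_denseSeq (Icc (0 : ℝ) 1)).equalizer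
    (Y ω).continuous (idPath + √ε • X ω).continuous ?_
  ext1 n
  exact Lp.ext ((h4 _).trans (EventuallyEq.trans (h3 n) (coeFn_idPath_add (h5 _)).symm))

end WhiteNoiseField

end FlowLDP

theorem theorem2p1 {Ω : Type*} [MeasurableSpace Ω] (P : Measure Ω) [IsProbabilityMeasure P]
    (W : Set (ℝ × ℝ) → Ω → ℝ) (hW : FlowLDP.IsWhiteNoise W FlowLDP.halfPlaneMeasure P)
    (φ : 𝓢(ℝ, ℝ)) (hφ : ∀ᵐ l : ℝ ∂volume, FlowLDP.fourierInt φ l ≠ 0) :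
    (∀ ε : ℝ, 0 < ε → ∃ Y : Ω → FlowLDP.PathSpace, FlowLDP.IsFieldElement W P φ ε Y) ∧
    ∀ Y : ℝ → Ω → FlowLDP.PathSpace,
      (∀ ε : ℝ, 0 < ε → FlowLDP.IsFieldElement W P φ ε (Y ε)) →
        FlowLDP.SatisfiesLDP P Y (FlowLDP.rateFunction φ) := by
  obtain ⟨C, hC, hk, hk0⟩ := FlowLDP.exists_kernel_bounds φ
  have hJ := FlowLDP.isIsonormal_wiener hW
  borelize FlowLDP.PathSpace
  obtain ⟨X, hXm, hX⟩ := hJ.exists_pathElement (μ := FlowLDP.stdNormal) hC hk hk0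
  have hXJ := hJ.exists_dual_ae_eq hC hk hk0 hX
  refine ⟨fun ε _ => ⟨fun ω => FlowLDP.idPath + √ε • X ω, ?_, _,
    FlowLDP.isField_fieldVersion hW hC hk ε, fun t _ => ?_, ?_⟩, fun Y hY => ?_⟩
  · exact (hXm.const_smul √ε).const_add FlowLDP.idPath
  · exact measurable_fst.add ((FlowLDP.measurable_fieldVersion _ _ t).const_mul _)
  · filter_upwards [hX] with ω h t using FlowLDP.coeFn_idPath_add (h t)
  · have hX2 := FlowLDP.memLp_two_of_dual hJ hXm hXJ
    refine (FlowLDP.satisfiesLDP_gaussian hJ hXm hXJ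
      (fun n => FlowLDP.finiteDimensional_range_bernsteinProj n (FlowLDP.denseSpan _ n))
      FlowLDP.tendsto_bernsteinProj hX2 FlowLDP.idPath
      (FlowLDP.rateFunction_eq_iInf hφ fun b t => ?_)).congr
      fun ε hε => (hY ε hε).ae_eq hW hC hk hX
    have h1 := FlowLDP.correlationOp_pathElement_apply hC hk hk0 hX hX2 b t
    -- The skeleton path carries no `√ε`, so the shift by the identity path is used with factor 1.
    have h2 := FlowLDP.coeFn_idPath_add (c := 1) h1
    rw [one_smul] at h2
    filter_upwards [h2] with u hu
    rw [hu, one_mul, FlowLDP.inner_kernel φ b u t.2.1]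
    rfl
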